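/- Let $L,\lambda,\ell>0$ and let $\mathcal A y=-y''''-\lambda y''$ on $L^2(0,L)$, with domain $D(\mathcal A)$ the set of $y\in H^4(0,L)$ satisfying one (fixed) of the following sets of boundary conditions: clamped, $y=y'=0$ at $x=0,L$; hinged, $y=y''=0$ at $x=0,L$; or Cahn–Hilliard, $y'=y'''=0$ at $x=0,L$. Let $\sigma_1,\dots,\sigma_n\ge 0$ be all the non-negative eigenvalues of $\mathcal A$, repeated according to multiplicity, with associated $L^2$-orthonormal eigenfunctions $e_1,\dots,e_n$; for $y\in L^2(0,L)$ write $z(y)=(\langle y,e_1\rangle,\dots,\langle y,e_n\rangle)^\top\in\mathbb R^n$. Let $b_1,\dots,b_m\in L^2(0,L)$, $\mathbf A=\operatorname{diag}(\sigma_1,\dots,\sigma_n)$ and $\mathbf B=(\langle b_k,e_j\rangle)_{j,k}\in\mathbb R^{n\times m}$, and let $\mathrm{sat}(s)=s$ if $|s|\le\ell$, $\mathrm{sat}(s)=\ell\,\mathrm{sgn}(s)$ otherwise. Let $\mathbf K\in\mathbb R^{m\times n}$ be such that $\mathbf A+\mathbf B\mathbf K$ is Hurwitz, and let $\mathbf P\in\mathbb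 R^{n\times n}$ be symmetric positive definite, $\mathbf D\in\mathbb R^{m\times m}$ diagonal positive definite and $\mathbf C\in\mathbb R^{m\times n}$ such that $$\begin{pmatrix}(\mathbf A+\mathbf{BK})^\top\mathbf P+\mathbf P(\mathbf A+\mathbf{BK}) & \mathbf{PB}-(\mathbf{DC})^\top\\ (\mathbf{PB})^\top-\mathbf{DC} & -2\mathbf D\end{pmatrix}\prec 0,\qquad \begin{pmatrix}\mathbf P & (\mathbf K-\mathbf C)^\top\\ \mathbf K-\mathbf C & \ell^2\mathbf I_m\end{pmatrix}\succeq 0 .$$ Put $\mathcal R=\{z\in\mathbb R^n: z^\top\mathbf Pz\le 1\}$. Then there are constants $C,a>0$ such that for every $y_0\in H^2(0,L)$ that satisfies those of the chosen boundary conditions which involve derivatives of order at most $1$, and for which $z(y_0)\in\mathcal R$, the closed-loop system $$\partial_t y+\lambda\partial_x^2y+\partial_x^4y=\sum_{k=1}^m b_k\,\mathrm{sat}\big((\mathbf K z(y(t,\cdot)))_k\big),\qquad y(0,\cdot)=y_0,$$ with the chosen boundary conditions has a unique solution $y$ which lies in $C([0,T];H^2(0,L))\cap L^2(0,T;H^4(0,L))$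 for every $T>0$ (it is also unique on each interval $[0,T]$), and $$\|y(t,\cdot)\|_{H^2(0,L)}\le C e^{-at}\|y_0\|_{H^2(0,L)}\qquad\text{for all } t>0 .$$ -/

import Mathlib

open Set MeasureTheory
open scoped Matrix ContDiff

noncomputable section

namespace SaturatedKS

/-! ### Function spaces on the interval `(0, L)` -/

/-- The Hilbert space `L²(0, L)` of real functions. -/
abbrev L2 (L : ℝ) : Type := Lp ℝ 2 (volume.restrict (Ioo (0 : ℝ) L))

/-- `v ∈ L²(0, L)` is the weak (distributional) derivative of order `k` of `u` on `(0, L)`. -/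
def HasWeakDeriv (L : ℝ) (k : ℕ) (u v : L2 L) : Prop :=
  ∀ φ : ℝ → ℝ, ContDiff ℝ ∞ φ → HasCompactSupport φ → tsupport φ ⊆ Ioo 0 L →
    ∫ x in Ioo 0 L, u x * iteratedDeriv k φ x = (-1) ^ k * ∫ x in Ioo 0 L, v x * φ x

/-- Weak derivatives are unique. -/
theorem HasWeakDeriv.unique {L : ℝ} {k : ℕ} {u v w : L2 L}
    (hv : HasWeakDeriv L k u v) (hw : HasWeakDeriv L k u w) : v = w := by
  have hint : ∀ f : L2 L, LocallyIntegrableOn f (Ioo 0 L) := fun f =>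
    IntegrableOn.locallyIntegrableOn (μ := volume) ((Lp.memLp f).integrable (by norm_num))
  have key : ∀ᵐ x ∂(volume : Measure ℝ), x ∈ Ioo 0 L → (v x - w x) = 0 := by
    refine isOpen_Ioo.ae_eq_zero_of_integral_contDiff_smul_eq_zero
      ((hint v).sub (hint w)) ?_
    intro g hg hgc hgs
    have h := (hv g hg hgc hgs).symm.trans (hw g hg hgc hgs)
    have h2 : ∫ x in Ioo 0 L, v x * g x = ∫ x in Ioo 0 L, w x * g x :=
      mul_left_cancel₀ (pow_ne_zero k (by norm_num)) h
    obtain ⟨c, hc⟩ := hgc.exists_bound_of_continuous hg.continuous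
    have hI : ∀ f : L2 L, Integrable (fun x => f x * g x) (volume.restrict (Ioo 0 L)) := fun f =>
      ((Lp.memLp f).integrable (by norm_num)).mul_bdd (c := c)
        hg.continuous.aestronglyMeasurable (Filter.Eventually.of_forall hc)
    rw [← setIntegral_eq_integral_of_forall_compl_eq_zero (s := Ioo 0 L)]
    · have : ∀ x, g x • (v x - w x) = v x * g x - w x * g x := fun x => by
        simp only [smul_eq_mul]; ring
      simp only [this]
      rw [integral_sub (hI v) (hI w), h2, sub_self]
    · intro x hx
      have : g x = 0 := by
        by_contra h0
        exact hx (hgs (subset_tsupport g h0))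
      simp [this]
  refine Lp.ext ?_
  rw [Filter.EventuallyEq, ae_restrict_iff' measurableSet_Ioo]
  filter_upwards [key] with x hx h
  exact sub_eq_zero.mp (hx h)

open Classical in
/-- The weak derivative of order `k` of `u` (zero when it does not exist in `L²(0, L)`). -/
def weakDeriv (L : ℝ) (k : ℕ) (u : L2 L) : L2 L :=
  if h : ∃ v, HasWeakDeriv L k u v then h.choose else 0

/-- `u ∈ H^s(0, L)`: all weak derivatives up to order `s` exist in `L²(0, L)`. -/
def MemSobolev (L : ℝ) (s : ℕ) (u : L2 L) : Prop :=
  ∀ k ≤ s, ∃ v, HasWeakDeriv L k u v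

/-- The usual norm of `H^s(0, L)`. -/
def sobolevNorm (L : ℝ) (s : ℕ) (u : L2 L) : ℝ :=
  Real.sqrt (∑ k ∈ Finset.range (s + 1), ‖weakDeriv L k u‖ ^ 2)

/-- `v` has a representative that is continuous on `[0, L]` and vanishes at both end points
(for `L > 0` a continuous representative is unique on `[0, L]`). -/
def VanishesAtEnds (L : ℝ) (v : L2 L) : Prop :=
  ∃ g : ℝ → ℝ, ContinuousOn g (Icc 0 L) ∧ v =ᵐ[volume.restrict (Ioo 0 L)] g ∧ g 0 = 0 ∧ g L = 0

/-! ### Boundary conditions and the spatial operator -/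

/-- The three admissible sets of boundary conditions. -/
inductive BoundaryCondition
  | clamped
  | hinged
  | cahnHilliard

/-- The orders of the derivatives that are required to vanish at `0` and at `L`. -/
def BoundaryCondition.orders : BoundaryCondition → Set ℕ
  | .clamped => {0, 1}
  | .hinged => {0, 2}
  | .cahnHilliard => {1, 3}

/-- The boundary conditions `bc` that have a meaning in `H^s(0, L)`, i.e. those on derivatives of
order less than `s`. -/
def SatisfiesBC (L : ℝ) (bc : BoundaryCondition) (s : ℕ) (u : L2 L) : Prop :=
  ∀ k ∈ bc.orders, k < s → VanishesAtEnds L (weakDeriv L k u)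

/-- The domain `D(𝒜)`: in one space dimension `u ∈ L²` and `-u'''' - λ u'' ∈ L²` mean `u ∈ H⁴`. -/
def MemDomain (L : ℝ) (bc : BoundaryCondition) (u : L2 L) : Prop :=
  MemSobolev L 4 u ∧ SatisfiesBC L bc 4 u

/-- The operator `𝒜 u = -u'''' - λ u''`. -/
def opA (L lam : ℝ) (u : L2 L) : L2 L :=
  -weakDeriv L 4 u - lam • weakDeriv L 2 u

/-- `u` belongs to `D(𝒜)` and `𝒜 u = μ u`. -/
def IsEigen (L lam : ℝ) (bc : BoundaryCondition) (μ : ℝ) (u : L2 L) : Prop :=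
  MemDomain L bc u ∧ opA L lam u = μ • u

/-- `σ₁, …, σₙ` are all the non-negative eigenvalues of `𝒜`, repeated according to multiplicity,
and `e₁, …, eₙ` are associated orthonormal eigenfunctions. -/
structure IsUnstableBasis (L lam : ℝ) (bc : BoundaryCondition) {n : ℕ}
    (σ : Fin n → ℝ) (e : Fin n → L2 L) : Prop where
  orthonormal : Orthonormal ℝ e
  eigen : ∀ j, IsEigen L lam bc (σ j) (e j)
  nonneg : ∀ j, 0 ≤ σ j
  complete : ∀ (μ : ℝ) (u : L2 L), 0 ≤ μ → IsEigen L lam bc μ u →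
    u ∈ Submodule.span ℝ (range e)

/-- The coordinates `z = (⟨u, e₁⟩, …, ⟨u, eₙ⟩)` of the projection of `u` on the unstable space. -/
def modes {L : ℝ} {n : ℕ} (e : Fin n → L2 L) (u : L2 L) : Fin n → ℝ :=
  fun j => inner ℝ u (e j)

/-! ### Saturated feedback -/

/-- The scalar saturation of level `ℓ`. -/
def sat (ℓ s : ℝ) : ℝ := if |s| ≤ ℓ then s else ℓ * Real.sign s

/-- The matrix `B = (⟨bₖ, eⱼ⟩)` of size `n × m`. -/
def controlMatrix {L : ℝ} {m n : ℕ} (b : Fin m → L2 L) (e : Fin n → L2 L) :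
    Matrix (Fin n) (Fin m) ℝ :=
  Matrix.of fun j k => inner ℝ (b k) (e j)

/-- The saturated feedback `∑ₖ bₖ sat((K z)ₖ)`, `z` being the unstable modes of `u`. -/
def feedback {L : ℝ} {m n : ℕ} (ℓ : ℝ) (b : Fin m → L2 L) (e : Fin n → L2 L)
    (K : Matrix (Fin m) (Fin n) ℝ) (u : L2 L) : L2 L :=
  ∑ k, sat ℓ ((K *ᵥ modes e u) k) • b k

/-- `y` is a solution on `[0, T]` of
`∂ₜ y + λ ∂ₓ² y + ∂ₓ⁴ y = ∑ₖ bₖ sat((K z)ₖ)`, `y(0) = y₀`, with the boundary conditions `bc`, in the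
class `C([0, T]; H²) ∩ L²(0, T; H⁴)`. The equation is the identity of `L²(0, L)`-valued functions
`y(t) = y₀ + ∫₀ᵗ (𝒜 y(s) + ∑ₖ bₖ sat((K z(s))ₖ)) ds`; equivalently `y` is absolutely continuous in
`L²(0, L)` and solves the equation for almost every `t`. -/
structure IsSolution (L lam ℓ : ℝ) (bc : BoundaryCondition) {m n : ℕ} (b : Fin m → L2 L)
    (e : Fin n → L2 L) (K : Matrix (Fin m) (Fin n) ℝ) (T : ℝ) (y₀ : L2 L) (y : ℝ → L2 L) :
    Prop where
  mem_H2 : ∀ t ∈ Icc 0 T, MemSobolev L 2 (y t)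
  continuous_H2 : ∀ k ≤ 2, ContinuousOn (fun t => weakDeriv L k (y t)) (Icc 0 T)
  mem_domain : ∀ᵐ t ∂(volume.restrict (Ioo 0 T)), MemDomain L bc (y t)
  memLp_H4 : ∀ k ≤ 4, MemLp (fun t => weakDeriv L k (y t)) 2 (volume.restrict (Ioo 0 T))
  equation : ∀ t ∈ Icc 0 T,
    y t = y₀ + ∫ s in (0 : ℝ)..t, (opA L lam (y s) + feedback ℓ b e K (y s))

/-! ### Matrices -/

/-- A real square matrix is Hurwitz if all its complex eigenvalues have negative real part. -/
def IsHurwitz {n : ℕ} (M : Matrix (Fin n) (Fin n) ℝ) : Prop :=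
  ∀ μ : ℂ, Module.End.HasEigenvalue (Matrix.toLin' (M.map Complex.ofReal)) μ → μ.re < 0

/-- The matrix `M₁` of the first linear matrix inequality. -/
def lmi₁ {m n : ℕ} (A : Matrix (Fin n) (Fin n) ℝ) (B : Matrix (Fin n) (Fin m) ℝ)
    (K : Matrix (Fin m) (Fin n) ℝ) (P : Matrix (Fin n) (Fin n) ℝ) (D : Matrix (Fin m) (Fin m) ℝ)
    (C : Matrix (Fin m) (Fin n) ℝ) : Matrix (Fin n ⊕ Fin m) (Fin n ⊕ Fin m) ℝ :=
  Matrix.fromBlocks ((A + B * K)ᵀ * P + P * (A + B * K)) (P * B - (D * C)ᵀ)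
    ((P * B)ᵀ - D * C) (-(2 : ℝ) • D)

/-- The matrix `M₂` of the second linear matrix inequality. -/
def lmi₂ {m n : ℕ} (ℓ : ℝ) (K : Matrix (Fin m) (Fin n) ℝ) (P : Matrix (Fin n) (Fin n) ℝ)
    (C : Matrix (Fin m) (Fin n) ℝ) : Matrix (Fin n ⊕ Fin m) (Fin n ⊕ Fin m) ℝ :=
  Matrix.fromBlocks P (K - C)ᵀ (K - C) (ℓ ^ 2 • (1 : Matrix (Fin m) (Fin m) ℝ))

/-- The ellipsoid `ℛ = {z : zᵀ P z ≤ 1}`. -/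
def region {n : ℕ} (P : Matrix (Fin n) (Fin n) ℝ) : Set (Fin n → ℝ) :=
  {z | z ⬝ᵥ (P *ᵥ z) ≤ 1}

end SaturatedKS

end

open SaturatedKS

/-!
The quadratic form of `-𝒜` is a perfect square up to a constant: with `B = ∂ₓ² + λ / 2` one has
`λ² / 4 - 𝒜 = B* B`, where `B` carries only the boundary conditions of order at most `1`. The graph
of `B` in `L² × L²` is therefore a Hilbert space (`formSpace`) whose norm is equivalent to the norm
of `H²(0, L)`, its embedding `J` in `L²` is compact, and `J J*` is the resolvent
`(1 + λ² / 4 - 𝒜)⁻¹` (`memDomain_resolvent`, `resolvent_opA`): the remaining boundary conditions and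
the `H⁴` regularity are the natural ones of the variational problem (`memDomain_of_forall_inner`).
The spectral theorem for compact self-adjoint operators gives a Hilbert basis of eigenfunctions
that extends the given `e₁, …, eₙ`, all the other eigenvalues being at most `-δ < 0`
(`IsUnstableBasis.exists_hilbertBasis`).

The feedback sees a solution only through its unstable modes `z`, which solve the closed system
`z' = modeField z`. On the ellipsoid `zᵀ P z ≤ 1` the second matrix inequality gives
`|((K - C) z)ₖ| ≤ ℓ`, hence the sector inequality
`(sat (K z) - K z)ₖ (sat (K z) - (K - C) z)ₖ ≤ 0`; inserted in the first one it makes `zᵀ P z` a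
strict Lyapunov function (`exists_lyapunov`), so that the ellipsoid is invariant and `z` decays
exponentially (`exists_mode_solution`). The controls decay at the same rate, and each stable mode is
given by variation of constants, with bounds in the form norm and in `L²(0, T; D(𝒜))` that are
uniform in the mode (`mul_sq_duhamel_le`, `integral_sq_duhamel_le`). Summing the modes yields a
solution with the required regularity and decay (`exists_decaying_solution`).

Conversely, the coordinates of any solution in the eigenbasis satisfy these ordinary differential
equations (`IsSolution.hasDerivWithinAt_inner`), whose uniqueness gives that of the solution
(`IsSolution.eqOn`).
-/

noncomputable section

namespace SaturatedKS

open Filter Topology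
open scoped NNReal RealInnerProductSpace

/-! ### Continuous functions as elements of `L²(0, L)` -/

/-- The class in `L²(0, L)` of a function `g` (zero when `g` is not square integrable). -/
def ofFun (L : ℝ) (g : ℝ → ℝ) : L2 L :=
  open Classical in
  if h : MemLp g 2 (volume.restrict (Ioo (0 : ℝ) L)) then h.toLp g else 0

theorem ContinuousOn.memLp_Ioo {L : ℝ} {g : ℝ → ℝ} (hg : ContinuousOn g (Icc 0 L)) :
    MemLp g 2 (volume.restrict (Ioo (0 : ℝ) L)) := by
  obtain ⟨C, hC⟩ := isCompact_Icc.exists_bound_of_continuousOn hg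
  refine MemLp.of_bound ?_ C ?_
  · exact (hg.mono Ioo_subset_Icc_self).aestronglyMeasurable measurableSet_Ioo
  · filter_upwards [ae_restrict_mem measurableSet_Ioo] with x hx using hC x (Ioo_subset_Icc_self hx)

theorem coeFn_ofFun {L : ℝ} {g : ℝ → ℝ} (hg : ContinuousOn g (Icc 0 L)) :
    ofFun L g =ᵐ[volume.restrict (Ioo (0 : ℝ) L)] g := by
  rw [ofFun, dif_pos (ContinuousOn.memLp_Ioo hg)]
  exact MemLp.coeFn_toLp _

theorem ofFun_eq_of_ae {L : ℝ} {g : ℝ → ℝ} (hg : ContinuousOn g (Icc 0 L)) {u : L2 L}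
    (hu : u =ᵐ[volume.restrict (Ioo (0 : ℝ) L)] g) : u = ofFun L g :=
  Lp.ext (hu.trans (coeFn_ofFun hg).symm)

theorem inner_eq_integral {L : ℝ} (u v : L2 L) : ⟪u, v⟫ = ∫ x in Ioo 0 L, u x * v x := by
  rw [L2.inner_def]
  refine integral_congr_ae (Eventually.of_forall fun x => ?_)
  simp [mul_comm]

theorem inner_ofFun {L : ℝ} (u : L2 L) {g : ℝ → ℝ} (hg : ContinuousOn g (Icc 0 L)) :
    ⟪u, ofFun L g⟫ = ∫ x in Ioo 0 L, u x * g x := by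
  rw [inner_eq_integral]
  refine integral_congr_ae ?_
  filter_upwards [coeFn_ofFun hg] with x hx
  rw [hx]

theorem ofFun_linear {L : ℝ} {f g : ℝ → ℝ} (hf : ContinuousOn f (Icc 0 L))
    (hg : ContinuousOn g (Icc 0 L)) (a b : ℝ) :
    ofFun L (fun x => a * f x + b * g x) = a • ofFun L f + b • ofFun L g := by
  symm
  refine ofFun_eq_of_ae (g := fun x => a * f x + b * g x)
    ((continuousOn_const.mul hf).add (continuousOn_const.mul hg)) ?_
  filter_upwards [coeFn_ofFun hf, coeFn_ofFun hg, Lp.coeFn_add (a • ofFun L f) (b • ofFun L g),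
    Lp.coeFn_smul a (ofFun L f), Lp.coeFn_smul b (ofFun L g)] with x h1 h2 h3 h4 h5
  rw [h3, Pi.add_apply, h4, h5, Pi.smul_apply, Pi.smul_apply, h1, h2, smul_eq_mul, smul_eq_mul]

theorem ofFun_const_mul {L : ℝ} {f : ℝ → ℝ} (hf : ContinuousOn f (Icc 0 L)) (a : ℝ) :
    ofFun L (fun x => a * f x) = a • ofFun L f := by
  simpa using ofFun_linear hf hf a 0

/-! ### Absolutely continuous representatives -/

/-- `f` is an absolutely continuous representative of `u` with almost everywhere derivative `v`. -/
structure IsACRep (L : ℝ) (u v : L2 L) (f : ℝ → ℝ) : Prop where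
  ac : AbsolutelyContinuousOnInterval f 0 L
  ae_eq : u =ᵐ[volume.restrict (Ioo (0 : ℝ) L)] f
  deriv_ae : v =ᵐ[volume.restrict (Ioo (0 : ℝ) L)] deriv f

theorem IsACRep.continuousOn {L : ℝ} (hL : 0 < L) {u v : L2 L} {f : ℝ → ℝ}
    (h : IsACRep L u v f) : ContinuousOn f (Icc 0 L) := by
  simpa [uIcc_of_le hL.le] using h.ac.continuousOn

theorem isACRep_ofFun {L : ℝ} {g : ℝ → ℝ} (hg : ContDiff ℝ 1 g) :
    IsACRep L (ofFun L g) (ofFun L (deriv g)) g where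
  ac := hg.contDiffOn.absolutelyContinuousOnInterval
  ae_eq := coeFn_ofFun hg.continuous.continuousOn
  deriv_ae := coeFn_ofFun (hg.continuous_deriv le_rfl).continuousOn

theorem integrable_mul {L : ℝ} (u v : L2 L) :
    Integrable (fun x => u x * v x) (volume.restrict (Ioo (0 : ℝ) L)) :=
  MemLp.integrable_mul (Lp.memLp u) (Lp.memLp v)

/-- Integration by parts. -/
theorem IsACRep.inner_add_inner {L : ℝ} (hL : 0 < L) {u v u' v' : L2 L} {f f' : ℝ → ℝ}
    (h : IsACRep L u v f) (h' : IsACRep L u' v' f') :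
    ⟪v, u'⟫ + ⟪u, v'⟫ = f L * f' L - f 0 * f' 0 := by
  rw [← h.ac.integral_deriv_mul_eq_sub h'.ac, intervalIntegral.integral_of_le hL.le,
    integral_Ioc_eq_integral_Ioo, inner_eq_integral, inner_eq_integral,
    ← integral_add (integrable_mul _ _) (integrable_mul _ _)]
  refine integral_congr_ae ?_
  filter_upwards [h.ae_eq, h.deriv_ae, h'.ae_eq, h'.deriv_ae] with x h1 h2 h3 h4
  rw [h1, h2, h3, h4]

theorem L2.integrable {L : ℝ} (u : L2 L) : Integrable u (volume.restrict (Ioo (0 : ℝ) L)) :=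
  (Lp.memLp u).integrable (by norm_num)

/-- The primitive of `u ∈ L²(0, L)` that vanishes at `0`. -/
def primFun {L : ℝ} (u : L2 L) (x : ℝ) : ℝ := ∫ s in (0 : ℝ)..x, (Ioo 0 L).indicator u s

theorem integrable_indicator_L2 {L : ℝ} (u : L2 L) :
    Integrable ((Ioo 0 L).indicator u) volume :=
  (integrable_indicator_iff measurableSet_Ioo).2 (L2.integrable u)

theorem continuous_primFun {L : ℝ} (u : L2 L) : Continuous (primFun u) :=
  intervalIntegral.continuous_primitive
    (fun _ _ => (integrable_indicator_L2 u).intervalIntegrable) 0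

theorem isACRep_primFun {L : ℝ} (u : L2 L) (c : ℝ) :
    IsACRep L (ofFun L fun x => c + primFun u x) u fun x => c + primFun u x where
  ac := by
    have h1 : AbsolutelyContinuousOnInterval (primFun u) 0 L :=
      (integrable_indicator_L2 u).intervalIntegrable.absolutelyContinuousOnInterval_intervalIntegral
        (by simp)
    have h2 : AbsolutelyContinuousOnInterval (fun _ : ℝ => c) 0 L :=
      (contDiff_const (𝕜 := ℝ) (n := 1)).contDiffOn.absolutelyContinuousOnInterval
    exact h2.add h1
  ae_eq := coeFn_ofFun (continuous_const.add (continuous_primFun u)).continuousOn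
  deriv_ae := by
    have := LocallyIntegrable.ae_hasDerivAt_integral
      (integrable_indicator_L2 u).locallyIntegrable
    filter_upwards [ae_restrict_of_ae this, ae_restrict_mem measurableSet_Ioo] with x hx hm
    have h := ((hx 0).const_add c).deriv
    rw [indicator_of_mem hm] at h
    exact h.symm

/-! ### Weak derivatives -/

/-- Test functions on `(0, L)`. -/
structure IsTest (L : ℝ) (φ : ℝ → ℝ) : Prop where
  smooth : ContDiff ℝ ∞ φ
  compact : HasCompactSupport φ
  support : tsupport φ ⊆ Ioo 0 L

theorem IsTest.continuousOn_iteratedDeriv {L : ℝ} {φ : ℝ → ℝ} (h : IsTest L φ) (k : ℕ) :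
    ContinuousOn (iteratedDeriv k φ) (Icc 0 L) :=
  (h.smooth.continuous_iteratedDeriv k (by exact_mod_cast le_top)).continuousOn

theorem IsTest.continuousOn {L : ℝ} {φ : ℝ → ℝ} (h : IsTest L φ) : ContinuousOn φ (Icc 0 L) :=
  h.smooth.continuous.continuousOn

theorem IsTest.deriv {L : ℝ} {φ : ℝ → ℝ} (h : IsTest L φ) : IsTest L (deriv φ) where
  smooth := (contDiff_infty_iff_deriv.1 h.smooth).2
  compact := h.compact.deriv
  support := (tsupport_deriv_subset).trans h.support

theorem IsTest.eq_zero {L : ℝ} {φ : ℝ → ℝ} (h : IsTest L φ) {x : ℝ} (hx : x ∉ Ioo 0 L) :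
    φ x = 0 :=
  image_eq_zero_of_notMem_tsupport fun hx' => hx (h.support hx')

theorem IsTest.linear {L : ℝ} {φ ψ : ℝ → ℝ} (h : IsTest L φ) (h' : IsTest L ψ) (a b : ℝ) :
    IsTest L (fun x => a * φ x + b * ψ x) where
  smooth := (contDiff_const.mul h.smooth).add (contDiff_const.mul h'.smooth)
  compact := (h.compact.mul_left (f := fun _ => a)).add (h'.compact.mul_left (f := fun _ => b))
  support := by
    refine (tsupport_add _ _).trans (union_subset ?_ ?_)
    · exact (tsupport_mul_subset_right (f := fun _ => a)).trans h.support
    · exact (tsupport_mul_subset_right (f := fun _ => b)).trans h'.support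

theorem hasWeakDeriv_iff {L : ℝ} {k : ℕ} {u v : L2 L} :
    HasWeakDeriv L k u v ↔ ∀ φ, IsTest L φ →
      ⟪u, ofFun L (iteratedDeriv k φ)⟫ = (-1) ^ k * ⟪v, ofFun L φ⟫ := by
  constructor
  · intro h φ hφ
    rw [inner_ofFun u (hφ.continuousOn_iteratedDeriv k), inner_ofFun v hφ.continuousOn]
    exact h φ hφ.1 hφ.2 hφ.3
  · intro h φ h1 h2 h3
    have hφ : IsTest L φ := ⟨h1, h2, h3⟩
    have := h φ hφ
    rwa [inner_ofFun u (hφ.continuousOn_iteratedDeriv k), inner_ofFun v hφ.continuousOn] at this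

theorem HasWeakDeriv.linear {L : ℝ} {k : ℕ} {u v u' v' : L2 L} (h : HasWeakDeriv L k u v)
    (h' : HasWeakDeriv L k u' v') (a b : ℝ) :
    HasWeakDeriv L k (a • u + b • u') (a • v + b • v') := by
  rw [hasWeakDeriv_iff] at *
  intro φ hφ
  simp only [inner_add_left, inner_smul_left, h φ hφ, h' φ hφ]
  simp; ring

theorem HasWeakDeriv.add {L : ℝ} {k : ℕ} {u v u' v' : L2 L} (h : HasWeakDeriv L k u v)
    (h' : HasWeakDeriv L k u' v') : HasWeakDeriv L k (u + u') (v + v') := by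
  simpa using h.linear h' 1 1

theorem HasWeakDeriv.smul {L : ℝ} {k : ℕ} {u v : L2 L} (h : HasWeakDeriv L k u v) (a : ℝ) :
    HasWeakDeriv L k (a • u) (a • v) := by
  simpa using h.linear h a 0

theorem HasWeakDeriv.sub_smul {L : ℝ} {k : ℕ} {u v u' v' : L2 L} (h : HasWeakDeriv L k u v)
    (h' : HasWeakDeriv L k u' v') (a : ℝ) : HasWeakDeriv L k (u - a • u') (v - a • v') := by
  simpa [sub_eq_add_neg] using h.linear h' 1 (-a)

theorem hasWeakDeriv_zero {L : ℝ} (u : L2 L) : HasWeakDeriv L 0 u u := by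
  rw [hasWeakDeriv_iff]; intro φ _; simp

theorem HasWeakDeriv.weakDeriv_eq {L : ℝ} {k : ℕ} {u v : L2 L} (h : HasWeakDeriv L k u v) :
    weakDeriv L k u = v := by
  have h' : ∃ v, HasWeakDeriv L k u v := ⟨v, h⟩
  rw [weakDeriv, dif_pos h']
  exact h'.choose_spec.unique h

theorem weakDeriv_zero {L : ℝ} (u : L2 L) : weakDeriv L 0 u = u :=
  (hasWeakDeriv_zero u).weakDeriv_eq

theorem hasWeakDeriv_weakDeriv {L : ℝ} {k : ℕ} {u : L2 L} (h : ∃ v, HasWeakDeriv L k u v) :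
    HasWeakDeriv L k u (weakDeriv L k u) := by
  obtain ⟨v, hv⟩ := h
  rwa [hv.weakDeriv_eq]

/-- Weak differentiation is a closed operator. -/
theorem HasWeakDeriv.of_tendsto {L : ℝ} {k : ℕ} {u v : ℕ → L2 L} {u' v' : L2 L}
    (h : ∀ n, HasWeakDeriv L k (u n) (v n)) (hu : Tendsto u atTop (𝓝 u'))
    (hv : Tendsto v atTop (𝓝 v')) : HasWeakDeriv L k u' v' := by
  rw [hasWeakDeriv_iff]
  intro φ hφ
  have h1 := hu.inner (𝕜 := ℝ) (tendsto_const_nhds (x := ofFun L (iteratedDeriv k φ)))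
  have h2 := (hv.inner (𝕜 := ℝ) (tendsto_const_nhds (x := ofFun L φ))).const_mul ((-1 : ℝ) ^ k)
  refine tendsto_nhds_unique h1 (h2.congr fun n => ?_)
  exact ((hasWeakDeriv_iff.1 (h n)) φ hφ).symm

theorem IsACRep.hasWeakDeriv {L : ℝ} (hL : 0 < L) {u v : L2 L} {f : ℝ → ℝ}
    (h : IsACRep L u v f) : HasWeakDeriv L 1 u v := by
  rw [hasWeakDeriv_iff]
  intro φ hφ
  have := h.inner_add_inner hL (isACRep_ofFun (hφ.smooth.of_le (by exact_mod_cast le_top)))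
  rw [hφ.eq_zero (by simp), hφ.eq_zero (by simp)] at this
  rw [iteratedDeriv_one]
  linarith

theorem exists_isTest_integral_eq_one {L : ℝ} (hL : 0 < L) :
    ∃ φ, IsTest L φ ∧ ∫ x in Ioo 0 L, φ x = 1 := by
  let f : ContDiffBump (L / 2) := ⟨L / 8, L / 4, by positivity, by linarith⟩
  have hsub : tsupport (f.normed volume) ⊆ Ioo 0 L := by
    rw [f.tsupport_normed_eq, Real.closedBall_eq_Icc]
    intro x hx
    constructor
    · have := hx.1; simp only [f] at this; linarith
    · have := hx.2; simp only [f] at this; linarith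
  refine ⟨f.normed volume, ⟨f.contDiff_normed, f.hasCompactSupport_normed, hsub⟩, ?_⟩
  rw [setIntegral_eq_integral_of_forall_compl_eq_zero]
  · exact f.integral_normed
  · intro x hx
    exact image_eq_zero_of_notMem_tsupport fun h => hx (hsub h)

/-- A test function of mean zero is the derivative of a test function. -/
theorem IsTest.exists_deriv_eq {L : ℝ} (hL : 0 < L) {ψ : ℝ → ℝ} (h : IsTest L ψ)
    (h0 : ∫ x in Ioo 0 L, ψ x = 0) : ∃ φ, IsTest L φ ∧ _root_.deriv φ = ψ := by
  obtain ⟨a, b, ha, hb, hab⟩ : ∃ a b : ℝ, 0 < a ∧ b < L ∧ tsupport ψ ⊆ Icc a b := by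
    rcases (tsupport ψ).eq_empty_or_nonempty with he | hne
    · exact ⟨L / 2, L / 2, by positivity, by linarith, by simp [he]⟩
    · obtain ⟨a, ha⟩ := h.compact.isCompact.exists_isLeast hne
      obtain ⟨b, hb⟩ := h.compact.isCompact.exists_isGreatest hne
      exact ⟨a, b, (h.support ha.1).1, (h.support hb.1).2, fun x hx => ⟨ha.2 hx, hb.2 hx⟩⟩
  have hz : ∀ x, x ∉ Icc a b → ψ x = 0 := fun x hx =>
    image_eq_zero_of_notMem_tsupport fun hx' => hx (hab hx')
  have hd : ∀ x, HasDerivAt (fun x => ∫ s in (0 : ℝ)..x, ψ s) (ψ x) x := fun x =>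
    (h.smooth.continuous.integral_hasStrictDerivAt 0 x).hasDerivAt
  have hderiv : _root_.deriv (fun x => ∫ s in (0 : ℝ)..x, ψ s) = ψ := funext fun x => (hd x).deriv
  have htot : ∫ s in (0 : ℝ)..L, ψ s = 0 := by
    rw [intervalIntegral.integral_of_le hL.le, integral_Ioc_eq_integral_Ioo, h0]
  have hsupp : ∀ x, x ∉ Icc a b → ∫ s in (0 : ℝ)..x, ψ s = 0 := by
    intro x hx
    rcases lt_or_ge x a with hxa | hxa
    · refine intervalIntegral.integral_zero_ae (Eventually.of_forall fun y hy => hz y fun hy' => ?_)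
      rcases le_total 0 x with h1 | h1
      · rw [uIoc_of_le h1] at hy; linarith [hy.2, hy'.1]
      · rw [uIoc_of_ge h1] at hy; linarith [hy.2, hy'.1]
    · have hxb : b < x := by
        by_contra hc
        exact hx ⟨hxa, not_lt.1 hc⟩
      have hI : ∀ c d : ℝ, IntervalIntegrable ψ volume c d := fun c d =>
        h.smooth.continuous.intervalIntegrable c d
      rw [← intervalIntegral.integral_add_adjacent_intervals (hI 0 L) (hI L x), htot, zero_add]
      refine intervalIntegral.integral_zero_ae (Eventually.of_forall fun y hy => hz y fun hy' => ?_)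
      rcases le_total L x with h1 | h1
      · rw [uIoc_of_le h1] at hy; linarith [hy.1, hy'.2]
      · rw [uIoc_of_ge h1] at hy; linarith [hy.1, hy'.2]
  have hts : tsupport (fun x => ∫ s in (0 : ℝ)..x, ψ s) ⊆ Icc a b := by
    refine closure_minimal (fun x hx => ?_) isClosed_Icc
    by_contra hc
    exact hx (hsupp x hc)
  refine ⟨fun x => ∫ s in (0 : ℝ)..x, ψ s, ⟨?_, ?_, ?_⟩, hderiv⟩
  · rw [contDiff_infty_iff_deriv, hderiv]
    exact ⟨fun x => (hd x).differentiableAt, h.smooth⟩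
  · exact isCompact_Icc.of_isClosed_subset (isClosed_tsupport _) hts
  · exact hts.trans fun x hx => ⟨ha.trans_le hx.1, hx.2.trans_lt hb⟩

/-- The du Bois-Reymond lemma: a functional on test functions that vanishes on derivatives is a
multiple of the integral. -/
theorem exists_eq_const_mul_integral {L : ℝ} (hL : 0 < L) (F : (ℝ → ℝ) → ℝ)
    (hF : ∀ φ ψ, IsTest L φ → IsTest L ψ → ∀ a b : ℝ,
      F (fun x => a * φ x + b * ψ x) = a * F φ + b * F ψ)
    (h0 : ∀ φ, IsTest L φ → F (deriv φ) = 0) :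
    ∃ C, ∀ φ, IsTest L φ → F φ = C * ∫ x in Ioo 0 L, φ x := by
  obtain ⟨φ₀, h₀, hi⟩ := exists_isTest_integral_eq_one hL
  refine ⟨F φ₀, fun φ hφ => ?_⟩
  have hint : ∀ f, IsTest L f → IntegrableOn f (Ioo 0 L) := fun f hf =>
    (hf.continuousOn.integrableOn_Icc).mono_set Ioo_subset_Icc_self
  set c := ∫ x in Ioo 0 L, φ x
  have hψ := hφ.linear h₀ 1 (-c)
  obtain ⟨Φ, hΦ, hd⟩ := hψ.exists_deriv_eq hL (by
    rw [integral_add ((hint _ hφ).const_mul 1) ((hint _ h₀).const_mul (-c)), integral_const_mul,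
      integral_const_mul, hi]
    simp [c])
  have h1 := h0 Φ hΦ
  rw [hd, hF φ φ₀ hφ h₀] at h1
  linarith

theorem inner_one_ofFun {L : ℝ} {φ : ℝ → ℝ} (h : IsTest L φ) (c : ℝ) :
    ⟪ofFun L (fun _ => c), ofFun L φ⟫ = c * ∫ x in Ioo 0 L, φ x := by
  rw [inner_ofFun _ h.continuousOn, ← integral_const_mul]
  refine integral_congr_ae ?_
  filter_upwards [coeFn_ofFun (continuousOn_const (c := c))] with x hx
  rw [hx]

theorem IsTest.iteratedDeriv_linear {L : ℝ} {φ ψ : ℝ → ℝ} (h : IsTest L φ) (h' : IsTest L ψ)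
    (a b : ℝ) (k : ℕ) : iteratedDeriv k (fun x => a * φ x + b * ψ x) =
      fun x => a * iteratedDeriv k φ x + b * iteratedDeriv k ψ x := by
  have hk : ((k : ℕ∞) : WithTop ℕ∞) ≤ ∞ := by exact_mod_cast le_top
  ext x
  have h1 : ContDiffAt ℝ k (fun x => a * φ x) x :=
    (contDiff_const.mul (h.smooth.of_le hk)).contDiffAt
  have h2 : ContDiffAt ℝ k (fun x => b * ψ x) x :=
    (contDiff_const.mul (h'.smooth.of_le hk)).contDiffAt
  rw [iteratedDeriv_fun_add h1 h2, iteratedDeriv_const_mul_field, iteratedDeriv_const_mul_field]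

theorem inner_ext_isTest {L : ℝ} {u v : L2 L}
    (h : ∀ φ, IsTest L φ → ⟪u, ofFun L φ⟫ = ⟪v, ofFun L φ⟫) : u = v := by
  have h1 : HasWeakDeriv L 0 u v := by
    rw [hasWeakDeriv_iff]; intro φ hφ; simpa using h φ hφ
  exact (hasWeakDeriv_zero u).unique h1

theorem HasWeakDeriv.comp_one {L : ℝ} {k : ℕ} {u w v : L2 L} (h : HasWeakDeriv L k u w)
    (h' : HasWeakDeriv L 1 w v) : HasWeakDeriv L (k + 1) u v := by
  rw [hasWeakDeriv_iff] at *
  intro φ hφ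
  have := h' φ hφ
  rw [iteratedDeriv_one] at this
  rw [iteratedDeriv_succ', h _ hφ.deriv, this]
  ring

/-- A weak derivative of order `k + 1` is the weak derivative of a weak derivative of order `k`:
lower order derivatives come for free in one dimension. -/
theorem HasWeakDeriv.exists_pred {L : ℝ} (hL : 0 < L) {k : ℕ} {u v : L2 L}
    (h : HasWeakDeriv L (k + 1) u v) : ∃ w, HasWeakDeriv L k u w ∧ HasWeakDeriv L 1 w v := by
  set p : L2 L := ofFun L fun x => 0 + primFun v x with hp
  have hpv : HasWeakDeriv L 1 p v := (isACRep_primFun v 0).hasWeakDeriv hL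
  obtain ⟨C, hC⟩ := exists_eq_const_mul_integral hL
    (fun φ => ⟪u, ofFun L (iteratedDeriv k φ)⟫ - (-1) ^ k * ⟪p, ofFun L φ⟫) (by
      intro φ ψ hφ hψ a b
      rw [hφ.iteratedDeriv_linear hψ, ofFun_linear (hφ.continuousOn_iteratedDeriv k)
        (hψ.continuousOn_iteratedDeriv k), ofFun_linear hφ.continuousOn hψ.continuousOn]
      simp only [inner_add_right, inner_smul_right]
      ring) (by
      intro φ hφ
      have h1 := hasWeakDeriv_iff.1 h φ hφ
      have h2 := hasWeakDeriv_iff.1 hpv φ hφ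
      rw [iteratedDeriv_one] at h2
      rw [iteratedDeriv_succ'] at h1
      rw [h1, h2]
      ring)
  have hone : HasWeakDeriv L 1 (ofFun L fun _ => (-1) ^ k * C) (0 : L2 L) := by
    have h1 : HasWeakDeriv L 1 (ofFun L fun _ => (-1) ^ k * C)
        (ofFun L (deriv fun _ => (-1) ^ k * C)) :=
      (isACRep_ofFun contDiff_const).hasWeakDeriv hL
    have h2 : ofFun L (deriv fun _ : ℝ => (-1) ^ k * C) = 0 := by
      rw [deriv_const']
      simpa using ofFun_const_mul (L := L) (f := fun _ => 1) continuousOn_const 0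
    rwa [h2] at h1
  refine ⟨p + ofFun L (fun _ => (-1) ^ k * C), ?_, by simpa using hpv.add hone⟩
  rw [hasWeakDeriv_iff]
  intro φ hφ
  have h1 := hC φ hφ
  rw [inner_add_left, inner_one_ofFun hφ]
  have h2 : ((-1 : ℝ) ^ k) * (-1) ^ k = 1 := by
    rw [← mul_pow]; norm_num
  linear_combination h1 - (C * ∫ x in Ioo 0 L, φ x) * h2

/-- Elements of `H¹(0, L)` have absolutely continuous representatives. -/
theorem HasWeakDeriv.exists_isACRep {L : ℝ} (hL : 0 < L) {u v : L2 L} (h : HasWeakDeriv L 1 u v) :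
    ∃ f, IsACRep L u v f := by
  set p : L2 L := ofFun L fun x => 0 + primFun v x with hp
  have hpv : HasWeakDeriv L 1 p v := (isACRep_primFun v 0).hasWeakDeriv hL
  have hd : HasWeakDeriv L 1 (u - p) 0 := by simpa using h.sub_smul hpv 1
  obtain ⟨C, hC⟩ := exists_eq_const_mul_integral hL (fun φ => ⟪u - p, ofFun L φ⟫) (by
      intro φ ψ hφ hψ a b
      rw [ofFun_linear hφ.continuousOn hψ.continuousOn]
      simp only [inner_add_right, inner_smul_right]) (by
      intro φ hφ
      simpa [iteratedDeriv_one] using hasWeakDeriv_iff.1 hd φ hφ)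
  have h1 : u - p = ofFun L fun _ => C :=
    inner_ext_isTest fun φ hφ => by rw [inner_one_ofFun hφ]; exact hC φ hφ
  have h2 : u = ofFun L fun x => C + primFun v x := by
    rw [← sub_add_cancel u p, h1, hp]
    have := ofFun_linear (L := L) (f := fun _ => C) (g := fun x => 0 + primFun v x)
      continuousOn_const (continuous_const.add (continuous_primFun v)).continuousOn 1 1
    simpa using this.symm
  exact ⟨_, h2 ▸ isACRep_primFun v C⟩

/-! ### Boundary values -/

theorem IsACRep.eqOn_of_ae_eq {L : ℝ} (hL : 0 < L) {u v : L2 L} {f g : ℝ → ℝ}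
    (h : IsACRep L u v f) (hg : ContinuousOn g (Icc 0 L))
    (hug : u =ᵐ[volume.restrict (Ioo (0 : ℝ) L)] g) : EqOn f g (Icc 0 L) := by
  have h1 : f =ᵐ[volume.restrict (Ioo (0 : ℝ) L)] g := h.ae_eq.symm.trans hug
  have h2 : EqOn f g (Ioo 0 L) := Measure.eqOn_open_of_ae_eq h1 isOpen_Ioo
    ((h.continuousOn hL).mono Ioo_subset_Icc_self) (hg.mono Ioo_subset_Icc_self)
  exact h2.of_subset_closure (h.continuousOn hL) hg Ioo_subset_Icc_self
    (by rw [closure_Ioo hL.ne])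

theorem IsACRep.vanishesAtEnds_iff {L : ℝ} (hL : 0 < L) {u v : L2 L} {f : ℝ → ℝ}
    (h : IsACRep L u v f) : VanishesAtEnds L u ↔ f 0 = 0 ∧ f L = 0 := by
  constructor
  · rintro ⟨g, hg, hug, h0, h1⟩
    have := h.eqOn_of_ae_eq hL hg hug
    rw [this (left_mem_Icc.2 hL.le), this (right_mem_Icc.2 hL.le)]
    exact ⟨h0, h1⟩
  · rintro ⟨h0, h1⟩
    exact ⟨f, h.continuousOn hL, h.ae_eq, h0, h1⟩

/-! ### Sobolev estimates and compactness -/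

theorem abs_setIntegral_le {L : ℝ} (v : L2 L) {x y : ℝ} (hxy : x ≤ y) :
    |∫ s in Ioc x y, v s ∂(volume.restrict (Ioo (0 : ℝ) L))| ≤ √(y - x) * ‖v‖ := by
  have hfin : volume.restrict (Ioo (0 : ℝ) L) (Ioc x y) ≠ ⊤ := measure_ne_top _ _
  rw [← L2.inner_indicatorConstLp_one (𝕜 := ℝ) measurableSet_Ioc hfin v]
  refine (abs_real_inner_le_norm _ _).trans ?_
  refine mul_le_mul_of_nonneg_right ?_ (norm_nonneg _)
  rw [norm_indicatorConstLp two_ne_zero ENNReal.ofNat_ne_top, norm_one, one_mul, Real.sqrt_eq_rpow]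
  norm_num
  refine Real.rpow_le_rpow measureReal_nonneg ?_ (by norm_num)
  rw [Measure.real]
  refine ENNReal.toReal_le_of_le_ofReal (by linarith) ?_
  exact (measure_mono inter_subset_left).trans Real.volume_Ioc.le

/-- Functions of `H¹(0, L)` are Hölder continuous of exponent `1 / 2`. -/
theorem IsACRep.abs_sub_le {L : ℝ} (hL : 0 < L) {u v : L2 L} {f : ℝ → ℝ}
    (h : IsACRep L u v f) {x y : ℝ} (hx : x ∈ Icc 0 L) (hy : y ∈ Icc 0 L) (hxy : x ≤ y) :
    |f y - f x| ≤ √(y - x) * ‖v‖ := by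
  have h1 : f y - f x = ∫ s in Ioc x y, v s ∂(volume.restrict (Ioo (0 : ℝ) L)) := by
    have hac : AbsolutelyContinuousOnInterval f x y := h.ac.mono (by
      rw [uIcc_of_le hL.le, uIcc_of_le hxy]
      exact Icc_subset_Icc hx.1 hy.2)
    rw [← hac.integral_deriv_eq_sub, intervalIntegral.integral_of_le hxy]
    have h2 : ∫ s in Ioc x y, v s ∂(volume.restrict (Ioo (0 : ℝ) L)) =
        ∫ s in Ioc x y, deriv f s ∂(volume.restrict (Ioo (0 : ℝ) L)) :=
      integral_congr_ae (ae_restrict_of_ae h.deriv_ae)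
    rw [h2, Measure.restrict_restrict measurableSet_Ioc, integral_Ioc_eq_integral_Ioo,
      ← integral_Ioc_eq_integral_Ioo]
    refine setIntegral_congr_set ?_
    have h3 : Ioo x y ⊆ Ioc x y ∩ Ioo 0 L := fun s hs =>
      ⟨Ioo_subset_Ioc_self hs, hx.1.trans_lt hs.1, hs.2.trans_le hy.2⟩
    exact (Ioo_ae_eq_Ioc.symm.le.trans (LE.le.eventuallyLE h3)).antisymm
      (LE.le.eventuallyLE inter_subset_left)
  rw [h1]
  exact abs_setIntegral_le v hxy

/-- The boundary values of an element of `H¹(0, L)` in terms of inner products. -/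
theorem IsACRep.inner_one_add_inner {L : ℝ} (hL : 0 < L) {u v : L2 L} {f : ℝ → ℝ}
    (h : IsACRep L u v f) (c : ℝ) :
    ⟪v, ofFun L (fun x => x - c)⟫ + ⟪u, ofFun L (fun _ => 1)⟫ = f L * (L - c) - f 0 * (0 - c) := by
  have h1 : IsACRep L (ofFun L fun x => x - c) (ofFun L (deriv fun x => x - c)) fun x => x - c :=
    isACRep_ofFun (contDiff_id.sub contDiff_const)
  have h2 : deriv (fun x : ℝ => x - c) = fun _ => 1 := by ext x; simp
  rw [h2] at h1
  exact h.inner_add_inner hL h1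

/-- The Sobolev inequality: the norm of `H¹(0, L)` controls the supremum norm. -/
theorem exists_abs_le_of_isACRep {L : ℝ} (hL : 0 < L) : ∃ C ≥ 0, ∀ (u v : L2 L) (f : ℝ → ℝ),
    IsACRep L u v f → ∀ x ∈ Icc 0 L, |f x| ≤ C * (‖u‖ + ‖v‖) := by
  set a := ‖ofFun L (fun x => x - L)‖
  set b := ‖ofFun L (fun _ => 1)‖
  refine ⟨(a + b) / L + √L, by positivity, fun u v f h x hx => ?_⟩
  have h0 : |f 0| ≤ (a + b) / L * (‖u‖ + ‖v‖) := by
    have h1 := h.inner_one_add_inner hL L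
    have h2 : f 0 = (⟪v, ofFun L (fun x => x - L)⟫ + ⟪u, ofFun L (fun _ => 1)⟫) / L := by
      rw [h1]; field_simp; ring
    have h3 := abs_real_inner_le_norm v (ofFun L (fun x => x - L))
    have h4 := abs_real_inner_le_norm u (ofFun L (fun _ => 1))
    rw [h2, abs_div, abs_of_pos hL, div_mul_eq_mul_div]
    refine div_le_div_of_nonneg_right ?_ hL.le
    refine (abs_add_le _ _).trans ((add_le_add h3 h4).trans ?_)
    have := mul_nonneg (norm_nonneg u) (norm_nonneg (ofFun L (fun x => x - L)))
    have := mul_nonneg (norm_nonneg v) (norm_nonneg (ofFun L (fun _ => 1)))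
    simp only [a, b]
    linarith
  have h5 := h.abs_sub_le hL (left_mem_Icc.2 hL.le) hx hx.1
  have h6 : √(x - 0) ≤ √L := Real.sqrt_le_sqrt (by linarith [hx.2])
  have h7 : √(x - 0) * ‖v‖ ≤ √L * (‖u‖ + ‖v‖) :=
    mul_le_mul h6 (by linarith [norm_nonneg u]) (norm_nonneg _) (Real.sqrt_nonneg _)
  have h8 : |f x| ≤ |f x - f 0| + |f 0| := by
    simpa using abs_add_le (f x - f 0) (f 0)
  rw [add_mul]
  linarith

/-- The embedding of `H¹(0, L)` into `L²(0, L)` is compact. -/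
theorem isCompactOperator_of_hasWeakDeriv {L : ℝ} (hL : 0 < L) {X : Type*} [NormedAddCommGroup X]
    [NormedSpace ℝ X] (T D : X →L[ℝ] L2 L) (h : ∀ x, HasWeakDeriv L 1 (T x) (D x)) :
    IsCompactOperator T := by
  obtain ⟨C, hC0, hC⟩ := exists_abs_le_of_isACRep hL
  -- The image of the unit ball lies in the image of a set of uniformly bounded and uniformly
  -- Hölder continuous functions, relatively compact by Arzelà–Ascoli.
  set M := C * (‖T‖ + ‖D‖)
  let A : Set (BoundedContinuousFunction (Icc (0 : ℝ) L) ℝ) :=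
    {g | (∀ x, g x ∈ Icc (-M) M) ∧ ∀ x y, |g x - g y| ≤ √|(x : ℝ) - y| * ‖D‖}
  have hA : IsCompact (closure A) := by
    refine BoundedContinuousFunction.arzela_ascoli (Icc (-M) M) isCompact_Icc A
      (fun g x hg => hg.1 x) ?_
    refine Metric.equicontinuous_of_continuity_modulus (fun t => √|t| * ‖D‖) ?_ _ ?_
    · have : Continuous fun t : ℝ => √|t| * ‖D‖ := by fun_prop
      simpa using this.tendsto 0
    · intro x y g
      rw [Real.dist_eq, Subtype.dist_eq, Real.dist_eq, abs_abs]
      exact g.2.2 x y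
  let P : C(ℝ, Icc (0 : ℝ) L) := ⟨projIcc 0 L hL.le, continuous_projIcc⟩
  let E : BoundedContinuousFunction (Icc (0 : ℝ) L) ℝ → L2 L := fun g =>
    BoundedContinuousFunction.toLp 2 (volume.restrict (Ioo (0 : ℝ) L)) ℝ (g.compContinuous P)
  have hE : Continuous E := (ContinuousLinearMap.continuous _).comp
    (BoundedContinuousFunction.continuous_compContinuous P)
  refine (isCompactOperator_iff_image_closedBall_subset_compact (T : X →ₗ[ℝ] L2 L) one_pos).2
    ⟨E '' closure A, hA.image hE, ?_⟩
  rintro _ ⟨x, hx, rfl⟩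
  have hx1 : ‖x‖ ≤ 1 := by simpa using hx
  obtain ⟨f, hf⟩ := (h x).exists_isACRep hL
  have hT : ‖T x‖ ≤ ‖T‖ := (T.le_opNorm x).trans (mul_le_of_le_one_right (norm_nonneg _) hx1)
  have hD : ‖D x‖ ≤ ‖D‖ := (D.le_opNorm x).trans (mul_le_of_le_one_right (norm_nonneg _) hx1)
  have hfc := hf.continuousOn hL
  let g : BoundedContinuousFunction (Icc (0 : ℝ) L) ℝ :=
    BoundedContinuousFunction.mkOfCompact ⟨(Icc 0 L).domRestrict f, hfc.domRestrict⟩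
  refine ⟨g, subset_closure ⟨fun t => ?_, fun s t => ?_⟩, ?_⟩
  · have h1 : |f t| ≤ M := (hC _ _ _ hf t t.2).trans
      (mul_le_mul_of_nonneg_left (add_le_add hT hD) hC0)
    exact abs_le.1 h1
  · have key : ∀ s t : Icc (0 : ℝ) L, (s : ℝ) ≤ t → |f s - f t| ≤ √|(s : ℝ) - t| * ‖D‖ := by
      intro s t hst
      rw [abs_sub_comm, abs_sub_comm (s : ℝ), abs_of_nonneg (sub_nonneg.2 hst)]
      exact (hf.abs_sub_le hL s.2 t.2 hst).trans
        (mul_le_mul_of_nonneg_left hD (Real.sqrt_nonneg _))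
    rcases le_total (s : ℝ) t with hst | hst
    · exact key s t hst
    · have := key t s hst
      rwa [abs_sub_comm, abs_sub_comm (t : ℝ)] at this
  · refine Lp.ext ((BoundedContinuousFunction.coeFn_toLp _ _ _ _).trans ?_)
    filter_upwards [hf.ae_eq, ae_restrict_mem measurableSet_Ioo] with t ht htm
    have : P t = ⟨t, Ioo_subset_Icc_self htm⟩ := projIcc_of_mem hL.le _
    change f (P t) = (T x) t
    rw [this, ht]

/-! ### The graph of the second derivative with boundary conditions -/

/-- Green's formula for the second derivative. -/
theorem inner_sub_inner_eq_boundary {L : ℝ} (hL : 0 < L) {u u₁ u₂ w w₁ w₂ : L2 L}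
    {f₀ f₁ g₀ g₁ : ℝ → ℝ} (hu : IsACRep L u u₁ f₀) (hu₁ : IsACRep L u₁ u₂ f₁)
    (hw : IsACRep L w w₁ g₀) (hw₁ : IsACRep L w₁ w₂ g₁) :
    ⟪u₂, w⟫ - ⟪u, w₂⟫ = (f₁ L * g₀ L - f₀ L * g₁ L) - (f₁ 0 * g₀ 0 - f₀ 0 * g₁ 0) := by
  have h1 := hu₁.inner_add_inner hL hw
  have h2 := hu.inner_add_inner hL hw₁
  linarith

/-- Smooth functions on `ℝ` that vanish at `0` and `L` if `d₀` holds, and whose derivative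
vanishes there if `d₁` holds. -/
structure IsBoundaryTest (L : ℝ) (d₀ d₁ : Prop) (p : ℝ → ℝ) : Prop where
  smooth : ContDiff ℝ ∞ p
  zero : d₀ → p 0 = 0 ∧ p L = 0
  deriv_zero : d₁ → deriv p 0 = 0 ∧ deriv p L = 0

theorem IsTest.isBoundaryTest {L : ℝ} {φ : ℝ → ℝ} (h : IsTest L φ) (d₀ d₁ : Prop) :
    IsBoundaryTest L d₀ d₁ φ :=
  ⟨h.smooth, fun _ => ⟨h.eq_zero (by simp), h.eq_zero (by simp)⟩,
    fun _ => ⟨h.deriv.eq_zero (by simp), h.deriv.eq_zero (by simp)⟩⟩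

/-- `v` is the second derivative of `u` in the sense of the pairing with all smooth functions
subject to the boundary conditions `d₀`, `d₁`; this forces the complementary boundary conditions
on `u`. -/
def IsGraph (L : ℝ) (d₀ d₁ : Prop) (u v : L2 L) : Prop :=
  ∀ p, IsBoundaryTest L d₀ d₁ p → ⟪v, ofFun L p⟫ = ⟪u, ofFun L (deriv (deriv p))⟫

theorem IsGraph.hasWeakDeriv {L : ℝ} {d₀ d₁ : Prop} {u v : L2 L} (h : IsGraph L d₀ d₁ u v) :
    HasWeakDeriv L 2 u v := by
  rw [hasWeakDeriv_iff]
  intro φ hφ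
  have := h φ (hφ.isBoundaryTest d₀ d₁)
  rw [iteratedDeriv_succ, iteratedDeriv_one, ← this]
  norm_num

theorem isACRep_smooth {L : ℝ} {p : ℝ → ℝ} (hp : ContDiff ℝ ∞ p) :
    IsACRep L (ofFun L p) (ofFun L (deriv p)) p ∧
      IsACRep L (ofFun L (deriv p)) (ofFun L (deriv (deriv p))) (deriv p) :=
  ⟨isACRep_ofFun (hp.of_le (by exact_mod_cast le_top)),
    isACRep_ofFun ((contDiff_infty_iff_deriv.1 hp).2.of_le (by exact_mod_cast le_top))⟩

/-- Green's formula with test functions whose boundary values are free gives the boundary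
conditions encoded in `IsGraph`. -/
theorem IsGraph.boundary {L : ℝ} (hL : 0 < L) {d₀ d₁ : Prop} {u v : L2 L}
    (h : IsGraph L d₀ d₁ u v) {u₁ : L2 L} {f₀ f₁ : ℝ → ℝ} (h₀ : IsACRep L u u₁ f₀)
    (h₁ : IsACRep L u₁ v f₁) :
    (¬ d₁ → f₀ 0 = 0 ∧ f₀ L = 0) ∧ (¬ d₀ → f₁ 0 = 0 ∧ f₁ L = 0) := by
  have key : ∀ p p' : ℝ → ℝ, ContDiff ℝ ∞ p → (∀ x, HasDerivAt p (p' x) x) →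
      (d₀ → p 0 = 0 ∧ p L = 0) → (d₁ → p' 0 = 0 ∧ p' L = 0) →
      (f₁ L * p L - f₀ L * p' L) - (f₁ 0 * p 0 - f₀ 0 * p' 0) = 0 := by
    intro p p' hp hd h0 h1
    have hd' : deriv p = p' := funext fun x => (hd x).deriv
    obtain ⟨r1, r2⟩ := isACRep_smooth (L := L) hp
    have := inner_sub_inner_eq_boundary hL h₀ h₁ r1 r2
    rw [h p ⟨hp, h0, by rwa [hd']⟩, sub_self] at this
    rw [hd'] at this
    exact this.symm
  -- Cubic polynomials for which exactly one of the four boundary values is not zero.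
  have hL2 : L ^ 2 ≠ 0 := by positivity
  have hL3 : L ^ 3 ≠ 0 := by positivity
  constructor
  · intro hd
    have k1 := key (fun x => x * (L - x) ^ 2) (fun x => (L - x) ^ 2 - 2 * x * (L - x))
      (by fun_prop) (fun x => by
        have := (hasDerivAt_id x).mul (((hasDerivAt_id x).const_sub L).pow 2)
        exact this.congr_deriv (by simp; ring)) (fun _ => by simp) (fun h => absurd h hd)
    have k2 := key (fun x => x ^ 2 * (L - x)) (fun x => 2 * x * (L - x) - x ^ 2)
      (by fun_prop) (fun x => by
        have := ((hasDerivAt_id x).pow 2).mul ((hasDerivAt_id x).const_sub L)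
        exact this.congr_deriv (by simp; ring)) (fun _ => by simp) (fun h => absurd h hd)
    constructor
    · have : f₀ 0 * L ^ 2 = 0 := by linear_combination k1
      simpa [hL2] using this
    · have : f₀ L * L ^ 2 = 0 := by linear_combination k2
      simpa [hL2] using this
  · intro hd
    have k1 := key (fun x => (L - x) ^ 2 * (L + 2 * x)) (fun x => -6 * x * (L - x))
      (by fun_prop) (fun x => by
        have := (((hasDerivAt_id x).const_sub L).pow 2).mul
          (((hasDerivAt_id x).const_mul 2).const_add L)
        exact this.congr_deriv (by simp; ring)) (fun h => absurd h hd) (fun _ => by simp)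
    have k2 := key (fun x => x ^ 2 * (3 * L - 2 * x)) (fun x => 6 * x * (L - x))
      (by fun_prop) (fun x => by
        have := ((hasDerivAt_id x).pow 2).mul
          (((hasDerivAt_id x).const_mul 2).const_sub (3 * L))
        exact this.congr_deriv (by simp; ring)) (fun h => absurd h hd) (fun _ => by simp)
    constructor
    · have : f₁ 0 * L ^ 3 = 0 := by linear_combination -k1
      simpa [hL3] using this
    · have : f₁ L * L ^ 3 = 0 := by linear_combination k2
      simpa [hL3] using this

theorem isGraph_of_boundary {L : ℝ} (hL : 0 < L) {d₀ d₁ : Prop} {u u₁ v : L2 L} {f₀ f₁ : ℝ → ℝ}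
    (h₀ : IsACRep L u u₁ f₀) (h₁ : IsACRep L u₁ v f₁)
    (hf₀ : ¬ d₁ → f₀ 0 = 0 ∧ f₀ L = 0) (hf₁ : ¬ d₀ → f₁ 0 = 0 ∧ f₁ L = 0) :
    IsGraph L d₀ d₁ u v := by
  intro p hp
  obtain ⟨r1, r2⟩ := isACRep_smooth (L := L) hp.smooth
  have := inner_sub_inner_eq_boundary hL h₀ h₁ r1 r2
  have a1 : f₀ 0 * deriv p 0 = 0 ∧ f₀ L * deriv p L = 0 := by
    by_cases h : d₁
    · simp [hp.deriv_zero h]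
    · simp [hf₀ h]
  have a2 : f₁ 0 * p 0 = 0 ∧ f₁ L * p L = 0 := by
    by_cases h : d₀
    · simp [hp.zero h]
    · simp [hf₁ h]
  linarith [a1.1, a1.2, a2.1, a2.2]

theorem HasWeakDeriv.exists_isACRep_two {L : ℝ} (hL : 0 < L) {u v : L2 L}
    (h : HasWeakDeriv L 2 u v) :
    ∃ u₁ f₀ f₁, HasWeakDeriv L 1 u u₁ ∧ IsACRep L u u₁ f₀ ∧ IsACRep L u₁ v f₁ := by
  obtain ⟨u₁, h1, h2⟩ := h.exists_pred hL
  obtain ⟨f₀, hf₀⟩ := h1.exists_isACRep hL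
  obtain ⟨f₁, hf₁⟩ := h2.exists_isACRep hL
  exact ⟨u₁, f₀, f₁, h1, hf₀, hf₁⟩

/-! ### The form domain and the resolvent -/

/-- The graph of `B = ∂ₓ² + λ / 2`, with the boundary conditions of order at most `1`, inside
`L² × L²`. Since `-𝒜 + λ² / 4 = B* B`, it is the form domain of `𝒜` with the form norm. The pairing
is with functions subject to the conditions complementary to those of `bc`, which makes the graph
closed at once. -/
def formSpace (L lam : ℝ) (bc : BoundaryCondition) : Submodule ℝ (WithLp 2 (L2 L × L2 L)) where
  carrier := {w | IsGraph L (1 ∉ bc.orders) (0 ∉ bc.orders) w.fst (w.snd - (lam / 2) • w.fst)}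
  add_mem' := by
    intro w w' h h' p hp
    have h1 := h p hp
    have h2 := h' p hp
    simp only [WithLp.add_fst, WithLp.add_snd, inner_add_left, inner_sub_left, smul_add] at *
    linarith
  zero_mem' := by
    intro p hp
    simp
  smul_mem' := by
    intro c w h p hp
    have h1 := h p hp
    simp only [WithLp.smul_fst, WithLp.smul_snd, inner_sub_left, inner_smul_left] at *
    simp only [conj_trivial] at *
    linear_combination c * h1

theorem mem_formSpace {L lam : ℝ} {bc : BoundaryCondition} {w : WithLp 2 (L2 L × L2 L)} :
    w ∈ formSpace L lam bc ↔
      IsGraph L (1 ∉ bc.orders) (0 ∉ bc.orders) w.fst (w.snd - (lam / 2) • w.fst) := Iff.rfl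

theorem isClosed_formSpace (L lam : ℝ) (bc : BoundaryCondition) :
    IsClosed (formSpace L lam bc : Set (WithLp 2 (L2 L × L2 L))) := by
  have h : (formSpace L lam bc : Set (WithLp 2 (L2 L × L2 L))) =
      ⋂ p : {p // IsBoundaryTest L (1 ∉ bc.orders) (0 ∉ bc.orders) p},
        {w | ⟪w.snd - (lam / 2) • w.fst, ofFun L p.1⟫ = ⟪w.fst, ofFun L (deriv (deriv p.1))⟫} := by
    ext w
    simp only [mem_iInter, mem_ofPred_eq, Subtype.forall]
    exact Iff.rfl
  rw [h]
  refine isClosed_iInter fun p => isClosed_eq ?_ ?_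
  · have h1 : Continuous fun w : WithLp 2 (L2 L × L2 L) => w.snd - (lam / 2) • w.fst := by
      have hf : Continuous fun w : WithLp 2 (L2 L × L2 L) => w.fst := WithLp.continuous_fst ..
      have hs : Continuous fun w : WithLp 2 (L2 L × L2 L) => w.snd := WithLp.continuous_snd ..
      fun_prop
    exact h1.inner continuous_const
  · exact (WithLp.continuous_fst ..).inner continuous_const

instance instCompleteSpaceFormSpace (L lam : ℝ) (bc : BoundaryCondition) :
    CompleteSpace (formSpace L lam bc) :=
  (isClosed_formSpace L lam bc).completeSpace_coe

/-- The embedding of the form domain into `L²(0, L)`. -/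
def embed (L lam : ℝ) (bc : BoundaryCondition) : formSpace L lam bc →L[ℝ] L2 L :=
  (WithLp.fstL 2 ℝ (L2 L) (L2 L)).comp (formSpace L lam bc).subtypeL

theorem hasWeakDeriv_two_embed {L lam : ℝ} {bc : BoundaryCondition} (w : formSpace L lam bc) :
    HasWeakDeriv L 2 (embed L lam bc w)
      ((w : WithLp 2 (L2 L × L2 L)).snd - (lam / 2) • embed L lam bc w) :=
  (mem_formSpace.1 w.2).hasWeakDeriv

theorem exists_hasWeakDeriv_of_le {L : ℝ} (hL : 0 < L) {k : ℕ} {u v : L2 L}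
    (h : HasWeakDeriv L k u v) {j : ℕ} (hj : j ≤ k) : ∃ w, HasWeakDeriv L j u w := by
  induction k generalizing v with
  | zero => obtain rfl := Nat.le_zero.1 hj; exact ⟨v, h⟩
  | succ k ih =>
    rcases Nat.lt_or_ge j (k + 1) with hlt | hge
    · obtain ⟨w, hw, -⟩ := h.exists_pred hL
      exact ih hw (Nat.lt_succ_iff.1 hlt)
    · obtain rfl := le_antisymm hj hge; exact ⟨v, h⟩

theorem memSobolev_embed {L lam : ℝ} (hL : 0 < L) {bc : BoundaryCondition}
    (w : formSpace L lam bc) : MemSobolev L 2 (embed L lam bc w) :=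
  fun _ hk => exists_hasWeakDeriv_of_le hL (hasWeakDeriv_two_embed w) hk

/-- The weak derivative along a bounded operator with values in a Sobolev space is bounded, by the
closed graph theorem. -/
def weakDerivCLM {L : ℝ} {X : Type*} [NormedAddCommGroup X] [NormedSpace ℝ X] [CompleteSpace X]
    (T : X →L[ℝ] L2 L) (k : ℕ) (h : ∀ x, ∃ v, HasWeakDeriv L k (T x) v) : X →L[ℝ] L2 L :=
  ContinuousLinearMap.ofSeqClosedGraph (g :=
    { toFun := fun x => weakDeriv L k (T x)
      map_add' := fun x y => by
        rw [map_add]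
        exact ((hasWeakDeriv_weakDeriv (h x)).add (hasWeakDeriv_weakDeriv (h y))).weakDeriv_eq
      map_smul' := fun c x => by
        rw [map_smul]
        exact ((hasWeakDeriv_weakDeriv (h x)).smul c).weakDeriv_eq }) (by
    intro u x y hu hy
    exact (HasWeakDeriv.of_tendsto (fun n => hasWeakDeriv_weakDeriv (h (u n)))
      ((T.continuous.tendsto x).comp hu) hy).weakDeriv_eq.symm)

theorem weakDerivCLM_apply {L : ℝ} {X : Type*} [NormedAddCommGroup X] [NormedSpace ℝ X]
    [CompleteSpace X] (T : X →L[ℝ] L2 L) (k : ℕ) (h : ∀ x, ∃ v, HasWeakDeriv L k (T x) v) (x : X) :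
    weakDerivCLM T k h x = weakDeriv L k (T x) := rfl

theorem isCompactOperator_embed {L : ℝ} (hL : 0 < L) (lam : ℝ) (bc : BoundaryCondition) :
    IsCompactOperator (embed L lam bc) :=
  isCompactOperator_of_hasWeakDeriv hL _
    (weakDerivCLM (embed L lam bc) 1 fun w => memSobolev_embed hL w 1 (by norm_num))
    fun w => hasWeakDeriv_weakDeriv (memSobolev_embed hL w 1 (by norm_num))

/-- An element of `H²(0, L)` subject to the boundary conditions of order at most `1` belongs to
the form domain. -/
theorem exists_embed_eq {L lam : ℝ} (hL : 0 < L) {bc : BoundaryCondition} {u : L2 L}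
    (h : MemSobolev L 2 u) (hbc : SatisfiesBC L bc 2 u) :
    ∃ w : formSpace L lam bc, embed L lam bc w = u ∧
      (w : WithLp 2 (L2 L × L2 L)).snd = weakDeriv L 2 u + (lam / 2) • u := by
  have h2 := hasWeakDeriv_weakDeriv (h 2 le_rfl)
  obtain ⟨u₁, f₀, f₁, hu₁, r0, r1⟩ := h2.exists_isACRep_two hL
  refine ⟨⟨WithLp.toLp 2 (u, weakDeriv L 2 u + (lam / 2) • u), ?_⟩, rfl, rfl⟩
  rw [mem_formSpace]
  have e1 : (WithLp.toLp 2 (u, weakDeriv L 2 u + (lam / 2) • u)).snd -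
      (lam / 2) • (WithLp.toLp 2 (u, weakDeriv L 2 u + (lam / 2) • u)).fst = weakDeriv L 2 u := by
    simp
  rw [e1]
  refine isGraph_of_boundary hL r0 r1 (fun h0 => ?_) (fun h1 => ?_)
  · have := hbc 0 (not_not.1 h0) (by norm_num)
    rw [weakDeriv_zero] at this
    exact (r0.vanishesAtEnds_iff hL).1 this
  · have := hbc 1 (not_not.1 h1) (by norm_num)
    rw [hu₁.weakDeriv_eq] at this
    exact (r1.vanishesAtEnds_iff hL).1 this

theorem inner_formSpace {L lam : ℝ} {bc : BoundaryCondition} (w w' : formSpace L lam bc) :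
    ⟪w, w'⟫ = ⟪embed L lam bc w, embed L lam bc w'⟫ +
      ⟪(w : WithLp 2 (L2 L × L2 L)).snd, (w' : WithLp 2 (L2 L × L2 L)).snd⟫ := rfl

theorem BoundaryCondition.zero_or_one (bc : BoundaryCondition) :
    0 ∈ bc.orders ∨ 1 ∈ bc.orders := by
  cases bc <;> simp [BoundaryCondition.orders]

/-- The conditions of order `2` and `3` are complementary to those of order `1` and `0`. -/
theorem BoundaryCondition.two_mem_iff (bc : BoundaryCondition) :
    2 ∈ bc.orders ↔ 1 ∉ bc.orders := by
  cases bc <;> simp [BoundaryCondition.orders]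

theorem BoundaryCondition.three_mem_iff (bc : BoundaryCondition) :
    3 ∈ bc.orders ↔ 0 ∉ bc.orders := by
  cases bc <;> simp [BoundaryCondition.orders]

theorem BoundaryCondition.le_three (bc : BoundaryCondition) {k : ℕ} (hk : k ∈ bc.orders) :
    k ≤ 3 := by
  cases bc <;> simp [BoundaryCondition.orders] at hk <;> omega

/-- An element `w` of the form domain with `⟪w, w'⟫ = ⟪f, w'⟫_{L²}` for all `w'` belongs to the
domain of `𝒜` and satisfies the natural boundary conditions. -/
theorem memDomain_of_forall_inner {L lam : ℝ} (hL : 0 < L) {bc : BoundaryCondition} {f : L2 L}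
    (w : formSpace L lam bc) (h : ∀ w' : formSpace L lam bc, ⟪w, w'⟫ = ⟪f, embed L lam bc w'⟫) :
    MemDomain L bc (embed L lam bc w) ∧
      opA L lam (embed L lam bc w) = (1 + lam ^ 2 / 4) • embed L lam bc w - f := by
  set u := embed L lam bc w with hu
  set g := (w : WithLp 2 (L2 L × L2 L)).snd with hg
  -- `g = B u` has a weak second derivative and satisfies the adjoint boundary conditions.
  have hgr : IsGraph L (0 ∈ bc.orders) (1 ∈ bc.orders) g (f - u - (lam / 2) • g) := by
    intro p hp
    obtain ⟨r0, r1⟩ := isACRep_smooth (L := L) hp.smooth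
    have hmem : WithLp.toLp 2 (ofFun L p, ofFun L (deriv (deriv p)) + (lam / 2) • ofFun L p) ∈
        formSpace L lam bc := by
      rw [mem_formSpace]
      have e1 : (WithLp.toLp 2 (ofFun L p, ofFun L (deriv (deriv p)) + (lam / 2) • ofFun L p)).snd -
          (lam / 2) • (WithLp.toLp 2 (ofFun L p,
            ofFun L (deriv (deriv p)) + (lam / 2) • ofFun L p)).fst =
          ofFun L (deriv (deriv p)) := by
        simp
      rw [e1]
      exact isGraph_of_boundary hL r0 r1 (fun h0 => hp.zero (not_not.1 h0))
        (fun h1 => hp.deriv_zero (not_not.1 h1))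
    have h1 := h ⟨_, hmem⟩
    rw [inner_formSpace] at h1
    change ⟪u, ofFun L p⟫ + ⟪g, ofFun L (deriv (deriv p)) + (lam / 2) • ofFun L p⟫ =
      ⟪f, ofFun L p⟫ at h1
    rw [inner_add_right, inner_smul_right] at h1
    rw [inner_sub_left, inner_sub_left, inner_smul_left]
    simp only [conj_trivial]
    linarith
  have hw := mem_formSpace.1 w.2
  change IsGraph L _ _ u (g - (lam / 2) • u) at hw
  obtain ⟨u₁, f₀, f₁, hu₁, r0, r1⟩ := hw.hasWeakDeriv.exists_isACRep_two hL
  obtain ⟨g₁, h₀, h₁, hg₁, s0, s1⟩ := hgr.hasWeakDeriv.exists_isACRep_two hL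
  have hb := hw.boundary hL r0 r1
  have hb' := hgr.boundary hL s0 s1
  set u₂ := g - (lam / 2) • u with hu₂
  have d1 := r0.hasWeakDeriv hL
  have d2 := d1.comp_one (r1.hasWeakDeriv hL)
  have e3 : HasWeakDeriv L 1 u₂ (g₁ - (lam / 2) • u₁) := hg₁.sub_smul hu₁ _
  have e4 : HasWeakDeriv L 1 (g₁ - (lam / 2) • u₁)
      (f - u - (lam / 2) • g - (lam / 2) • u₂) :=
    (s1.hasWeakDeriv hL).sub_smul (r1.hasWeakDeriv hL) _
  have d3 := d2.comp_one e3
  have d4 := d3.comp_one e4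
  obtain ⟨q₂, t2⟩ := e3.exists_isACRep hL
  obtain ⟨q₃, t3⟩ := e4.exists_isACRep hL
  have v0 : 0 ∈ bc.orders → VanishesAtEnds L u := fun h0 =>
    (r0.vanishesAtEnds_iff hL).2 (hb.1 (not_not.2 h0))
  have v1 : 1 ∈ bc.orders → VanishesAtEnds L u₁ := fun h1 =>
    (r1.vanishesAtEnds_iff hL).2 (hb.2 (not_not.2 h1))
  -- One of the conditions on `u`, `u'` is always present, so that `u'' = g - (λ / 2) u` and
  -- `u''' = g' - (λ / 2) u'` inherit those on `g` and `g'`.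
  have vsub : ∀ a b : L2 L, VanishesAtEnds L a → VanishesAtEnds L b →
      VanishesAtEnds L (a - (lam / 2) • b) := by
    rintro a b ⟨p, hp, hpa, hp0, hpL⟩ ⟨q, hq, hqb, hq0, hqL⟩
    refine ⟨fun x => p x - lam / 2 * q x, hp.sub (continuousOn_const.mul hq), ?_,
      by simp [hp0, hq0], by simp [hpL, hqL]⟩
    filter_upwards [hpa, hqb, Lp.coeFn_sub a ((lam / 2) • b), Lp.coeFn_smul (lam / 2) b]
      with x h1 h2 h3 h4
    rw [h3, Pi.sub_apply, h4, Pi.smul_apply, h1, h2, smul_eq_mul]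
  have v2 : 2 ∈ bc.orders → VanishesAtEnds L u₂ := fun h2 => by
    rw [bc.two_mem_iff] at h2
    exact vsub _ _ ((s0.vanishesAtEnds_iff hL).2 (hb'.1 h2))
      (v0 (bc.zero_or_one.resolve_right h2))
  have v3 : 3 ∈ bc.orders → VanishesAtEnds L (g₁ - (lam / 2) • u₁) := fun h3 => by
    rw [bc.three_mem_iff] at h3
    exact vsub _ _ ((s1.vanishesAtEnds_iff hL).2 (hb'.2 h3))
      (v1 (bc.zero_or_one.resolve_left h3))
  refine ⟨⟨fun k hk => exists_hasWeakDeriv_of_le hL d4 hk, fun k hk _ => ?_⟩, ?_⟩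
  · have := bc.le_three hk
    interval_cases k
    · rw [weakDeriv_zero]; exact v0 hk
    · rw [hu₁.weakDeriv_eq]; exact v1 hk
    · rw [d2.weakDeriv_eq]; exact v2 hk
    · rw [d3.weakDeriv_eq]; exact v3 hk
  · rw [opA, d4.weakDeriv_eq, d2.weakDeriv_eq, hu₂]
    module

/-- Green's formula: on the domain of `𝒜`, the form inner product is
`⟪(1 + λ² / 4) u - 𝒜 u, ·⟫_{L²}`. -/
theorem exists_embed_eq_of_memDomain {L lam : ℝ} (hL : 0 < L) {bc : BoundaryCondition} {u : L2 L}
    (h : MemDomain L bc u) : ∃ w : formSpace L lam bc, embed L lam bc w = u ∧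
      ∀ w' : formSpace L lam bc,
        ⟪w, w'⟫ = ⟪(1 + lam ^ 2 / 4) • u - opA L lam u, embed L lam bc w'⟫ := by
  obtain ⟨w, hw, hw2⟩ := exists_embed_eq (lam := lam) hL
    (fun k hk => h.1 k (by omega)) (fun k hk _ => h.2 k hk (by omega))
  refine ⟨w, hw, fun w' => ?_⟩
  obtain ⟨u₃, d3, e4⟩ := (hasWeakDeriv_weakDeriv (h.1 4 le_rfl)).exists_pred hL
  obtain ⟨u₂, d2, e3⟩ := d3.exists_pred hL
  obtain ⟨u₁, d1, e2⟩ := d2.exists_pred hL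
  obtain ⟨q₀, r0⟩ := d1.exists_isACRep hL
  obtain ⟨q₁, r1⟩ := e2.exists_isACRep hL
  obtain ⟨q₂, r2⟩ := e3.exists_isACRep hL
  obtain ⟨q₃, r3⟩ := e4.exists_isACRep hL
  have hgr := mem_formSpace.1 w'.2
  obtain ⟨v₁, f₀, f₁, hv₁, s0, s1⟩ := hgr.hasWeakDeriv.exists_isACRep_two hL
  have hb := hgr.boundary hL s0 s1
  rw [inner_formSpace, hw2, hw, d2.weakDeriv_eq, opA, d2.weakDeriv_eq]
  set u₄ := weakDeriv L 4 u
  change _ = ⟪_, (w' : WithLp 2 (L2 L × L2 L)).fst⟫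
  change ⟪u, (w' : WithLp 2 (L2 L × L2 L)).fst⟫ + _ = _
  set v := (w' : WithLp 2 (L2 L × L2 L)).fst
  set g := (w' : WithLp 2 (L2 L × L2 L)).snd
  have k1 := inner_sub_inner_eq_boundary hL r2 r3 s0 s1
  have k2 := inner_sub_inner_eq_boundary hL r0 r1 s0 s1
  have bcu : ∀ k, k ∈ bc.orders → VanishesAtEnds L (weakDeriv L k u) := fun k hk =>
    h.2 k hk (by have := bc.le_three hk; omega)
  have b0 : 0 ∈ bc.orders → q₀ 0 = 0 ∧ q₀ L = 0 := fun hk => by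
    have := bcu 0 hk
    rw [weakDeriv_zero] at this
    exact (r0.vanishesAtEnds_iff hL).1 this
  have b1 : 1 ∈ bc.orders → q₁ 0 = 0 ∧ q₁ L = 0 := fun hk =>
    (r1.vanishesAtEnds_iff hL).1 (d1.weakDeriv_eq ▸ bcu 1 hk)
  have b2 : 1 ∉ bc.orders → q₂ 0 = 0 ∧ q₂ L = 0 := fun hk =>
    (r2.vanishesAtEnds_iff hL).1 (d2.weakDeriv_eq ▸ bcu 2 (bc.two_mem_iff.2 hk))
  have b3 : 0 ∉ bc.orders → q₃ 0 = 0 ∧ q₃ L = 0 := fun hk =>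
    (r3.vanishesAtEnds_iff hL).1 (d3.weakDeriv_eq ▸ bcu 3 (bc.three_mem_iff.2 hk))
  have z1 : (q₃ L * f₀ L - q₂ L * f₁ L) - (q₃ 0 * f₀ 0 - q₂ 0 * f₁ 0) = 0 := by
    have a1 : q₃ 0 * f₀ 0 = 0 ∧ q₃ L * f₀ L = 0 := by
      by_cases hk : 0 ∈ bc.orders
      · simp [hb.1 (not_not.2 hk)]
      · simp [b3 hk]
    have a2 : q₂ 0 * f₁ 0 = 0 ∧ q₂ L * f₁ L = 0 := by
      by_cases hk : 1 ∈ bc.orders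
      · simp [hb.2 (not_not.2 hk)]
      · simp [b2 hk]
    linarith [a1.1, a1.2, a2.1, a2.2]
  have z2 : (q₁ L * f₀ L - q₀ L * f₁ L) - (q₁ 0 * f₀ 0 - q₀ 0 * f₁ 0) = 0 := by
    rcases bc.zero_or_one with hk | hk
    · simp [hb.1 (not_not.2 hk), b0 hk]
    · simp [hb.2 (not_not.2 hk), b1 hk]
  rw [z1] at k1
  rw [z2] at k2
  simp only [inner_sub_left, inner_add_left, inner_sub_right, inner_smul_left, inner_smul_right,
    inner_neg_left, conj_trivial] at *
  linear_combination -k1 - (lam / 2) * k2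

/-- The resolvent `(1 + λ² / 4 - 𝒜)⁻¹ = (1 + B* B)⁻¹` of `𝒜`, written as `J J*` where `J` is the
embedding of the form domain into `L²(0, L)`. -/
def resolvent (L lam : ℝ) (bc : BoundaryCondition) : L2 L →L[ℝ] L2 L :=
  (embed L lam bc).comp (ContinuousLinearMap.adjoint (embed L lam bc))

theorem resolvent_apply {L lam : ℝ} {bc : BoundaryCondition} (f : L2 L) :
    resolvent L lam bc f = embed L lam bc (ContinuousLinearMap.adjoint (embed L lam bc) f) := rfl

theorem memDomain_resolvent {L lam : ℝ} (hL : 0 < L) {bc : BoundaryCondition} (f : L2 L) :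
    MemDomain L bc (resolvent L lam bc f) ∧
      opA L lam (resolvent L lam bc f) = (1 + lam ^ 2 / 4) • resolvent L lam bc f - f :=
  memDomain_of_forall_inner hL _ fun w' =>
    ContinuousLinearMap.adjoint_inner_left (embed L lam bc) w' f

theorem resolvent_opA {L lam : ℝ} (hL : 0 < L) {bc : BoundaryCondition} {u : L2 L}
    (h : MemDomain L bc u) :
    resolvent L lam bc ((1 + lam ^ 2 / 4) • u - opA L lam u) = u := by
  obtain ⟨w, hw, hw'⟩ := exists_embed_eq_of_memDomain (lam := lam) hL h
  have : w = ContinuousLinearMap.adjoint (embed L lam bc)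
      ((1 + lam ^ 2 / 4) • u - opA L lam u) := by
    refine ext_inner_right ℝ fun w' => ?_
    rw [hw', ContinuousLinearMap.adjoint_inner_left]
  rw [resolvent_apply, ← this, hw]

theorem inner_resolvent {L lam : ℝ} {bc : BoundaryCondition} (f g : L2 L) :
    ⟪resolvent L lam bc f, g⟫ = ⟪ContinuousLinearMap.adjoint (embed L lam bc) f,
      ContinuousLinearMap.adjoint (embed L lam bc) g⟫ := by
  rw [resolvent_apply, ContinuousLinearMap.adjoint_inner_right]

theorem isSymmetric_resolvent (L lam : ℝ) (bc : BoundaryCondition) :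
    (resolvent L lam bc : L2 L →ₗ[ℝ] L2 L).IsSymmetric := by
  intro f g
  change ⟪resolvent L lam bc f, g⟫ = ⟪f, resolvent L lam bc g⟫
  rw [inner_resolvent, ← real_inner_comm, ← inner_resolvent, real_inner_comm]

theorem isCompactOperator_resolvent {L : ℝ} (hL : 0 < L) (lam : ℝ) (bc : BoundaryCondition) :
    IsCompactOperator (resolvent L lam bc) :=
  (isCompactOperator_embed hL lam bc).comp_clm _

theorem opA_zero (L lam : ℝ) : opA L lam 0 = 0 := by
  have h : ∀ k, HasWeakDeriv L k (0 : L2 L) 0 := fun k => by rw [hasWeakDeriv_iff]; simp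
  simp [opA, (h 4).weakDeriv_eq, (h 2).weakDeriv_eq]

theorem inner_resolvent_pos {L lam : ℝ} (hL : 0 < L) {bc : BoundaryCondition} {f : L2 L}
    (hf : f ≠ 0) : 0 < ⟪resolvent L lam bc f, f⟫ := by
  rw [inner_resolvent, real_inner_self_pos]
  intro h
  apply hf
  have h1 : resolvent L lam bc f = 0 := by rw [resolvent_apply, h, map_zero]
  have h2 := (memDomain_resolvent (lam := lam) hL (bc := bc) f).2
  rw [h1, opA_zero, smul_zero, zero_sub] at h2
  exact neg_eq_zero.1 h2.symm

theorem IsEigen.smul_resolvent {L lam : ℝ} (hL : 0 < L) {bc : BoundaryCondition} {μ : ℝ} {u : L2 L}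
    (h : IsEigen L lam bc μ u) : (1 + lam ^ 2 / 4 - μ) • resolvent L lam bc u = u := by
  have := resolvent_opA hL h.1 (lam := lam)
  rwa [h.2, ← sub_smul, map_smul] at this

theorem isEigen_of_resolvent {L lam : ℝ} (hL : 0 < L) {bc : BoundaryCondition} {ρ : ℝ}
    (hρ : ρ ≠ 0) {u : L2 L} (h : resolvent L lam bc u = ρ • u) :
    IsEigen L lam bc (1 + lam ^ 2 / 4 - ρ⁻¹) u := by
  have h1 : resolvent L lam bc (ρ⁻¹ • u) = u := by
    rw [map_smul, h, smul_smul, inv_mul_cancel₀ hρ, one_smul]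
  have h2 := memDomain_resolvent (lam := lam) hL (bc := bc) (ρ⁻¹ • u)
  rw [h1] at h2
  exact ⟨h2.1, by rw [h2.2, sub_smul]⟩

/-! ### Eigenbases of compact operators -/

section Spectral

variable {H : Type*} [NormedAddCommGroup H] [InnerProductSpace ℝ H]

/-- Infinitely many orthonormal eigenvectors with eigenvalues at least `ε` would have images at
mutual distances at least `ε`, against compactness. -/
theorem finite_setOf_le_eigenvalue {R : H →L[ℝ] H} (hc : IsCompactOperator R) {κ : Type*}
    {φ : κ → H} (hφ : Orthonormal ℝ φ) {ρ : κ → ℝ} (hR : ∀ k, R (φ k) = ρ k • φ k) {ε : ℝ}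
    (hε : 0 < ε) : {k | ε ≤ ρ k}.Finite := by
  by_contra hinf
  let x := Set.Infinite.natEmbedding _ hinf
  obtain ⟨K, hK, hRK⟩ := (isCompactOperator_iff_image_closedBall_subset_compact
    (R : H →ₗ[ℝ] H) one_pos).1 hc
  have hmem : ∀ n, R (φ (x n)) ∈ K := fun n => hRK ⟨φ (x n), by simp [hφ.1], rfl⟩
  obtain ⟨a, -, g, hg, hlim⟩ := hK.tendsto_subseq hmem
  obtain ⟨N, hN⟩ := Metric.cauchySeq_iff'.1 hlim.cauchySeq ε hε
  have h1 := hN (N + 1) (Nat.le_succ N)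
  have hne : (x (g (N + 1)) : κ) ≠ x (g N) := fun h => by
    have := hg.injective (x.injective (Subtype.ext h)); omega
  have h2 : ε ≤ ρ (x (g (N + 1))) := (x (g (N + 1))).2
  simp only [Function.comp_apply, dist_eq_norm, hR] at h1
  have h3 : ⟪ρ (x (g (N + 1))) • φ (x (g (N + 1))) - ρ (x (g N)) • φ (x (g N)),
      φ (x (g (N + 1)))⟫ = ρ (x (g (N + 1))) := by
    rw [inner_sub_left, inner_smul_left, inner_smul_left, hφ.2 hne.symm,
      real_inner_self_eq_norm_sq, hφ.1]
    simp
  have h4 := real_inner_le_norm (ρ (x (g (N + 1))) • φ (x (g (N + 1))) - ρ (x (g N)) • φ (x (g N)))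
    (φ (x (g (N + 1))))
  rw [h3, hφ.1, mul_one] at h4
  linarith

/-- An orthonormal basis of the sum of the eigenspaces of a compact positive operator for the
eigenvalues `≥ r₀` extends to a Hilbert basis of eigenvectors; the remaining eigenvalues stay away
from `r₀`. -/
theorem exists_hilbertBasis_eigenvectors [CompleteSpace H] {R : H →L[ℝ] H}
    (hc : IsCompactOperator R)
    (hs : (R : H →ₗ[ℝ] H).IsSymmetric) (hpos : ∀ x, x ≠ 0 → 0 < ⟪R x, x⟫) {n : ℕ} {e : Fin n → H}
    (he : Orthonormal ℝ e) {r : Fin n → ℝ} (hr : ∀ j, R (e j) = r j • e j) {r₀ : ℝ} (hr₀ : 0 < r₀)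
    (hr₀' : ∀ j, r₀ ≤ r j)
    (hcomp : ∀ ρ v, r₀ ≤ ρ → R v = ρ • v → v ∈ Submodule.span ℝ (range e)) :
    ∃ (κ : Type) (_ : Countable κ) (φ : HilbertBasis (Fin n ⊕ κ) ℝ H) (ρ : Fin n ⊕ κ → ℝ),
      (∀ j, φ (Sum.inl j) = e j) ∧ (∀ i, R (φ i) = ρ i • φ i) ∧ (∀ i, 0 < ρ i) ∧
      ∃ r₁ < r₀, ∀ k, ρ (Sum.inr k) ≤ r₁ := by
  -- The eigenspaces for the eigenvalues `≥ r₀` are spanned by `e`; the basis is completed by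
  -- orthonormal bases of the other eigenspaces.
  have hfd : ∀ μ : {μ : ℝ // μ < r₀ ∧ μ ≠ 0},
      FiniteDimensional ℝ (Module.End.eigenspace (R : H →ₗ[ℝ] H) μ) := fun μ =>
    ContinuousLinearMap.finite_dimensional_eigenspace hc _ μ.2.2
  let β := fun μ : {μ : ℝ // μ < r₀ ∧ μ ≠ 0} =>
    stdOrthonormalBasis ℝ (Module.End.eigenspace (R : H →ₗ[ℝ] H) μ)
  let κ := Σ μ : {μ : ℝ // μ < r₀ ∧ μ ≠ 0},
    Fin (Module.finrank ℝ (Module.End.eigenspace (R : H →ₗ[ℝ] H) μ))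
  let ψ : κ → H := fun k => (β k.1 k.2 : H)
  have hψ : Orthonormal ℝ ψ :=
    (hs.orthogonalFamily_eigenspaces.comp Subtype.val_injective).orthonormal_sigma_orthonormal
      (fun μ => (β μ).orthonormal)
  have hRψ : ∀ k, R (ψ k) = (k.1 : ℝ) • ψ k := fun k =>
    Module.End.mem_eigenspace_iff.1 (β k.1 k.2).2
  have hkpos : ∀ k : κ, (0 : ℝ) < k.1 := by
    intro k
    have h1 := hpos (ψ k) (hψ.ne_zero k)
    rw [hRψ, inner_smul_left, real_inner_self_eq_norm_sq, hψ.1] at h1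
    simpa using h1
  have hcross : ∀ j k, ⟪e j, ψ k⟫ = 0 := by
    intro j k
    have h1 : ⟪R (e j), ψ k⟫ = ⟪e j, R (ψ k)⟫ := hs (e j) (ψ k)
    rw [hr, hRψ, inner_smul_left, inner_smul_right, conj_trivial] at h1
    have h2 : (r j - k.1) * ⟪e j, ψ k⟫ = 0 := by rw [sub_mul, h1, sub_self]
    have h3 : r j - k.1 ≠ 0 := by
      have := hr₀' j; have := k.1.2.1; intro h; linarith
    exact (mul_eq_zero.1 h2).resolve_left h3
  have hor : Orthonormal ℝ (Sum.elim e ψ) := by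
    refine ⟨?_, ?_⟩
    · rintro (j | k)
      · exact he.1 j
      · exact hψ.1 k
    · rintro (j | k) (j' | k') hne
      · exact he.2 fun h => hne (congrArg _ h)
      · exact hcross j k'
      · rw [← inner_conj_symm]; simp [hcross]
      · exact hψ.2 fun h => hne (congrArg _ h)
  have hspan : (Submodule.span ℝ (range (Sum.elim e ψ)))ᗮ = ⊥ := by
    rw [eq_bot_iff, ← ContinuousLinearMap.orthogonalComplement_iSup_eigenspaces_eq_bot hc hs]
    refine Submodule.orthogonal_le (iSup_le fun μ v hv => ?_)
    have hv' : R v = μ • v := Module.End.mem_eigenspace_iff.1 hv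
    have hle1 : Submodule.span ℝ (range e) ≤ Submodule.span ℝ (range (Sum.elim e ψ)) :=
      Submodule.span_mono (by rw [Sum.elim_range]; exact subset_union_left)
    have hle2 : Submodule.span ℝ (range ψ) ≤ Submodule.span ℝ (range (Sum.elim e ψ)) :=
      Submodule.span_mono (by rw [Sum.elim_range]; exact subset_union_right)
    by_cases h0 : μ = 0
    · by_cases hv0 : v = 0
      · rw [hv0]; exact zero_mem _
      · have := hpos v hv0
        rw [hv', h0] at this
        simp at this
    · rcases lt_or_ge μ r₀ with hlt | hge
      · refine hle2 ?_
        have h1 := (β ⟨μ, hlt, h0⟩).sum_repr ⟨v, hv⟩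
        have h2 := congrArg (Submodule.subtype _) h1
        rw [map_sum] at h2
        rw [show v = Submodule.subtype _ ⟨v, hv⟩ from rfl, ← h2]
        refine Submodule.sum_mem _ fun i _ => ?_
        rw [map_smul]
        exact Submodule.smul_mem _ _ (Submodule.subset_span ⟨⟨⟨μ, hlt, h0⟩, i⟩, rfl⟩)
      · exact hle1 (hcomp μ v hge hv')
  have hfin : ∀ ε : ℝ, 0 < ε → {k : κ | ε ≤ (k.1 : ℝ)}.Finite := fun ε hε =>
    finite_setOf_le_eigenvalue hc hψ (ρ := fun k => (k.1 : ℝ)) hRψ hε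
  have hcount : Countable κ := by
    rw [← Set.countable_univ_iff]
    have : (univ : Set κ) = ⋃ N : ℕ, {k : κ | 1 / ((N : ℝ) + 1) ≤ (k.1 : ℝ)} := by
      symm
      rw [eq_univ_iff_forall]
      intro k
      obtain ⟨N, hN⟩ := exists_nat_one_div_lt (hkpos k)
      exact mem_iUnion.2 ⟨N, hN.le⟩
    rw [this]
    exact countable_iUnion fun N => (hfin _ (by positivity)).countable
  refine ⟨κ, hcount, HilbertBasis.mkOfOrthogonalEqBot hor hspan,
    Sum.elim r (fun k => (k.1 : ℝ)), fun j => by simp, ?_, ?_, ?_⟩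
  · rintro (j | k)
    · simp [hr]
    · simp [hRψ]
  · rintro (j | k)
    · exact hr₀.trans_le (hr₀' j)
    · exact hkpos k
  -- Only finitely many of the eigenvalues below `r₀` exceed `r₀ / 2`.
  · have h1 : ∀ᶠ t in 𝓝[<] r₀, ∀ k ∈ {k : κ | r₀ / 2 ≤ (k.1 : ℝ)}, (k.1 : ℝ) < t :=
      (Filter.eventually_all_finite (hfin _ (by positivity))).2 fun k _ =>
        eventually_nhdsWithin_of_eventually_nhds (lt_mem_nhds k.1.2.1)
    have h2 : ∀ᶠ t in 𝓝[<] r₀, r₀ / 2 < t :=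
      eventually_nhdsWithin_of_eventually_nhds (lt_mem_nhds (by linarith))
    obtain ⟨t, ht1, ht2, ht3⟩ := (h1.and (h2.and self_mem_nhdsWithin)).exists
    refine ⟨t, ht3, fun k => ?_⟩
    rw [Sum.elim_inr]
    by_cases hk : r₀ / 2 ≤ (k.1 : ℝ)
    · exact (ht1 k hk).le
    · linarith

end Spectral

/-- `L²(0, L)` has a Hilbert basis of eigenvectors of `𝒜` that extends the given basis of the
unstable space; the remaining eigenvalues are bounded away from zero. -/
theorem IsUnstableBasis.exists_hilbertBasis {L lam : ℝ} (hL : 0 < L) {bc : BoundaryCondition}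
    {n : ℕ} {σ : Fin n → ℝ} {e : Fin n → L2 L} (he : IsUnstableBasis L lam bc σ e) :
    ∃ (κ : Type) (_ : Countable κ) (φ : HilbertBasis (Fin n ⊕ κ) ℝ (L2 L)) (μ : Fin n ⊕ κ → ℝ),
      (∀ j, φ (Sum.inl j) = e j) ∧ (∀ j, μ (Sum.inl j) = σ j) ∧
      (∀ i, IsEigen L lam bc (μ i) (φ i)) ∧ (∀ i, 0 < 1 + lam ^ 2 / 4 - μ i) ∧
      ∃ δ > 0, ∀ k, μ (Sum.inr k) ≤ -δ := by
  set c := 1 + lam ^ 2 / 4 with hc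
  have hc0 : 0 < c := by positivity
  have hpos : ∀ (μ : ℝ) (u : L2 L), u ≠ 0 → IsEigen L lam bc μ u → 0 < c - μ := by
    intro μ u hu h
    have h1 := h.smul_resolvent hL
    have h2 := inner_resolvent_pos (lam := lam) hL (bc := bc) hu
    have h3 : (c - μ) * ⟪resolvent L lam bc u, u⟫ = ‖u‖ ^ 2 := by
      have h4 := congrArg (fun v => ⟪v, u⟫) h1
      simp only [inner_smul_left, conj_trivial, real_inner_self_eq_norm_sq] at h4
      exact h4
    exact pos_of_mul_pos_left (h3 ▸ by positivity) h2.le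
  have hσ : ∀ j, 0 < c - σ j := fun j => hpos _ _ (he.orthonormal.ne_zero j) (he.eigen j)
  -- An eigenvalue `μ` of `𝒜` corresponds to the eigenvalue `(c - μ)⁻¹` of the resolvent, and
  -- `μ ≥ 0` to `(c - μ)⁻¹ ≥ c⁻¹`.
  obtain ⟨κ, hκ, φ, ρ, h1, h2, h3, r₁, h4, h5⟩ := exists_hilbertBasis_eigenvectors
    (isCompactOperator_resolvent hL lam bc) (isSymmetric_resolvent L lam bc)
    (fun x hx => inner_resolvent_pos hL hx) he.orthonormal (r := fun j => (c - σ j)⁻¹)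
    (fun j => by rw [eq_inv_smul_iff₀ (hσ j).ne']; exact (he.eigen j).smul_resolvent hL)
    (r₀ := c⁻¹) (by positivity)
    (fun j => inv_anti₀ (hσ j) (by linarith [he.nonneg j]))
    (fun ρ v hρ hv => by
      have hρ0 : 0 < ρ := lt_of_lt_of_le (by positivity) hρ
      refine he.complete _ v ?_ (isEigen_of_resolvent hL hρ0.ne' hv)
      have := inv_anti₀ (inv_pos.2 hc0) hρ
      rw [inv_inv] at this
      rw [← hc]
      linarith)
  have hE : ∀ i, IsEigen L lam bc (c - (ρ i)⁻¹) (φ i) := fun i =>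
    isEigen_of_resolvent hL (h3 i).ne' (h2 i)
  refine ⟨κ, hκ, φ, fun i => c - (ρ i)⁻¹, h1, fun j => ?_, hE, fun i => ?_, ?_⟩
  · have e1 := (hE (Sum.inl j)).2
    rw [h1, (he.eigen j).2] at e1
    exact (smul_left_injective ℝ (he.orthonormal.ne_zero j) e1).symm
  · have := inv_pos.2 (h3 i)
    linarith
  · set r := max r₁ (c⁻¹ / 2)
    have hr : r < c⁻¹ := max_lt h4 (half_lt_self (by positivity))
    have hr0 : 0 < r := lt_max_of_lt_right (by positivity)
    refine ⟨r⁻¹ - c, ?_, fun k => ?_⟩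
    · have := inv_strictAnti₀ hr0 hr
      rw [inv_inv] at this
      linarith
    · have := inv_anti₀ (h3 (Sum.inr k)) ((h5 k).trans (le_max_left _ _) : _ ≤ r)
      linarith

/-! ### Orthogonal series with time-dependent coefficients -/

section Series

variable {E : Type*} [NormedAddCommGroup E] [InnerProductSpace ℝ E] {ι : Type*} {ψ : ι → E}

theorem norm_sq_sum_smul (hψ : Orthonormal ℝ ψ) (a : ι → ℝ) (F : Finset ι) :
    ‖∑ i ∈ F, a i • ψ i‖ ^ 2 = ∑ i ∈ F, a i ^ 2 := by
  rw [← real_inner_self_eq_norm_sq, hψ.inner_sum]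
  simp [sq]

variable [CompleteSpace E]

theorem summable_smul_iff (hψ : Orthonormal ℝ ψ) (a : ι → ℝ) :
    Summable (fun i => a i • ψ i) ↔ Summable fun i => a i ^ 2 := by
  have := hψ.orthogonalFamily.summable_iff_norm_sq_summable (f := a)
  simpa using this

theorem inner_tsum_smul (hψ : Orthonormal ℝ ψ) {a : ι → ℝ} (ha : Summable fun i => a i ^ 2)
    (i : ι) : ⟪∑' j, a j • ψ j, ψ i⟫ = a i := by
  classical
  have h1 := ((summable_smul_iff hψ a).2 ha).hasSum.mapL (innerSL ℝ (ψ i))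
  have h2 : HasSum (fun j => (innerSL ℝ (ψ i)) (a j • ψ j)) (a i) := by
    convert hasSum_ite_eq i (a i) using 2 with j
    rw [innerSL_apply_apply, inner_smul_right, orthonormal_iff_ite.1 hψ]
    by_cases h : j = i
    · subst h; simp
    · simp [h, Ne.symm h]
  have h3 := h1.unique h2
  rw [innerSL_apply_apply] at h3
  rw [real_inner_comm, h3]

theorem norm_sq_tsum_smul (hψ : Orthonormal ℝ ψ) {a : ι → ℝ} (ha : Summable fun i => a i ^ 2) :
    ‖∑' j, a j • ψ j‖ ^ 2 = ∑' j, a j ^ 2 := by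
  have h1 := (((summable_smul_iff hψ a).2 ha).hasSum.norm.pow 2)
  refine tendsto_nhds_unique h1 ?_
  simp_rw [norm_sq_sum_smul hψ]
  exact ha.hasSum

/-- An orthogonal series with continuous coefficients and a summable majorant is continuous. -/
theorem continuousOn_tsum_smul (hψ : Orthonormal ℝ ψ) {c : ι → ℝ → ℝ} {M : ι → ℝ} {s : Set ℝ}
    (hc : ∀ i, ContinuousOn (c i) s) (hM : Summable M) (hcM : ∀ i, ∀ t ∈ s, c i t ^ 2 ≤ M i) :
    ContinuousOn (fun t => ∑' i, c i t • ψ i) s := by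
  have hsum : ∀ t ∈ s, Summable fun i => c i t ^ 2 := fun t ht =>
    hM.of_nonneg_of_le (fun i => sq_nonneg _) fun i => hcM i t ht
  have hlim : TendstoUniformlyOn (fun (F : Finset ι) t => ∑ i ∈ F, c i t • ψ i)
      (fun t => ∑' i, c i t • ψ i) atTop s := by
    rw [Metric.tendstoUniformlyOn_iff]
    intro ε hε
    have h1 : ∀ᶠ F : Finset ι in atTop, ∑' i, M i - ε ^ 2 < ∑ i ∈ F, M i :=
      hM.hasSum.eventually (lt_mem_nhds (by have : 0 < ε ^ 2 := by positivity
                                            linarith))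
    filter_upwards [h1] with F hF t ht
    have hM0 : ∀ i, 0 ≤ M i := fun i => (sq_nonneg _).trans (hcM i t ht)
    classical
    have h2 : ∑' i, c i t • ψ i - ∑ i ∈ F, c i t • ψ i =
        ∑' i, (if i ∈ F then 0 else c i t) • ψ i := by
      have hS := ((summable_smul_iff hψ _).2 (hsum t ht)).hasSum
      have hF' : HasSum (fun i => (if i ∈ F then c i t else 0) • ψ i) (∑ i ∈ F, c i t • ψ i) := by
        have h : HasSum (fun i => (if i ∈ F then c i t else 0) • ψ i)
            (∑ i ∈ F, (if i ∈ F then c i t else 0) • ψ i) :=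
          hasSum_sum_of_ne_finset_zero fun i hi => by simp [hi]
        rwa [Finset.sum_congr rfl fun i hi => by rw [if_pos hi]] at h
      rw [← (hS.sub hF').tsum_eq]
      refine tsum_congr fun i => ?_
      by_cases hi : i ∈ F <;> simp [hi]
    have h3 : ∀ i, (if i ∈ F then 0 else c i t) ^ 2 ≤ M i - (if i ∈ F then M i else 0) := by
      intro i
      by_cases hi : i ∈ F
      · simp [hi]
      · simpa [hi] using hcM i t ht
    have hMF : HasSum (fun i => if i ∈ F then M i else 0) (∑ i ∈ F, M i) := by
      have h : HasSum (fun i => if i ∈ F then M i else 0) (∑ i ∈ F, if i ∈ F then M i else 0) :=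
        hasSum_sum_of_ne_finset_zero fun i hi => by simp [hi]
      rwa [Finset.sum_congr rfl fun i hi => by rw [if_pos hi]] at h
    have h4 := hM.hasSum.sub hMF
    have h5 : Summable fun i => (if i ∈ F then 0 else c i t) ^ 2 :=
      h4.summable.of_nonneg_of_le (fun i => sq_nonneg _) h3
    rw [dist_eq_norm, h2]
    refine lt_of_pow_lt_pow_left₀ 2 hε.le ?_
    rw [norm_sq_tsum_smul hψ h5]
    calc _ ≤ ∑' i, M i - ∑ i ∈ F, M i := hasSum_le h3 h5.hasSum h4
      _ < ε ^ 2 := by linarith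
  refine hlim.continuousOn (Frequently.of_forall fun F => ?_)
  exact continuousOn_finsetSum F fun i _ => (hc i).smul continuousOn_const

/-- An orthogonal series with square integrable coefficients whose squared norms are summable is
square integrable. -/
theorem memLp_tsum_smul [Countable ι] (hψ : Orthonormal ℝ ψ) {c : ι → ℝ → ℝ} {ν : Measure ℝ}
    (hc : ∀ i, AEStronglyMeasurable (c i) ν) (hci : ∀ i, Integrable (fun t => c i t ^ 2) ν)
    (hsum : Summable fun i => ∫ t, c i t ^ 2 ∂ν) :
    MemLp (fun t => ∑' i, c i t • ψ i) 2 ν ∧ ∀ᵐ t ∂ν, Summable fun i => c i t ^ 2 := by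
  have hfin : ∫⁻ t, ∑' i, ENNReal.ofReal (c i t ^ 2) ∂ν ≠ ⊤ := by
    rw [lintegral_tsum fun i => ((hci i).aestronglyMeasurable.aemeasurable).ennreal_ofReal]
    have h1 : ∀ i, ∫⁻ t, ENNReal.ofReal (c i t ^ 2) ∂ν = ENNReal.ofReal (∫ t, c i t ^ 2 ∂ν) :=
      fun i => (ofReal_integral_eq_lintegral_ofReal (hci i)
        (Eventually.of_forall fun t => sq_nonneg _)).symm
    simp_rw [h1]
    rw [← ENNReal.ofReal_tsum_of_nonneg (fun i => integral_nonneg fun t => sq_nonneg _) hsum]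
    exact ENNReal.ofReal_ne_top
  have hae : ∀ᵐ t ∂ν, Summable fun i => c i t ^ 2 := by
    have hm : AEMeasurable (fun t => ∑' i, ENNReal.ofReal (c i t ^ 2)) ν :=
      AEMeasurable.tsum fun i =>
        ((hci i).aestronglyMeasurable.aemeasurable).ennreal_ofReal
    filter_upwards [ae_lt_top' hm hfin] with t ht
    have := ENNReal.summable_toReal ht.ne
    simpa [ENNReal.toReal_ofReal (sq_nonneg _)] using this
  refine ⟨?_, hae⟩
  have hmeas : AEStronglyMeasurable (fun t => ∑' i, c i t • ψ i) ν := by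
    refine aestronglyMeasurable_of_tendsto_ae atTop
      (f := fun (F : Finset ι) t => ∑ i ∈ F, c i t • ψ i) (fun F => ?_) ?_
    · exact Finset.aestronglyMeasurable_fun_sum F fun i _ => (hc i).smul_const (ψ i)
    · filter_upwards [hae] with t ht
      exact ((summable_smul_iff hψ _).2 ht).hasSum
  rw [memLp_two_iff_integrable_sq_norm hmeas]
  refine ⟨(hmeas.norm.pow 2), ?_⟩
  rw [hasFiniteIntegral_iff_enorm]
  refine lt_of_le_of_lt (lintegral_mono_ae ?_) hfin.lt_top
  filter_upwards [hae] with t ht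
  rw [norm_sq_tsum_smul hψ ht, Real.enorm_of_nonneg (tsum_nonneg fun i => sq_nonneg _),
    ENNReal.ofReal_tsum_of_nonneg (fun i => sq_nonneg _) ht]

end Series

/-! ### The saturated finite-dimensional system -/

theorem sat_eq_max_min {ℓ : ℝ} (hℓ : 0 < ℓ) (s : ℝ) : sat ℓ s = max (-ℓ) (min ℓ s) := by
  unfold sat
  split_ifs with h
  · obtain ⟨h1, h2⟩ := abs_le.1 h
    rw [min_eq_right h2, max_eq_right h1]
  · rcases lt_trichotomy s 0 with hs | hs | hs
    · rw [abs_of_neg hs] at h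
      rw [Real.sign_of_neg hs, min_eq_right (by linarith), max_eq_left (by linarith)]; ring
    · simp [hs, hℓ.le] at h
    · rw [abs_of_pos hs] at h
      rw [Real.sign_of_pos hs, min_eq_left (by linarith), max_eq_right (by linarith)]; ring

theorem lipschitzWith_sat {ℓ : ℝ} (hℓ : 0 < ℓ) : LipschitzWith 1 (sat ℓ) := by
  rw [show sat ℓ = fun s => max (-ℓ) (min ℓ s) from funext (sat_eq_max_min hℓ)]
  exact (LipschitzWith.id.const_min ℓ).const_max (-ℓ)

/-- The sector condition: the dead zone `sat s - s` and `sat s - q` have opposite signs as long as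
`|q| ≤ ℓ`. -/
theorem sat_sub_mul_nonpos {ℓ : ℝ} (hℓ : 0 < ℓ) {q : ℝ} (hq : |q| ≤ ℓ) (s : ℝ) :
    (sat ℓ s - s) * (sat ℓ s - q) ≤ 0 := by
  obtain ⟨h1, h2⟩ := abs_le.1 hq
  rw [sat_eq_max_min hℓ]
  rcases le_total s ℓ with h3 | h3
  · rw [min_eq_right h3]
    rcases le_total (-ℓ) s with h4 | h4
    · rw [max_eq_right h4]; simp
    · rw [max_eq_left h4]
      exact mul_nonpos_of_nonneg_of_nonpos (by linarith) (by linarith)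
  · rw [min_eq_left h3, max_eq_right (by linarith)]
    exact mul_nonpos_of_nonpos_of_nonneg (by linarith) (by linarith)

/-- The right-hand side of the closed-loop system for the unstable modes. -/
def modeField {m n : ℕ} (ℓ : ℝ) (A : Matrix (Fin n) (Fin n) ℝ) (B : Matrix (Fin n) (Fin m) ℝ)
    (K : Matrix (Fin m) (Fin n) ℝ) (z : Fin n → ℝ) : Fin n → ℝ :=
  A *ᵥ z + B *ᵥ fun k => sat ℓ ((K *ᵥ z) k)

theorem lipschitzWith_sat_mulVec {m n : ℕ} {ℓ : ℝ} (hℓ : 0 < ℓ) (K : Matrix (Fin m) (Fin n) ℝ) :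
    ∃ c, LipschitzWith c fun (z : Fin n → ℝ) k => sat ℓ ((K *ᵥ z) k) := by
  have h1 : LipschitzWith 1 fun (w : Fin m → ℝ) k => sat ℓ (w k) := by
    refine LipschitzWith.of_dist_le_mul fun x y => ?_
    rw [NNReal.coe_one, one_mul, dist_pi_le_iff dist_nonneg]
    intro k
    have := (lipschitzWith_sat hℓ).dist_le_mul (x k) (y k)
    rw [NNReal.coe_one, one_mul] at this
    exact this.trans (dist_le_pi_dist x y k)
  exact ⟨_, h1.comp (LinearMap.toContinuousLinearMap (Matrix.mulVecLin K)).lipschitz⟩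

theorem lipschitzWith_modeField {m n : ℕ} {ℓ : ℝ} (hℓ : 0 < ℓ) (A : Matrix (Fin n) (Fin n) ℝ)
    (B : Matrix (Fin n) (Fin m) ℝ) (K : Matrix (Fin m) (Fin n) ℝ) :
    ∃ c, LipschitzWith c (modeField ℓ A B K) := by
  obtain ⟨c, hc⟩ := lipschitzWith_sat_mulVec hℓ K
  exact ⟨_, (LinearMap.toContinuousLinearMap (Matrix.mulVecLin A)).lipschitz.add
    ((LinearMap.toContinuousLinearMap (Matrix.mulVecLin B)).lipschitz.comp hc)⟩

/-- A bounded Lipschitz vector field has global forward solutions: the solutions given by the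
Picard–Lindelöf theorem on the intervals `[0, N]` agree on their common domains. -/
theorem exists_forward_solution {E : Type*} [NormedAddCommGroup E] [NormedSpace ℝ E]
    [CompleteSpace E] {G : E → E} {c b : ℝ≥0} (hG : LipschitzWith c G) (hb : ∀ x, ‖G x‖ ≤ b)
    (x₀ : E) : ∃ z : ℝ → E, z 0 = x₀ ∧ ContinuousOn z (Ici 0) ∧
      ∀ t, 0 ≤ t → HasDerivWithinAt z (G (z t)) (Ici t) t := by
  have hsol : ∀ N : ℕ, ∃ α : ℝ → E, α 0 = x₀ ∧
      ∀ t ∈ Icc (0 : ℝ) N, HasDerivWithinAt α (G (α t)) (Icc 0 N) t := by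
    intro N
    have hN : (0 : ℝ) ≤ N := Nat.cast_nonneg N
    have hpl : IsPicardLindelof (fun _ => G) (⟨0, left_mem_Icc.2 hN⟩ : Icc (0 : ℝ) N) x₀
        (b * N) 0 b c :=
      IsPicardLindelof.of_time_independent (fun x _ => hb x) hG.lipschitzOnWith (by simp)
    exact hpl.exists_eq_forall_mem_Icc_hasDerivWithinAt₀
  choose α hα0 hα using hsol
  have hαc : ∀ N, ContinuousOn (α N) (Icc 0 N) := fun N t ht => (hα N t ht).continuousWithinAt
  have hαr : ∀ N : ℕ, ∀ t ∈ Ico (0 : ℝ) N, HasDerivWithinAt (α N) (G (α N t)) (Ici t) t :=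
    fun N t ht => ((hα N t (Ico_subset_Icc_self ht)).mono
      (Icc_subset_Icc_left ht.1)).mono_of_mem_nhdsWithin (Icc_mem_nhdsGE ht.2)
  have hagree : ∀ M N : ℕ, M ≤ N → EqOn (α M) (α N) (Icc 0 M) := by
    intro M N hMN
    have hMN' : (M : ℝ) ≤ N := by exact_mod_cast hMN
    exact ODE_solution_unique_of_mem_Icc_right (v := fun _ => G) (s := fun _ => univ) (K := c)
      (fun t _ => hG.lipschitzOnWith) (hαc M) (hαr M) (fun _ _ => mem_univ _)
      ((hαc N).mono (Icc_subset_Icc_right hMN'))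
      (fun t ht => hαr N t ⟨ht.1, ht.2.trans_le hMN'⟩) (fun _ _ => mem_univ _)
      ((hα0 M).trans (hα0 N).symm)
  let z : ℝ → E := fun t => α (⌊t⌋₊ + 1) t
  have hz : ∀ N : ℕ, EqOn z (α N) (Icc 0 N) := by
    intro N t ht
    have h1 : t ∈ Icc (0 : ℝ) ((⌊t⌋₊ + 1 : ℕ) : ℝ) :=
      ⟨ht.1, by push_cast; exact (Nat.lt_floor_add_one t).le⟩
    rcases le_total (⌊t⌋₊ + 1) N with h | h
    · exact hagree _ _ h h1
    · exact (hagree _ _ h ht).symm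
  refine ⟨z, ?_, fun t ht => ?_, fun t ht => ?_⟩
  · have := hz 0 (by simp : (0 : ℝ) ∈ Icc (0 : ℝ) ((0 : ℕ) : ℝ))
    rw [this, hα0]
  · obtain ⟨N, hN⟩ := exists_nat_gt t
    have h1 : ContinuousWithinAt z (Icc 0 N) t :=
      ((hαc N).congr (hz N)) t ⟨ht, hN.le⟩
    refine h1.mono_of_mem_nhdsWithin ?_
    rw [← Ici_inter_Iic]
    exact inter_mem self_mem_nhdsWithin (mem_nhdsWithin_of_mem_nhds (Iic_mem_nhds hN))
  · obtain ⟨N, hN⟩ := exists_nat_gt t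
    have h1 := hαr N t ⟨ht, hN⟩
    rw [← hz N ⟨ht, hN.le⟩] at h1
    refine h1.congr_of_eventuallyEq ?_ (hz N ⟨ht, hN.le⟩)
    filter_upwards [Icc_mem_nhdsGE hN] with s hs
    exact hz N ⟨ht.trans hs.1, hs.2⟩

theorem exists_pos_mul_norm_sq_le {ι : Type*} [Fintype ι] {M : Matrix ι ι ℝ} (hM : M.PosDef) :
    ∃ ε > 0, ∀ x : ι → ℝ, ε * ‖x‖ ^ 2 ≤ x ⬝ᵥ (M *ᵥ x) := by
  have hcont : Continuous fun x : ι → ℝ => x ⬝ᵥ (M *ᵥ x) := by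
    unfold dotProduct Matrix.mulVec dotProduct
    fun_prop
  have hpos : ∀ x : ι → ℝ, x ≠ 0 → 0 < x ⬝ᵥ (M *ᵥ x) := fun x hx => by
    simpa using hM.dotProduct_mulVec_pos hx
  rcases (Metric.sphere (0 : ι → ℝ) 1).eq_empty_or_nonempty with he | hne
  · refine ⟨1, one_pos, fun x => ?_⟩
    have : x = 0 := by
      by_contra hx
      have : (‖x‖⁻¹ • x) ∈ Metric.sphere (0 : ι → ℝ) 1 := by
        simp [norm_smul, hx]
      rw [he] at this
      exact this
    simp [this]
  · obtain ⟨x₀, hx₀, hmin⟩ := (isCompact_sphere (0 : ι → ℝ) 1).exists_isMinOn hne hcont.continuousOn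
    refine ⟨x₀ ⬝ᵥ (M *ᵥ x₀), hpos x₀ (by rintro rfl; simp at hx₀), fun x => ?_⟩
    by_cases hx : x = 0
    · simp [hx]
    have h1 : x₀ ⬝ᵥ (M *ᵥ x₀) ≤ (‖x‖⁻¹ • x) ⬝ᵥ (M *ᵥ (‖x‖⁻¹ • x)) :=
      hmin (by simp [norm_smul, hx])
    rw [Matrix.mulVec_smul, smul_dotProduct, dotProduct_smul, smul_eq_mul, smul_eq_mul] at h1
    have hx' : 0 < ‖x‖ := norm_pos_iff.2 hx
    calc _ ≤ (‖x‖⁻¹ * (‖x‖⁻¹ * x ⬝ᵥ (M *ᵥ x))) * ‖x‖ ^ 2 :=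
          mul_le_mul_of_nonneg_right h1 (sq_nonneg _)
      _ = _ := by field_simp

theorem exists_le_mul_norm_sq {ι : Type*} [Fintype ι] (M : Matrix ι ι ℝ) :
    ∃ c > 0, ∀ x : ι → ℝ, x ⬝ᵥ (M *ᵥ x) ≤ c * ‖x‖ ^ 2 := by
  refine ⟨∑ i, ∑ j, |M i j| + 1, by positivity, fun x => ?_⟩
  have h1 : x ⬝ᵥ (M *ᵥ x) = ∑ i, ∑ j, x i * (M i j * x j) := by
    simp only [dotProduct, Matrix.mulVec, Finset.mul_sum]
  rw [h1, add_mul, one_mul, Finset.sum_mul]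
  refine le_add_of_le_of_nonneg (Finset.sum_le_sum fun i _ => ?_) (sq_nonneg _)
  rw [Finset.sum_mul]
  refine Finset.sum_le_sum fun j _ => (le_abs_self _).trans ?_
  rw [abs_mul, abs_mul]
  have h2 := norm_le_pi_norm x i
  have h3 := norm_le_pi_norm x j
  rw [Real.norm_eq_abs] at h2 h3
  calc |x i| * (|M i j| * |x j|) = |M i j| * (|x i| * |x j|) := by ring
    _ ≤ |M i j| * (‖x‖ * ‖x‖) := by gcongr
    _ = _ := by ring

/-- In the region, the second matrix inequality bounds `(K - C) z` by the saturation level. -/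
theorem abs_sub_mulVec_le {m n : ℕ} {ℓ : ℝ} (hℓ : 0 < ℓ) {K C : Matrix (Fin m) (Fin n) ℝ}
    {P : Matrix (Fin n) (Fin n) ℝ} (hM₂ : (lmi₂ ℓ K P C).PosSemidef) {z : Fin n → ℝ}
    (hz : z ∈ region P) (k : Fin m) : |((K - C) *ᵥ z) k| ≤ ℓ := by
  have hz' : z ⬝ᵥ (P *ᵥ z) ≤ 1 := hz
  set q := ((K - C) *ᵥ z) k with hq
  -- The second component minimizes the quadratic form among the multiples of the `k`-th basis
  -- vector: this is the Schur complement inequality for one row.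
  have h1 := hM₂.dotProduct_mulVec_nonneg (Sum.elim z (Pi.single k (-q / ℓ ^ 2)))
  have e1 : z ⬝ᵥ ((K - C)ᵀ *ᵥ Pi.single k (-q / ℓ ^ 2)) = -q / ℓ ^ 2 * q := by
    rw [Matrix.dotProduct_mulVec, Matrix.vecMul_transpose, dotProduct_single, ← hq, mul_comm]
  rw [lmi₂, star_trivial, Matrix.fromBlocks_mulVec, sumElim_dotProduct_sumElim] at h1
  simp only [Sum.elim_comp_inl, Sum.elim_comp_inr, dotProduct_add, single_dotProduct, e1,
    Matrix.smul_mulVec, Matrix.one_mulVec, Pi.smul_apply, Pi.single_eq_same, smul_eq_mul,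
    ← hq] at h1
  have h2 : z ⬝ᵥ (P *ᵥ z) - q ^ 2 / ℓ ^ 2 ≥ 0 := by
    have : z ⬝ᵥ (P *ᵥ z) + -q / ℓ ^ 2 * q + (-q / ℓ ^ 2 * q + -q / ℓ ^ 2 * (ℓ ^ 2 * (-q / ℓ ^ 2))) =
      z ⬝ᵥ (P *ᵥ z) - q ^ 2 / ℓ ^ 2 := by field_simp; ring
    linarith
  have h3 : q ^ 2 / ℓ ^ 2 ≤ 1 := by linarith
  rw [div_le_one (by positivity)] at h3
  exact abs_le_of_sq_le_sq h3 hℓ.le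

/-- The Lyapunov function `zᵀ P z` decreases exponentially along the flow in the region: by the
sector condition, its derivative is bounded by the quadratic form of the first matrix inequality
at `(z, sat (K z) - K z)`. -/
theorem exists_lyapunov {m n : ℕ} {ℓ : ℝ} (hℓ : 0 < ℓ) {A : Matrix (Fin n) (Fin n) ℝ}
    {B : Matrix (Fin n) (Fin m) ℝ} {K C : Matrix (Fin m) (Fin n) ℝ} {P : Matrix (Fin n) (Fin n) ℝ}
    (hP : P.PosDef) {D : Matrix (Fin m) (Fin m) ℝ} (hDdiag : D.IsDiag) (hD : D.PosDef)
    (hM₁ : (-lmi₁ A B K P D C).PosDef) (hM₂ : (lmi₂ ℓ K P C).PosSemidef) :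
    ∃ κ > 0, ∀ z ∈ region P,
      2 * (z ⬝ᵥ (P *ᵥ modeField ℓ A B K z)) ≤ -κ * (z ⬝ᵥ (P *ᵥ z)) := by
  obtain ⟨ε, hε, h1⟩ := exists_pos_mul_norm_sq_le hM₁
  obtain ⟨c, hc, h2⟩ := exists_le_mul_norm_sq P
  refine ⟨ε / c, by positivity, fun z hz => ?_⟩
  -- The dead zone nonlinearity.
  set φ : Fin m → ℝ := fun k => sat ℓ ((K *ᵥ z) k) - (K *ᵥ z) k with hφ
  have hPt : Pᵀ = P := by
    simpa [Matrix.conjTranspose_eq_transpose_of_trivial] using hP.isHermitian.eq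
  have hDt : Dᵀ = D := by
    simpa [Matrix.conjTranspose_eq_transpose_of_trivial] using hD.isHermitian.eq
  have hF : modeField ℓ A B K z = (A + B * K) *ᵥ z + B *ᵥ φ := by
    have : (fun k => sat ℓ ((K *ᵥ z) k)) = φ + K *ᵥ z := by ext k; simp [hφ]
    rw [modeField, this, Matrix.mulVec_add, Matrix.add_mulVec, Matrix.mulVec_mulVec]
    abel
  have hsector : φ ⬝ᵥ (D *ᵥ (φ + C *ᵥ z)) ≤ 0 := by
    have hDv : ∀ w : Fin m → ℝ, ∀ k, (D *ᵥ w) k = D k k * w k := by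
      intro w k
      rw [Matrix.mulVec, dotProduct, Finset.sum_eq_single k]
      · intro j _ hj
        rw [hDdiag hj.symm, zero_mul]
      · simp
    refine Finset.sum_nonpos fun k _ => ?_
    rw [hDv]
    have h3 := sat_sub_mul_nonpos hℓ (abs_sub_mulVec_le hℓ hM₂ hz k) ((K *ᵥ z) k)
    have h4 : (φ + C *ᵥ z) k = sat ℓ ((K *ᵥ z) k) - ((K - C) *ᵥ z) k := by
      simp only [Pi.add_apply, hφ, Matrix.sub_mulVec, Pi.sub_apply]; ring
    have h5 : 0 < D k k := hD.diag_pos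
    rw [h4]
    have : φ k * (D k k * (sat ℓ ((K *ᵥ z) k) - ((K - C) *ᵥ z) k)) =
        D k k * ((sat ℓ ((K *ᵥ z) k) - (K *ᵥ z) k) * (sat ℓ ((K *ᵥ z) k) - ((K - C) *ᵥ z) k)) := by
      simp only [hφ]; ring
    rw [this]
    exact mul_nonpos_of_nonneg_of_nonpos h5.le h3
  have h6 := h1 (Sum.elim z φ)
  have e1 : Sum.elim z φ ⬝ᵥ (-lmi₁ A B K P D C *ᵥ Sum.elim z φ) =
      -(2 * (z ⬝ᵥ (P *ᵥ modeField ℓ A B K z)) - 2 * (φ ⬝ᵥ (D *ᵥ (φ + C *ᵥ z)))) := by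
    have a1 : z ⬝ᵥ (((A + B * K)ᵀ * P) *ᵥ z) = z ⬝ᵥ (P *ᵥ ((A + B * K) *ᵥ z)) := by
      rw [← Matrix.mulVec_mulVec, Matrix.dotProduct_mulVec, Matrix.vecMul_transpose,
        Matrix.dotProduct_mulVec z P, ← Matrix.mulVec_transpose, hPt, dotProduct_comm]
    have a2 : z ⬝ᵥ ((D * C)ᵀ *ᵥ φ) = φ ⬝ᵥ ((D * C) *ᵥ z) := by
      rw [Matrix.dotProduct_mulVec, Matrix.vecMul_transpose, dotProduct_comm]
    have a3 : φ ⬝ᵥ ((P * B)ᵀ *ᵥ z) = z ⬝ᵥ ((P * B) *ᵥ φ) := by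
      rw [Matrix.dotProduct_mulVec, Matrix.vecMul_transpose, dotProduct_comm]
    rw [Matrix.neg_mulVec, dotProduct_neg, lmi₁, Matrix.fromBlocks_mulVec,
      sumElim_dotProduct_sumElim, hF]
    simp only [Sum.elim_comp_inl, Sum.elim_comp_inr, dotProduct_add, Matrix.add_mulVec,
      Matrix.sub_mulVec, dotProduct_sub, a2, a3, Matrix.smul_mulVec, dotProduct_smul,
      Matrix.mulVec_add, ← Matrix.mulVec_mulVec, smul_eq_mul] at a1 ⊢
    have a4 : z ⬝ᵥ ((A + B * K)ᵀ *ᵥ (P *ᵥ z)) =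
        z ⬝ᵥ (P *ᵥ (A *ᵥ z)) + z ⬝ᵥ (P *ᵥ (B *ᵥ (K *ᵥ z))) := a1
    rw [a4]
    ring
  have h7 : ε * ‖z‖ ^ 2 ≤ ε * ‖Sum.elim z φ‖ ^ 2 := by
    have : ‖z‖ ≤ ‖Sum.elim z φ‖ := (pi_norm_le_iff_of_nonneg (norm_nonneg _)).2 fun i =>
      norm_le_pi_norm (Sum.elim z φ) (Sum.inl i)
    gcongr
  have h8 : ε / c * (z ⬝ᵥ (P *ᵥ z)) ≤ ε * ‖z‖ ^ 2 := by
    have := mul_le_mul_of_nonneg_left (h2 z) (by positivity : 0 ≤ ε / c)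
    calc _ ≤ _ := this
      _ = _ := by field_simp
  rw [e1] at h6
  linarith

theorem hasDerivWithinAt_quadForm {n : ℕ} {P : Matrix (Fin n) (Fin n) ℝ} (hP : P.PosDef)
    {z : ℝ → Fin n → ℝ} {z' : Fin n → ℝ} {s : Set ℝ} {t : ℝ} (hz : HasDerivWithinAt z z' s t) :
    HasDerivWithinAt (fun t => z t ⬝ᵥ (P *ᵥ z t)) (2 * (z t ⬝ᵥ (P *ᵥ z'))) s t := by
  have hPt : Pᵀ = P := by
    simpa [Matrix.conjTranspose_eq_transpose_of_trivial] using hP.isHermitian.eq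
  have hz' := hasDerivWithinAt_pi.1 hz
  have h1 : HasDerivWithinAt (fun t => ∑ i, z t i * ∑ j, P i j * z t j)
      (∑ i, (z' i * ∑ j, P i j * z t j + z t i * ∑ j, P i j * z' j)) s t :=
    HasDerivWithinAt.fun_sum fun i _ => (hz' i).mul
      (HasDerivWithinAt.fun_sum fun j _ => (hz' j).const_mul (P i j))
  refine h1.congr_deriv ?_
  rw [Finset.sum_add_distrib]
  change z' ⬝ᵥ (P *ᵥ z t) + z t ⬝ᵥ (P *ᵥ z') = _
  have : z' ⬝ᵥ (P *ᵥ z t) = z t ⬝ᵥ (P *ᵥ z') := by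
    rw [Matrix.dotProduct_mulVec, ← Matrix.mulVec_transpose, hPt, dotProduct_comm]
  rw [this]; ring

/-- The closed-loop system for the unstable modes has global solutions in the region, which decay
exponentially. -/
theorem exists_mode_solution {m n : ℕ} {ℓ : ℝ} (hℓ : 0 < ℓ) {A : Matrix (Fin n) (Fin n) ℝ}
    {B : Matrix (Fin n) (Fin m) ℝ} {K C : Matrix (Fin m) (Fin n) ℝ} {P : Matrix (Fin n) (Fin n) ℝ}
    (hP : P.PosDef) {D : Matrix (Fin m) (Fin m) ℝ} (hDdiag : D.IsDiag) (hD : D.PosDef)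
    (hM₁ : (-lmi₁ A B K P D C).PosDef) (hM₂ : (lmi₂ ℓ K P C).PosSemidef) :
    ∃ c ≥ 0, ∃ a > 0, ∀ z₀ ∈ region P, ∃ z : ℝ → Fin n → ℝ, z 0 = z₀ ∧ ContinuousOn z (Ici 0) ∧
      (∀ t, 0 ≤ t → HasDerivWithinAt z (modeField ℓ A B K (z t)) (Ici t) t) ∧
      ∀ t, 0 ≤ t → ‖z t‖ ≤ c * ‖z₀‖ * Real.exp (-a * t) := by
  obtain ⟨κ, hκ, hlyap⟩ := exists_lyapunov hℓ hP hDdiag hD hM₁ hM₂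
  obtain ⟨ε, hε, hε'⟩ := exists_pos_mul_norm_sq_le hP
  obtain ⟨q, hq, hq'⟩ := exists_le_mul_norm_sq P
  -- The vector field is cut off outside a ball that contains the region, so as to be bounded; the
  -- solution never leaves the region, hence solves the original system.
  set R := 1 / ε + 1 with hR
  have hR0 : 0 < R := by positivity
  have hreg : ∀ z ∈ region P, ‖z‖ ≤ R := by
    intro z hz
    have h1 : ‖z‖ ^ 2 ≤ 1 / ε := by
      rw [le_div_iff₀ hε, mul_comm]
      exact (hε' z).trans hz
    have h2 : 0 ≤ 1 / ε := by positivity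
    refine le_of_sq_le_sq ?_ hR0.le
    nlinarith
  obtain ⟨cF, hcF⟩ := lipschitzWith_modeField hℓ A B K
  obtain ⟨cS, hcS⟩ := lipschitzWith_sat_mulVec hR0 (1 : Matrix (Fin n) (Fin n) ℝ)
  set S : (Fin n → ℝ) → Fin n → ℝ := fun z k => sat R (((1 : Matrix (Fin n) (Fin n) ℝ) *ᵥ z) k)
  have hS_id : ∀ z ∈ region P, S z = z := by
    intro z hz
    ext k
    have h1 : |z k| ≤ R := (norm_le_pi_norm z k).trans (hreg z hz)
    simp [S, sat, h1]
  have hS_le : ∀ z, ‖S z‖ ≤ R := fun z => (pi_norm_le_iff_of_nonneg hR0.le).2 fun k => by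
    simp only [S]
    rw [sat_eq_max_min hR0, Real.norm_eq_abs, abs_le]
    exact ⟨le_max_left _ _, max_le (by linarith) (min_le_left _ _)⟩
  have hF0 : modeField ℓ A B K 0 = 0 := by
    have : (fun k : Fin m => sat ℓ ((K *ᵥ (0 : Fin n → ℝ)) k)) = 0 := by
      ext k; simp [sat, hℓ.le]
    rw [modeField, this]; simp
  have hb : ∀ z, ‖modeField ℓ A B K (S z)‖ ≤ (cF * ⟨R, hR0.le⟩ : ℝ≥0) := by
    intro z
    have h1 := hcF.dist_le_mul (S z) 0
    rw [hF0, dist_zero_right, dist_zero_right] at h1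
    exact h1.trans (mul_le_mul_of_nonneg_left (hS_le z) cF.2)
  refine ⟨√(q / ε), Real.sqrt_nonneg _, κ / 4, by positivity, fun z₀ hz₀ => ?_⟩
  obtain ⟨z, hz0, hzc, hzd⟩ := exists_forward_solution (hcF.comp hcS) hb z₀
  have hWd : ∀ t, 0 ≤ t → HasDerivWithinAt (fun t => z t ⬝ᵥ (P *ᵥ z t))
      (2 * (z t ⬝ᵥ (P *ᵥ modeField ℓ A B K (S (z t))))) (Ici t) t := fun t ht =>
    hasDerivWithinAt_quadForm hP (hzd t ht)
  have hWc : ContinuousOn (fun t => z t ⬝ᵥ (P *ᵥ z t)) (Ici 0) := by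
    have : Continuous fun x : Fin n → ℝ => x ⬝ᵥ (P *ᵥ x) := by
      unfold dotProduct Matrix.mulVec dotProduct
      fun_prop
    exact this.comp_continuousOn hzc
  -- The barrier decays more slowly than the rate `κ` of the Lyapunov inequality, which gives the
  -- strict inequality needed at a point of contact; since it stays below `1`, such a point lies in
  -- the region.
  have hdecay : ∀ δ : ℝ, 0 < δ → δ ≤ 1 → z₀ ⬝ᵥ (P *ᵥ z₀) ≤ δ → ∀ t, 0 ≤ t →
      z t ⬝ᵥ (P *ᵥ z t) ≤ δ * Real.exp (-(κ / 2) * t) := by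
    intro δ hδ hδ1 h0 t ht
    refine image_le_of_deriv_right_lt_deriv_boundary (a := 0) (b := t)
      (hWc.mono Icc_subset_Ici_self) (fun x hx => hWd x hx.1) (by simpa [hz0] using h0)
      (B := fun t => δ * Real.exp (-(κ / 2) * t))
      (B' := fun t => δ * (Real.exp (-(κ / 2) * t) * -(κ / 2))) (fun x => ?_) ?_ ⟨ht, le_rfl⟩
    · have := (((hasDerivAt_id x).const_mul (-(κ / 2))).exp).const_mul δ
      simpa using this
    · intro x hx hxe
      have hexp : Real.exp (-(κ / 2) * x) ≤ 1 := Real.exp_le_one_iff.2 (by nlinarith [hx.1])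
      have hmem : z x ∈ region P := by
        change z x ⬝ᵥ (P *ᵥ z x) ≤ 1
        rw [hxe]
        exact mul_le_one₀ hδ1 (Real.exp_pos _).le hexp
      have h1 := hlyap _ hmem
      rw [hS_id _ hmem]
      have h2 : 0 < δ * Real.exp (-(κ / 2) * x) := by positivity
      rw [hxe] at h1
      nlinarith
  have hW0 : 0 ≤ z₀ ⬝ᵥ (P *ᵥ z₀) := le_trans (by positivity) (hε' z₀)
  have hdecay' : ∀ t, 0 ≤ t →
      z t ⬝ᵥ (P *ᵥ z t) ≤ z₀ ⬝ᵥ (P *ᵥ z₀) * Real.exp (-(κ / 2) * t) := by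
    intro t ht
    -- The barrier has to be positive, so that `z₀ = 0` is treated by a limit.
    rcases hW0.eq_or_lt with h0 | h0
    · rw [← h0, zero_mul]
      refine le_of_forall_pos_le_add fun δ hδ => ?_
      have h1 := hdecay (min δ 1) (by positivity) (min_le_right _ _) (by rw [← h0]; positivity) t ht
      have hexp : Real.exp (-(κ / 2) * t) ≤ 1 := Real.exp_le_one_iff.2 (by nlinarith)
      have h2 : min δ 1 * Real.exp (-(κ / 2) * t) ≤ min δ 1 :=
        mul_le_of_le_one_right (by positivity) hexp
      linarith [min_le_left δ 1]
    · exact hdecay _ h0 hz₀ le_rfl t ht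
  refine ⟨z, hz0, hzc, fun t ht => ?_, fun t ht => ?_⟩
  · have hmem : z t ∈ region P := by
      have hexp : Real.exp (-(κ / 2) * t) ≤ 1 := Real.exp_le_one_iff.2 (by nlinarith)
      exact (hdecay' t ht).trans (mul_le_one₀ hz₀ (Real.exp_pos _).le hexp)
    have := hzd t ht
    simp only [Function.comp_apply] at this
    rwa [hS_id _ hmem] at this
  · have h1 : ε * ‖z t‖ ^ 2 ≤ q * ‖z₀‖ ^ 2 * Real.exp (-(κ / 2) * t) :=
      (hε' _).trans ((hdecay' t ht).trans
        (mul_le_mul_of_nonneg_right (hq' z₀) (Real.exp_pos _).le))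
    have h2 : ‖z t‖ ^ 2 ≤ (√(q / ε) * ‖z₀‖ * Real.exp (-(κ / 4) * t)) ^ 2 := by
      rw [mul_pow, mul_pow, Real.sq_sqrt (by positivity), ← Real.exp_nat_mul]
      have e1 : ((2 : ℕ) : ℝ) * (-(κ / 4) * t) = -(κ / 2) * t := by push_cast; ring
      rw [e1, div_mul_eq_mul_div, div_mul_eq_mul_div, le_div_iff₀ hε]
      linarith
    exact le_of_sq_le_sq h2 (by positivity)

/-! ### Variation of constants -/

/-- The solution of `x' = -s x + f`, `x 0 = x₀`. -/
def duhamel (s x₀ : ℝ) (f : ℝ → ℝ) (t : ℝ) : ℝ :=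
  Real.exp (-s * t) * (x₀ + ∫ τ in (0 : ℝ)..t, Real.exp (s * τ) * f τ)

theorem duhamel_zero (s x₀ : ℝ) (f : ℝ → ℝ) : duhamel s x₀ f 0 = x₀ := by simp [duhamel]

theorem hasDerivAt_duhamel (s x₀ : ℝ) {f : ℝ → ℝ} (hf : Continuous f) (t : ℝ) :
    HasDerivAt (duhamel s x₀ f) (-s * duhamel s x₀ f t + f t) t := by
  have h1 : HasDerivAt (fun t => Real.exp (-s * t)) (Real.exp (-s * t) * -s) t := by
    simpa using ((hasDerivAt_id t).const_mul (-s)).exp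
  have hc : Continuous fun τ => Real.exp (s * τ) * f τ := by fun_prop
  have h2 := ((hc.integral_hasStrictDerivAt 0 t).hasDerivAt).const_add x₀
  refine (h1.mul h2).congr_deriv ?_
  have h3 : Real.exp (-s * t) * Real.exp (s * t) = 1 := by
    rw [← Real.exp_add]; simp
  rw [duhamel]
  linear_combination f t * h3

theorem integral_exp_const_mul {c : ℝ} (hc : c ≠ 0) (t : ℝ) :
    ∫ τ in (0 : ℝ)..t, Real.exp (c * τ) = (Real.exp (c * t) - 1) / c := by
  rw [intervalIntegral.integral_comp_mul_left (fun x => Real.exp x) hc, integral_exp]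
  simp [div_eq_inv_mul]

/-- The forced part inherits the decay of a forcing that decays more slowly than `exp (-s t)`. -/
theorem abs_duhamel_sub_le {s a : ℝ} (has : a < s) (x₀ : ℝ) {f : ℝ → ℝ}
    {F : ℝ} (hF : ∀ τ, 0 ≤ τ → |f τ| ≤ F * Real.exp (-a * τ)) {t : ℝ} (ht : 0 ≤ t) :
    |duhamel s x₀ f t - Real.exp (-s * t) * x₀| ≤ F * Real.exp (-a * t) / (s - a) := by
  have hF0 : 0 ≤ F := by simpa using (abs_nonneg _).trans (hF 0 le_rfl)
  have hsa : 0 < s - a := by linarith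
  have h1 : |∫ τ in (0 : ℝ)..t, Real.exp (s * τ) * f τ| ≤
      ∫ τ in (0 : ℝ)..t, F * Real.exp ((s - a) * τ) := by
    have hg : IntervalIntegrable (fun τ => F * Real.exp ((s - a) * τ)) volume 0 t :=
      (by fun_prop : Continuous fun τ => F * Real.exp ((s - a) * τ)).intervalIntegrable _ _
    rw [← Real.norm_eq_abs]
    refine intervalIntegral.norm_integral_le_of_norm_le ht (Eventually.of_forall fun τ hτ => ?_) hg
    rw [Real.norm_eq_abs, abs_mul, abs_of_pos (Real.exp_pos _)]
    have e1 : Real.exp ((s - a) * τ) = Real.exp (s * τ) * Real.exp (-a * τ) := by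
      rw [← Real.exp_add]; congr 1; ring
    rw [e1]
    calc _ ≤ Real.exp (s * τ) * (F * Real.exp (-a * τ)) :=
          mul_le_mul_of_nonneg_left (hF τ hτ.1.le) (Real.exp_pos _).le
      _ = _ := by ring
  have h2 : ∫ τ in (0 : ℝ)..t, F * Real.exp ((s - a) * τ) =
      F * ((Real.exp ((s - a) * t) - 1) / (s - a)) := by
    rw [intervalIntegral.integral_const_mul, integral_exp_const_mul hsa.ne']
  have h3 : duhamel s x₀ f t - Real.exp (-s * t) * x₀ =
      Real.exp (-s * t) * ∫ τ in (0 : ℝ)..t, Real.exp (s * τ) * f τ := by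
    rw [duhamel]; ring
  rw [h3, abs_mul, abs_of_pos (Real.exp_pos _)]
  have e2 : Real.exp (-s * t) * Real.exp ((s - a) * t) = Real.exp (-a * t) := by
    rw [← Real.exp_add]; congr 1; ring
  calc _ ≤ Real.exp (-s * t) * (F * ((Real.exp ((s - a) * t) - 1) / (s - a))) :=
        mul_le_mul_of_nonneg_left (h1.trans h2.le) (Real.exp_pos _).le
    _ ≤ Real.exp (-s * t) * (F * (Real.exp ((s - a) * t) / (s - a))) := by
        gcongr; linarith
    _ = F * (Real.exp (-s * t) * Real.exp ((s - a) * t)) / (s - a) := by ring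
    _ = _ := by rw [e2]

theorem sq_duhamel_le {s a : ℝ} (hs : 0 < s) (has : 2 * a ≤ s) (x₀ : ℝ) {f : ℝ → ℝ}
    {F : ℝ} (hF : ∀ τ, 0 ≤ τ → |f τ| ≤ F * Real.exp (-a * τ)) {t : ℝ} (ht : 0 ≤ t) :
    duhamel s x₀ f t ^ 2 ≤
      2 * (Real.exp (-(2 * s) * t) * x₀ ^ 2) + 8 * (F ^ 2 / s ^ 2) * Real.exp (-(2 * a) * t) := by
  have hF0 : 0 ≤ F := by simpa using (abs_nonneg _).trans (hF 0 le_rfl)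
  have h1 := abs_duhamel_sub_le (by linarith : a < s) x₀ hF ht
  have h2 : F * Real.exp (-a * t) / (s - a) ≤ 2 * (F / s) * Real.exp (-a * t) := by
    have : F / (s - a) ≤ F / (s / 2) := div_le_div_of_nonneg_left hF0 (by positivity) (by linarith)
    calc _ = F / (s - a) * Real.exp (-a * t) := by ring
      _ ≤ F / (s / 2) * Real.exp (-a * t) := by gcongr
      _ = _ := by field_simp
  have h3 := sq_le_sq' (by linarith [(abs_le.1 (h1.trans h2)).1]) (abs_le.1 (h1.trans h2)).2
  have e1 : Real.exp (-s * t) ^ 2 = Real.exp (-(2 * s) * t) := by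
    rw [← Real.exp_nat_mul]; congr 1; push_cast; ring
  have e2 : Real.exp (-a * t) ^ 2 = Real.exp (-(2 * a) * t) := by
    rw [← Real.exp_nat_mul]; congr 1; push_cast; ring
  have h4 : duhamel s x₀ f t ^ 2 ≤ 2 * (Real.exp (-s * t) * x₀) ^ 2 +
      2 * (duhamel s x₀ f t - Real.exp (-s * t) * x₀) ^ 2 := by
    nlinarith [sq_nonneg (duhamel s x₀ f t - 2 * (Real.exp (-s * t) * x₀))]
  rw [← e1, ← e2]
  calc _ ≤ _ := h4
    _ ≤ 2 * (Real.exp (-s * t) * x₀) ^ 2 + 2 * (2 * (F / s) * Real.exp (-a * t)) ^ 2 := by gcongr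
    _ = _ := by ring

/-- Pointwise bound for a stable mode in the form norm; `c + s` is the shifted eigenvalue. The
term in `F²` carries no factor `c + s`, because `(c + s) / s²` is bounded for `s ≥ δ`: hence the
bounds can be summed over the modes. -/
theorem mul_sq_duhamel_le {s a δ c : ℝ} (hδ : 0 < δ) (hc : 0 ≤ c) (hs : δ ≤ s)
    (has : 2 * a ≤ δ) (x₀ : ℝ) {f : ℝ → ℝ} {F : ℝ}
    (hF : ∀ τ, 0 ≤ τ → |f τ| ≤ F * Real.exp (-a * τ)) {t : ℝ} (ht : 0 ≤ t) :
    (c + s) * duhamel s x₀ f t ^ 2 ≤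
      Real.exp (-(2 * a) * t) * (2 * ((c + s) * x₀ ^ 2) + 8 * (c / δ + 1) / δ * F ^ 2) := by
  have hs0 : 0 < s := hδ.trans_le hs
  have h1 := sq_duhamel_le hs0 (has.trans hs) x₀ hF ht
  have h2 : Real.exp (-(2 * s) * t) ≤ Real.exp (-(2 * a) * t) :=
    Real.exp_le_exp.2 (by nlinarith)
  have h3 : (c + s) / s ^ 2 ≤ (c / δ + 1) / δ := by
    have e : (c + s) / s ^ 2 = (c / s + 1) / s := by field_simp
    rw [e]
    gcongr
  calc _ ≤ (c + s) * (2 * (Real.exp (-(2 * s) * t) * x₀ ^ 2) +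
          8 * (F ^ 2 / s ^ 2) * Real.exp (-(2 * a) * t)) := by gcongr
    _ ≤ (c + s) * (2 * (Real.exp (-(2 * a) * t) * x₀ ^ 2) +
          8 * (F ^ 2 / s ^ 2) * Real.exp (-(2 * a) * t)) := by gcongr
    _ = Real.exp (-(2 * a) * t) * (2 * ((c + s) * x₀ ^ 2) + 8 * ((c + s) / s ^ 2) * F ^ 2) := by
        ring
    _ ≤ Real.exp (-(2 * a) * t) * (2 * ((c + s) * x₀ ^ 2) + 8 * ((c / δ + 1) / δ) * F ^ 2) := by
        gcongr
    _ = _ := by ring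

/-- Bound for a stable mode in `L²(0, T; D(𝒜))`. Integrating `exp (-2 s t)` gains the factor `1 / s`
that turns the square of the shifted eigenvalue `c + s` into its first power, so that the initial
value enters with the form norm only. -/
theorem integral_sq_duhamel_le {s a δ c : ℝ} (ha : 0 ≤ a) (hδ : 0 < δ) (hc : 0 ≤ c) (hs : δ ≤ s)
    (has : 2 * a ≤ δ) (x₀ : ℝ) {f : ℝ → ℝ} (hf : Continuous f) {F : ℝ}
    (hF : ∀ τ, 0 ≤ τ → |f τ| ≤ F * Real.exp (-a * τ)) {T : ℝ} (hT : 0 ≤ T) :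
    ∫ t in Ioo 0 T, ((c + s) * duhamel s x₀ f t) ^ 2 ≤
      (c / δ + 1) * ((c + s) * x₀ ^ 2) + 8 * (c / δ + 1) ^ 2 * T * F ^ 2 := by
  have hs0 : 0 < s := hδ.trans_le hs
  have hΛ : (c + s) / s ≤ c / δ + 1 := by
    have e : (c + s) / s = c / s + 1 := by field_simp
    rw [e]
    gcongr
  have hD : Continuous (duhamel s x₀ f) :=
    continuous_iff_continuousAt.2 fun t => (hasDerivAt_duhamel s x₀ hf t).continuousAt
  rw [← integral_Ioc_eq_integral_Ioo, ← intervalIntegral.integral_of_le hT]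
  have h1 : ∀ t ∈ Icc 0 T, ((c + s) * duhamel s x₀ f t) ^ 2 ≤
      2 * (c + s) ^ 2 * x₀ ^ 2 * Real.exp (-(2 * s) * t) + 8 * ((c + s) / s) ^ 2 * F ^ 2 := by
    intro t ht
    have h2 := sq_duhamel_le hs0 (has.trans hs) x₀ hF ht.1
    have h3 : Real.exp (-(2 * a) * t) ≤ 1 := Real.exp_le_one_iff.2 (by nlinarith [ht.1])
    calc _ = (c + s) ^ 2 * duhamel s x₀ f t ^ 2 := by ring
      _ ≤ (c + s) ^ 2 * (2 * (Real.exp (-(2 * s) * t) * x₀ ^ 2) + 8 * (F ^ 2 / s ^ 2) * 1) := by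
          refine mul_le_mul_of_nonneg_left (h2.trans ?_) (sq_nonneg _)
          gcongr
      _ = _ := by field_simp
  have h4 : ∫ t in (0 : ℝ)..T, Real.exp (-(2 * s) * t) ≤ 1 / (2 * s) := by
    rw [integral_exp_const_mul (neg_ne_zero.2 (by positivity)), div_neg, ← neg_div]
    gcongr
    linarith [Real.exp_pos (-(2 * s) * T)]
  calc _ ≤ ∫ t in (0 : ℝ)..T, (2 * (c + s) ^ 2 * x₀ ^ 2 * Real.exp (-(2 * s) * t) +
        8 * ((c + s) / s) ^ 2 * F ^ 2) := by
        refine intervalIntegral.integral_mono_on hT ?_ ?_ h1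
        · exact (by fun_prop : Continuous fun t =>
            ((c + s) * duhamel s x₀ f t) ^ 2).intervalIntegrable _ _
        · exact (by fun_prop : Continuous fun t => 2 * (c + s) ^ 2 * x₀ ^ 2 *
            Real.exp (-(2 * s) * t) + 8 * ((c + s) / s) ^ 2 * F ^ 2).intervalIntegrable _ _
    _ = 2 * (c + s) ^ 2 * x₀ ^ 2 * (∫ t in (0 : ℝ)..T, Real.exp (-(2 * s) * t)) +
        8 * ((c + s) / s) ^ 2 * F ^ 2 * T := by
        rw [intervalIntegral.integral_add, intervalIntegral.integral_const_mul,
          intervalIntegral.integral_const]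
        · rw [smul_eq_mul]; ring
        · exact (by fun_prop : Continuous fun t => 2 * (c + s) ^ 2 * x₀ ^ 2 *
            Real.exp (-(2 * s) * t)).intervalIntegrable _ _
        · exact intervalIntegrable_const
    _ ≤ 2 * (c + s) ^ 2 * x₀ ^ 2 * (1 / (2 * s)) + 8 * ((c + s) / s) ^ 2 * F ^ 2 * T := by gcongr
    _ = (c + s) / s * ((c + s) * x₀ ^ 2) + 8 * ((c + s) / s) ^ 2 * T * F ^ 2 := by
        field_simp
    _ ≤ _ := by gcongr

/-! ### Modal coordinates and uniqueness -/

section Modes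

variable {L lam ℓ : ℝ} {bc : BoundaryCondition} {m n : ℕ} {b : Fin m → L2 L} {e : Fin n → L2 L}
  {K : Matrix (Fin m) (Fin n) ℝ}

theorem hilbertBasis_ext {H ι : Type*} [NormedAddCommGroup H] [InnerProductSpace ℝ H]
    (φ : HilbertBasis ι ℝ H) {u v : H} (h : ∀ i, ⟪u, φ i⟫ = ⟪v, φ i⟫) : u = v := by
  refine φ.repr.injective (lp.ext (funext fun i => ?_))
  rw [φ.repr_apply_apply, φ.repr_apply_apply, ← real_inner_comm, h, real_inner_comm]

theorem IsEigen.inner_opA (hL : 0 < L) {μ : ℝ} {φ : L2 L} (hφ : IsEigen L lam bc μ φ) {u : L2 L}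
    (hu : MemDomain L bc u) : ⟪opA L lam u, φ⟫ = μ * ⟪u, φ⟫ := by
  have h1 := resolvent_opA (lam := lam) hL hu
  have h2 := hφ.smul_resolvent hL
  have h3 := (isSymmetric_resolvent L lam bc) ((1 + lam ^ 2 / 4) • u - opA L lam u) φ
  simp only [ContinuousLinearMap.coe_coe] at h3
  have h4 : ⟪(1 + lam ^ 2 / 4) • u - opA L lam u, φ⟫ = (1 + lam ^ 2 / 4 - μ) * ⟪u, φ⟫ := by
    rw [← h2, inner_smul_right, ← h3, h1, h2]
  rw [inner_sub_left, real_inner_smul_left] at h4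
  linarith

theorem continuous_modes (e : Fin n → L2 L) : Continuous (modes e) :=
  continuous_pi fun _ => continuous_id.inner continuous_const

theorem continuous_feedback (hℓ : 0 < ℓ) (b : Fin m → L2 L) (e : Fin n → L2 L)
    (K : Matrix (Fin m) (Fin n) ℝ) : Continuous (feedback ℓ b e K) := by
  obtain ⟨c, hc⟩ := lipschitzWith_sat_mulVec hℓ K
  have h := hc.continuous.comp (continuous_modes e)
  exact continuous_finsetSum _ fun k _ => ((continuous_apply k).comp h).smul continuous_const

theorem modeField_apply (σ : Fin n → ℝ) (z : Fin n → ℝ) (j : Fin n) :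
    modeField ℓ (Matrix.diagonal σ) (controlMatrix b e) K z j =
      σ j * z j + ⟪∑ k, sat ℓ ((K *ᵥ z) k) • b k, e j⟫ := by
  rw [modeField, Pi.add_apply, Matrix.mulVec_diagonal]
  simp only [sum_inner, real_inner_smul_left, Matrix.mulVec, dotProduct, controlMatrix,
    Matrix.of_apply]
  congr 1
  exact Finset.sum_congr rfl fun k _ => mul_comm _ _

theorem opA_memLp {T : ℝ} {y : ℝ → L2 L}
    (h : ∀ k ≤ 4, MemLp (fun t => weakDeriv L k (y t)) 2 (volume.restrict (Ioo 0 T))) :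
    MemLp (fun t => opA L lam (y t)) 2 (volume.restrict (Ioo 0 T)) :=
  (h 4 le_rfl).neg.sub ((h 2 (by norm_num)).const_smul lam)

theorem intervalIntegrable_of_memLp {E : Type*} [NormedAddCommGroup E] {T : ℝ} {g : ℝ → E}
    (h : MemLp g 2 (volume.restrict (Ioo 0 T))) {t : ℝ} (ht : t ∈ Icc 0 T) :
    IntervalIntegrable g volume 0 t := by
  have h1 : IntegrableOn g (Ioo 0 T) := h.integrable (by norm_num)
  rw [intervalIntegrable_iff_integrableOn_Ioo_of_le ht.1]
  exact h1.mono_set (Ioo_subset_Ioo_right ht.2)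

theorem IsSolution.continuousOn {T : ℝ} {y₀ : L2 L} {y : ℝ → L2 L}
    (h : IsSolution L lam ℓ bc b e K T y₀ y) : ContinuousOn y (Icc 0 T) := by
  simpa only [weakDeriv_zero] using h.continuous_H2 0 (by norm_num)

/-- The weak form of the equation, tested with an eigenfunction. -/
theorem inner_integral_opA_add (hL : 0 < L) {T : ℝ} {y g : ℝ → L2 L}
    (hd : ∀ᵐ t ∂(volume.restrict (Ioo 0 T)), MemDomain L bc (y t))
    (h4 : ∀ k ≤ 4, MemLp (fun t => weakDeriv L k (y t)) 2 (volume.restrict (Ioo 0 T)))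
    (hg : ContinuousOn g (Icc 0 T)) {μ : ℝ} {φ : L2 L} (hφ : IsEigen L lam bc μ φ) {t : ℝ}
    (ht : t ∈ Icc 0 T) :
    ⟪∫ s in (0 : ℝ)..t, (opA L lam (y s) + g s), φ⟫ =
      ∫ s in (0 : ℝ)..t, (μ * ⟪y s, φ⟫ + ⟪g s, φ⟫) := by
  have hi : IntervalIntegrable (fun s => opA L lam (y s) + g s) volume 0 t := by
    refine (intervalIntegrable_of_memLp (opA_memLp h4) ht).add (ContinuousOn.intervalIntegrable ?_)
    rw [uIcc_of_le ht.1]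
    exact hg.mono (Icc_subset_Icc_right ht.2)
  have h1 := (innerSL ℝ φ).intervalIntegral_comp_comm hi
  simp only [innerSL_apply_apply] at h1
  rw [real_inner_comm, ← h1]
  refine intervalIntegral.integral_congr_ae ?_
  have h3 := (ae_restrict_iff' measurableSet_Ioo).1 hd
  have h4 : ∀ᵐ s : ℝ, s ≠ T := by simp [ae_iff]
  filter_upwards [h3, h4] with s hs hsT hst
  rw [uIoc_of_le ht.1] at hst
  rw [real_inner_comm, inner_add_left,
    hφ.inner_opA hL (hs ⟨hst.1, lt_of_le_of_ne (hst.2.trans ht.2) hsT⟩)]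

theorem IsSolution.inner_eq (hL : 0 < L) (hℓ : 0 < ℓ) {T : ℝ} {y₀ : L2 L} {y : ℝ → L2 L}
    (h : IsSolution L lam ℓ bc b e K T y₀ y) {μ : ℝ} {φ : L2 L} (hφ : IsEigen L lam bc μ φ) {t : ℝ}
    (ht : t ∈ Icc 0 T) :
    ⟪y t, φ⟫ = ⟪y₀, φ⟫ + ∫ s in (0 : ℝ)..t, (μ * ⟪y s, φ⟫ + ⟪feedback ℓ b e K (y s), φ⟫) := by
  rw [← inner_integral_opA_add (g := fun s => feedback ℓ b e K (y s)) hL h.mem_domain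
    h.memLp_H4 ((continuous_feedback hℓ b e K).comp_continuousOn h.continuousOn) hφ ht,
    ← inner_add_left]
  exact congrArg (fun u => ⟪u, φ⟫) (h.equation t ht)

theorem hasDerivWithinAt_Ici_of_eq_add_integral {x g : ℝ → ℝ} {x₀ T : ℝ}
    (hg : ContinuousOn g (Icc 0 T))
    (hx : ∀ t ∈ Icc 0 T, x t = x₀ + ∫ s in (0 : ℝ)..t, g s) {t : ℝ} (ht : t ∈ Ico 0 T) :
    HasDerivWithinAt x (g t) (Ici t) t := by
  have hmem : Icc 0 T ∈ 𝓝[>] t :=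
    mem_of_superset (Ioo_mem_nhdsGT ht.2) fun s hs => ⟨ht.1.trans hs.1.le, hs.2.le⟩
  have hmem' : Icc 0 T ∈ 𝓝[≥] t :=
    mem_of_superset (Ico_mem_nhdsGE ht.2) fun s hs => ⟨ht.1.trans hs.1, hs.2.le⟩
  have hi : IntervalIntegrable g volume 0 t := by
    refine (hg.mono ?_).intervalIntegrable
    rw [uIcc_of_le ht.1]
    exact Icc_subset_Icc_right ht.2.le
  have hm : StronglyMeasurableAtFilter g (𝓝[>] t) :=
    ⟨Icc 0 T, hmem, hg.aestronglyMeasurable measurableSet_Icc⟩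
  have hc : ContinuousWithinAt g (Ioi t) t :=
    (hg t ⟨ht.1, ht.2.le⟩).mono_of_mem_nhdsWithin hmem
  have h1 := (intervalIntegral.integral_hasDerivWithinAt_right hi (s := Ici t) hm hc).const_add x₀
  refine h1.congr_of_eventuallyEq ?_ (hx t ⟨ht.1, ht.2.le⟩)
  filter_upwards [hmem'] with s hs using hx s hs

theorem IsSolution.hasDerivWithinAt_inner (hL : 0 < L) (hℓ : 0 < ℓ) {T : ℝ} {y₀ : L2 L}
    {y : ℝ → L2 L} (h : IsSolution L lam ℓ bc b e K T y₀ y) {μ : ℝ} {φ : L2 L}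
    (hφ : IsEigen L lam bc μ φ) {t : ℝ} (ht : t ∈ Ico 0 T) :
    HasDerivWithinAt (fun t => ⟪y t, φ⟫) (μ * ⟪y t, φ⟫ + ⟪feedback ℓ b e K (y t), φ⟫) (Ici t)
      t := by
  have h1 := h.continuousOn
  have h2 := (continuous_feedback hℓ b e K).comp_continuousOn h1
  exact hasDerivWithinAt_Ici_of_eq_add_integral
    (g := fun t => μ * ⟪y t, φ⟫ + ⟪feedback ℓ b e K (y t), φ⟫)
    (((h1.inner continuousOn_const).const_mul _).add (h2.inner continuousOn_const))
    (fun s hs => h.inner_eq hL hℓ hφ hs) ht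

/-- The unstable modes of a solution solve a Lipschitz system; the feedback being determined by
them, every other mode solves a scalar linear equation with known right-hand side. -/
theorem IsSolution.eqOn (hL : 0 < L) (hℓ : 0 < ℓ) {σ : Fin n → ℝ}
    (he : IsUnstableBasis L lam bc σ e) {T : ℝ} (hT : 0 ≤ T) {y₀ : L2 L} {y w : ℝ → L2 L}
    (hy : IsSolution L lam ℓ bc b e K T y₀ y) (hw : IsSolution L lam ℓ bc b e K T y₀ w) :
    EqOn w y (Icc 0 T) := by
  obtain ⟨κ, _, φ, μ, -, -, hφ, -, -⟩ := he.exists_hilbertBasis hL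
  have h0 : ∀ {v : ℝ → L2 L}, IsSolution L lam ℓ bc b e K T y₀ v → v 0 = y₀ := fun hv => by
    simpa using hv.equation 0 ⟨le_rfl, hT⟩
  obtain ⟨c, hc⟩ := lipschitzWith_modeField hℓ (Matrix.diagonal σ) (controlMatrix b e) K
  have hmodes : ∀ {v : ℝ → L2 L}, IsSolution L lam ℓ bc b e K T y₀ v → ∀ t ∈ Ico 0 T,
      HasDerivWithinAt (fun t => modes e (v t)) (modeField ℓ (Matrix.diagonal σ)
        (controlMatrix b e) K (modes e (v t))) (Ici t) t := fun hv t ht => by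
    rw [hasDerivWithinAt_pi]
    intro j
    rw [modeField_apply]
    exact hv.hasDerivWithinAt_inner hL hℓ (he.eigen j) ht
  have h1 : EqOn (fun t => modes e (w t)) (fun t => modes e (y t)) (Icc 0 T) :=
    ODE_solution_unique (v := fun _ => modeField ℓ (Matrix.diagonal σ) (controlMatrix b e) K)
      (fun _ => hc) ((continuous_modes e).comp_continuousOn hw.continuousOn) (hmodes hw)
      ((continuous_modes e).comp_continuousOn hy.continuousOn) (hmodes hy) (by simp [h0 hw, h0 hy])
  have h2 : ∀ t ∈ Icc 0 T, feedback ℓ b e K (w t) = feedback ℓ b e K (y t) := fun t ht => by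
    have : modes e (w t) = modes e (y t) := h1 ht
    rw [feedback, feedback, this]
  have h3 : ∀ i, EqOn (fun t => ⟪w t, φ i⟫) (fun t => ⟪y t, φ i⟫) (Icc 0 T) := fun i => by
    refine ODE_solution_unique (v := fun t x => μ i * x + ⟪feedback ℓ b e K (y t), φ i⟫)
      (K := ‖μ i‖₊) (fun t => ?_) (hw.continuousOn.inner continuousOn_const) (fun t ht => ?_)
      (hy.continuousOn.inner continuousOn_const)
      (fun t ht => hy.hasDerivWithinAt_inner hL hℓ (hφ i) ht) (by simp [h0 hw, h0 hy])
    · refine LipschitzWith.of_dist_le_mul fun x x' => ?_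
      rw [dist_add_right, Real.dist_eq, Real.dist_eq, ← mul_sub, abs_mul, coe_nnnorm,
        Real.norm_eq_abs]
    · have := hw.hasDerivWithinAt_inner hL hℓ (hφ i) ht
      rwa [h2 t ⟨ht.1, ht.2.le⟩] at this
  intro t ht
  exact hilbertBasis_ext φ fun i => h3 i ht

end Modes

/-! ### Synthesis of a trajectory from its modes -/

section Synthesis

variable {L lam : ℝ} {bc : BoundaryCondition} {ι : Type} {φ : HilbertBasis ι ℝ (L2 L)} {μ : ι → ℝ}

/-- The normalized element of the form space that lies over the eigenfunction `φ` with eigenvalue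
`μ`: the adjoint of the embedding maps eigenfunctions to multiples of their lifts. -/
def formMode (L lam : ℝ) (bc : BoundaryCondition) (μ : ℝ) (φ : L2 L) : formSpace L lam bc :=
  ContinuousLinearMap.adjoint (embed L lam bc) (Real.sqrt (1 + lam ^ 2 / 4 - μ) • φ)

theorem inner_formMode (w : formSpace L lam bc) (μ : ℝ) (φ : L2 L) :
    ⟪w, formMode L lam bc μ φ⟫ = Real.sqrt (1 + lam ^ 2 / 4 - μ) * ⟪embed L lam bc w, φ⟫ := by
  rw [formMode, ContinuousLinearMap.adjoint_inner_right, real_inner_smul_right]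

theorem orthonormal_formMode (hL : 0 < L) (hφ : ∀ i, IsEigen L lam bc (μ i) (φ i))
    (hμ : ∀ i, 0 < 1 + lam ^ 2 / 4 - μ i) :
    Orthonormal ℝ fun i => formMode L lam bc (μ i) (φ i) := by
  classical
  rw [orthonormal_iff_ite]
  intro i j
  rw [inner_formMode, formMode, ← resolvent_apply, map_smul, real_inner_smul_left]
  have h1 : ⟪resolvent L lam bc (φ i), φ j⟫ =
      (1 + lam ^ 2 / 4 - μ i)⁻¹ * ⟪φ i, φ j⟫ := by
    rw [eq_inv_mul_iff_mul_eq₀ (hμ i).ne', ← real_inner_smul_left, (hφ i).smul_resolvent hL]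
  rw [h1, (orthonormal_iff_ite.1 φ.orthonormal) i j]
  split_ifs with h
  · subst h
    have := Real.mul_self_sqrt (hμ i).le
    rw [mul_one, ← mul_assoc, this, mul_inv_cancel₀ (hμ i).ne']
  · ring

/-- Bessel's inequality in the form space. -/
theorem summable_mul_sq_inner_embed (hL : 0 < L) (hφ : ∀ i, IsEigen L lam bc (μ i) (φ i))
    (hμ : ∀ i, 0 < 1 + lam ^ 2 / 4 - μ i) (w : formSpace L lam bc) :
    Summable (fun i => (1 + lam ^ 2 / 4 - μ i) * ⟪embed L lam bc w, φ i⟫ ^ 2) ∧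
      ∑' i, (1 + lam ^ 2 / 4 - μ i) * ⟪embed L lam bc w, φ i⟫ ^ 2 ≤ ‖w‖ ^ 2 := by
  have h := orthonormal_formMode hL hφ hμ
  have e : ∀ i, ‖⟪formMode L lam bc (μ i) (φ i), w⟫‖ ^ 2 =
      (1 + lam ^ 2 / 4 - μ i) * ⟪embed L lam bc w, φ i⟫ ^ 2 := fun i => by
    rw [real_inner_comm, inner_formMode, Real.norm_eq_abs, sq_abs, mul_pow,
      Real.sq_sqrt (hμ i).le]
  simp only [← e]
  exact ⟨h.inner_products_summable (x := w), h.tsum_inner_products_le (x := w)⟩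

/-- Modes with a summable majorant in the form norm are those of a continuous curve in the form
space. -/
theorem exists_form_trajectory (hL : 0 < L) (hφ : ∀ i, IsEigen L lam bc (μ i) (φ i))
    (hμ : ∀ i, 0 < 1 + lam ^ 2 / 4 - μ i) {x : ι → ℝ → ℝ} {M : ι → ℝ} {s : Set ℝ}
    (hx : ∀ i, ContinuousOn (x i) s) (hM : Summable M)
    (hxM : ∀ i, ∀ t ∈ s, (1 + lam ^ 2 / 4 - μ i) * x i t ^ 2 ≤ M i) :
    ∃ Y : ℝ → formSpace L lam bc, ContinuousOn Y s ∧
      ∀ t ∈ s, (∀ i, ⟪embed L lam bc (Y t), φ i⟫ = x i t) ∧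
        ‖Y t‖ ^ 2 = ∑' i, (1 + lam ^ 2 / 4 - μ i) * x i t ^ 2 := by
  have h := orthonormal_formMode hL hφ hμ
  have e : ∀ i t, (Real.sqrt (1 + lam ^ 2 / 4 - μ i) * x i t) ^ 2 =
      (1 + lam ^ 2 / 4 - μ i) * x i t ^ 2 := fun i t => by
    rw [mul_pow, Real.sq_sqrt (hμ i).le]
  refine ⟨fun t => ∑' i, (Real.sqrt (1 + lam ^ 2 / 4 - μ i) * x i t) •
    formMode L lam bc (μ i) (φ i), ?_, fun t ht => ?_⟩
  · refine continuousOn_tsum_smul h (fun i => continuousOn_const.mul (hx i)) hM fun i t ht => ?_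
    rw [e]
    exact hxM i t ht
  · have hs : Summable fun i => (Real.sqrt (1 + lam ^ 2 / 4 - μ i) * x i t) ^ 2 := by
      refine hM.of_nonneg_of_le (fun i => sq_nonneg _) fun i => ?_
      rw [e]
      exact hxM i t ht
    refine ⟨fun i => ?_, ?_⟩
    · have h1 := inner_tsum_smul h hs i
      rw [inner_formMode] at h1
      exact mul_left_cancel₀ (Real.sqrt_pos.2 (hμ i)).ne' h1
    · rw [norm_sq_tsum_smul h hs]
      simp only [e]

/-- If the modes, multiplied by the shifted eigenvalues, are square summable in `L²(0, T)`, the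
curve is almost everywhere the resolvent of a curve in `L²(0, T; L²(0, L))`. -/
theorem memLp_weakDeriv_of_modes [Countable ι] (hL : 0 < L)
    (hφ : ∀ i, IsEigen L lam bc (μ i) (φ i)) (hμ : ∀ i, 0 < 1 + lam ^ 2 / 4 - μ i)
    {x : ι → ℝ → ℝ} {y : ℝ → L2 L} {T : ℝ} (hx : ∀ i, ContinuousOn (x i) (Icc 0 T))
    (hy : ∀ t ∈ Icc 0 T, ∀ i, ⟪y t, φ i⟫ = x i t)
    (hsum : Summable fun i => ∫ t in Ioo 0 T, ((1 + lam ^ 2 / 4 - μ i) * x i t) ^ 2) :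
    (∀ᵐ t ∂(volume.restrict (Ioo 0 T)), MemDomain L bc (y t)) ∧
      ∀ k ≤ 4, MemLp (fun t => weakDeriv L k (y t)) 2 (volume.restrict (Ioo 0 T)) := by
  have hc : ∀ i, ContinuousOn (fun t => (1 + lam ^ 2 / 4 - μ i) * x i t) (Icc 0 T) := fun i =>
    continuousOn_const.mul (hx i)
  obtain ⟨h1, h2⟩ := memLp_tsum_smul φ.orthonormal
    (fun i => ((hc i).mono Ioo_subset_Icc_self).aestronglyMeasurable measurableSet_Ioo)
    (fun i => (((hc i).pow 2).integrableOn_Icc).mono_set Ioo_subset_Icc_self) hsum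
  have h3 : ∀ᵐ t ∂(volume.restrict (Ioo 0 T)),
      resolvent L lam bc (∑' i, ((1 + lam ^ 2 / 4 - μ i) * x i t) • φ i) = y t := by
    filter_upwards [h2, ae_restrict_mem measurableSet_Ioo] with t ht htT
    refine hilbertBasis_ext φ fun i => ?_
    have h4 := (isSymmetric_resolvent L lam bc)
      (∑' i, ((1 + lam ^ 2 / 4 - μ i) * x i t) • φ i) (φ i)
    simp only [ContinuousLinearMap.coe_coe] at h4
    refine mul_left_cancel₀ (hμ i).ne' ?_
    rw [h4, ← inner_smul_right, (hφ i).smul_resolvent hL, inner_tsum_smul φ.orthonormal ht,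
      hy t (Ioo_subset_Icc_self htT)]
  refine ⟨?_, fun k hk => ?_⟩
  · filter_upwards [h3] with t ht
    rw [← ht]
    exact (memDomain_resolvent hL _).1
  · have h4 := (weakDerivCLM (resolvent L lam bc) k
      fun f => (memDomain_resolvent hL f).1.1 k hk).comp_memLp' h1
    refine h4.ae_eq ?_
    filter_upwards [h3] with t ht
    simp only [Function.comp_apply, weakDerivCLM_apply, ht]

/-- A curve solves the evolution equation if each of its modes solves the corresponding scalar
equation. -/
theorem eq_add_integral_of_modes (hL : 0 < L) (hφ : ∀ i, IsEigen L lam bc (μ i) (φ i))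
    {x : ι → ℝ → ℝ} {y g : ℝ → L2 L} {T : ℝ}
    (hd : ∀ᵐ t ∂(volume.restrict (Ioo 0 T)), MemDomain L bc (y t))
    (h4 : ∀ k ≤ 4, MemLp (fun t => weakDeriv L k (y t)) 2 (volume.restrict (Ioo 0 T)))
    (hg : ContinuousOn g (Icc 0 T)) (hx : ∀ i, ContinuousOn (x i) (Icc 0 T))
    (hy : ∀ t ∈ Icc 0 T, ∀ i, ⟪y t, φ i⟫ = x i t)
    (hx' : ∀ i, ∀ t ∈ Icc 0 T, HasDerivWithinAt (x i) (μ i * x i t + ⟪g t, φ i⟫) (Ici t) t)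
    {t : ℝ} (ht : t ∈ Icc 0 T) :
    y t = y 0 + ∫ s in (0 : ℝ)..t, (opA L lam (y s) + g s) := by
  have h0 : (0 : ℝ) ∈ Icc 0 T := ⟨le_rfl, ht.1.trans ht.2⟩
  have hsub : Icc 0 t ⊆ Icc 0 T := Icc_subset_Icc_right ht.2
  refine hilbertBasis_ext φ fun i => ?_
  rw [inner_add_left, inner_integral_opA_add hL hd h4 hg (hφ i) ht, hy t ht, hy 0 h0]
  have hc : ContinuousOn (fun s => μ i * x i s + ⟪g s, φ i⟫) (Icc 0 t) :=
    ((continuousOn_const.mul (hx i)).add (hg.inner continuousOn_const)).mono hsub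
  have h5 : ∫ s in (0 : ℝ)..t, (μ i * ⟪y s, φ i⟫ + ⟪g s, φ i⟫) =
      ∫ s in (0 : ℝ)..t, (μ i * x i s + ⟪g s, φ i⟫) := by
    refine intervalIntegral.integral_congr fun s hs => ?_
    rw [uIcc_of_le ht.1] at hs
    simp only [hy s (hsub hs)]
  rw [h5, intervalIntegral.integral_eq_sub_of_hasDeriv_right (f := x i)]
  · ring
  · rw [uIcc_of_le ht.1]
    exact (hx i).mono hsub
  · intro s hs
    rw [min_eq_left ht.1, max_eq_right ht.1] at hs
    exact (hx' i s (hsub ⟨hs.1.le, hs.2.le⟩)).mono Ioi_subset_Ici_self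
  · refine ContinuousOn.intervalIntegrable ?_
    rwa [uIcc_of_le ht.1]

/-! ### The form norm and the norm of `H²` -/

/-- The form norm controls the norm of `H²`, since weak derivatives are bounded operators on the
form space by the closed graph theorem. -/
theorem exists_sobolevNorm_embed_le (hL : 0 < L) (lam : ℝ) (bc : BoundaryCondition) :
    ∃ c > 0, ∀ w : formSpace L lam bc, sobolevNorm L 2 (embed L lam bc w) ≤ c * ‖w‖ := by
  have hD : ∀ k : ℕ, ∃ c ≥ 0, ∀ w : formSpace L lam bc, k ≤ 2 →
      ‖weakDeriv L k (embed L lam bc w)‖ ≤ c * ‖w‖ := fun k => by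
    by_cases hk : k ≤ 2
    · let D := weakDerivCLM (embed L lam bc) k fun w => memSobolev_embed hL w k hk
      exact ⟨‖D‖, norm_nonneg D, fun w _ => D.le_opNorm w⟩
    · exact ⟨0, le_rfl, fun w h => absurd h hk⟩
  choose c hc0 hc using hD
  refine ⟨Real.sqrt (∑ k ∈ Finset.range 3, c k ^ 2) + 1, by positivity, fun w => ?_⟩
  have h1 : ∑ k ∈ Finset.range (2 + 1), ‖weakDeriv L k (embed L lam bc w)‖ ^ 2 ≤
      (∑ k ∈ Finset.range 3, c k ^ 2) * ‖w‖ ^ 2 := by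
    rw [Finset.sum_mul]
    refine Finset.sum_le_sum fun k hk => ?_
    rw [← mul_pow]
    have := hc k w (by have := Finset.mem_range.1 hk; omega)
    gcongr
  calc sobolevNorm L 2 (embed L lam bc w)
      ≤ Real.sqrt ((∑ k ∈ Finset.range 3, c k ^ 2) * ‖w‖ ^ 2) := Real.sqrt_le_sqrt h1
    _ = Real.sqrt (∑ k ∈ Finset.range 3, c k ^ 2) * ‖w‖ := by
        rw [Real.sqrt_mul (Finset.sum_nonneg fun k _ => sq_nonneg _),
          Real.sqrt_sq (norm_nonneg _)]
    _ ≤ _ := by nlinarith [norm_nonneg w]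

theorem norm_weakDeriv_le_sobolevNorm {s k : ℕ} (hk : k ≤ s) (u : L2 L) :
    ‖weakDeriv L k u‖ ≤ sobolevNorm L s u := by
  refine Real.le_sqrt_of_sq_le ?_
  exact Finset.single_le_sum (f := fun k => ‖weakDeriv L k u‖ ^ 2) (fun i _ => sq_nonneg _)
    (Finset.mem_range.2 (by omega))

theorem norm_formSpace_le (hlam : 0 ≤ lam) {w : formSpace L lam bc} {u : L2 L}
    (hu : embed L lam bc w = u)
    (hw : (w : WithLp 2 (L2 L × L2 L)).snd = weakDeriv L 2 u + (lam / 2) • u) :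
    ‖w‖ ≤ (2 + lam / 2) * sobolevNorm L 2 u := by
  have h0 : ‖u‖ ≤ sobolevNorm L 2 u := by
    simpa only [weakDeriv_zero] using norm_weakDeriv_le_sobolevNorm (Nat.zero_le 2) u
  have h2 := norm_weakDeriv_le_sobolevNorm le_rfl u (s := 2)
  have h3 : ‖weakDeriv L 2 u + (lam / 2) • u‖ ≤ (1 + lam / 2) * sobolevNorm L 2 u := by
    calc _ ≤ ‖weakDeriv L 2 u‖ + lam / 2 * ‖u‖ := by
          refine (norm_add_le _ _).trans ?_
          rw [norm_smul, Real.norm_eq_abs, abs_of_nonneg (by positivity)]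
      _ ≤ sobolevNorm L 2 u + lam / 2 * sobolevNorm L 2 u := by gcongr
      _ = _ := by ring
  have hN : 0 ≤ sobolevNorm L 2 u := Real.sqrt_nonneg _
  refine abs_le_of_sq_le_sq' ?_ (by positivity) |>.2
  rw [← real_inner_self_eq_norm_sq, inner_formSpace, hu, hw, real_inner_self_eq_norm_sq,
    real_inner_self_eq_norm_sq]
  have h4 := pow_le_pow_left₀ (norm_nonneg _) h0 2
  have h5 := pow_le_pow_left₀ (norm_nonneg _) h3 2
  nlinarith [mul_nonneg hlam (sq_nonneg (sobolevNorm L 2 u))]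

theorem norm_embed_le (w : formSpace L lam bc) : ‖embed L lam bc w‖ ≤ ‖w‖ := by
  refine abs_le_of_sq_le_sq' ?_ (norm_nonneg _) |>.2
  rw [← real_inner_self_eq_norm_sq w, inner_formSpace, real_inner_self_eq_norm_sq]
  linarith [real_inner_self_nonneg (x := (w : WithLp 2 (L2 L × L2 L)).snd)]

end Synthesis

/-! ### Existence and decay -/

theorem summable_sum_sq_inner {H ι : Type*} [NormedAddCommGroup H] [InnerProductSpace ℝ H]
    (φ : HilbertBasis ι ℝ H) {m : ℕ} (b : Fin m → H) :
    Summable fun i => ∑ k, ⟪b k, φ i⟫ ^ 2 := by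
  refine summable_sum fun k _ => ?_
  have h := φ.orthonormal.inner_products_summable (x := b k)
  simpa only [Real.norm_eq_abs, sq_abs, real_inner_comm] using h

theorem abs_inner_sum_smul_le {H : Type*} [NormedAddCommGroup H] [InnerProductSpace ℝ H] {m : ℕ}
    (b : Fin m → H) {u : Fin m → ℝ} {r : ℝ} (hu : ∀ k, |u k| ≤ r) (φ : H) :
    |⟪∑ k, u k • b k, φ⟫| ≤ r * ∑ k, |⟪b k, φ⟫| := by
  rw [sum_inner, Finset.mul_sum]
  refine (Finset.abs_sum_le_sum_abs _ _).trans (Finset.sum_le_sum fun k _ => ?_)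
  rw [real_inner_smul_left, abs_mul]
  exact mul_le_mul_of_nonneg_right (hu k) (abs_nonneg _)

/-- The unstable modes are prescribed by the finite-dimensional closed loop `z`; they determine the
controls, hence the stable modes by variation of constants. -/
theorem exists_decaying_solution {L lam ℓ : ℝ} (hL : 0 < L) (hℓ : 0 < ℓ) {bc : BoundaryCondition}
    {m n : ℕ} (b : Fin m → L2 L) {e : Fin n → L2 L} (he : Orthonormal ℝ e)
    (K : Matrix (Fin m) (Fin n) ℝ) {κ : Type} [Countable κ]
    {φ : HilbertBasis (Fin n ⊕ κ) ℝ (L2 L)} {μ : Fin n ⊕ κ → ℝ}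
    (hφe : ∀ j, φ (Sum.inl j) = e j) (hμ0 : ∀ j, 0 ≤ μ (Sum.inl j))
    (hφ : ∀ i, IsEigen L lam bc (μ i) (φ i)) (hμ : ∀ i, 0 < 1 + lam ^ 2 / 4 - μ i)
    {δ : ℝ} (hδ : 0 < δ) (hμδ : ∀ k, μ (Sum.inr k) ≤ -δ) {a c : ℝ} (ha : 0 < a)
    (haδ : 2 * a ≤ δ) :
    ∃ A ≥ 0, ∀ (w : formSpace L lam bc) (z : ℝ → Fin n → ℝ), z 0 = modes e (embed L lam bc w) →
      ContinuousOn z (Ici 0) →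
      (∀ t, 0 ≤ t → HasDerivWithinAt z (modeField ℓ (Matrix.diagonal fun j => μ (Sum.inl j))
        (controlMatrix b e) K (z t)) (Ici t) t) →
      (∀ t, 0 ≤ t → ‖z t‖ ≤ c * ‖z 0‖ * Real.exp (-a * t)) →
      ∃ Y : ℝ → formSpace L lam bc,
        (∀ T > 0, IsSolution L lam ℓ bc b e K T (embed L lam bc w)
          fun t => embed L lam bc (Y t)) ∧
        ∀ t, 0 ≤ t → ‖Y t‖ ^ 2 ≤ Real.exp (-(2 * a) * t) * (A * ‖w‖ ^ 2) := by
  obtain ⟨r, hr⟩ := lipschitzWith_sat_mulVec hℓ K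
  have hu : ∀ z k, |sat ℓ ((K *ᵥ z) k)| ≤ r * ‖z‖ := fun z k => by
    have h1 := hr.dist_le_mul z 0
    have h2 : (fun k => sat ℓ ((K *ᵥ (0 : Fin n → ℝ)) k)) = 0 := by
      funext k
      simp [sat, hℓ.le]
    rw [h2, dist_zero_right, dist_zero_right] at h1
    exact (norm_le_pi_norm (fun k => sat ℓ ((K *ᵥ z) k)) k).trans h1
  set c₀ : ℝ := 1 + lam ^ 2 / 4 with hc₀
  have hc₀0 : 0 < c₀ := by positivity
  set β : Fin n ⊕ κ → ℝ := fun i => ∑ k, |⟪b k, φ i⟫| with hβ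
  have hβs : Summable fun i => β i ^ 2 := by
    refine ((summable_sum_sq_inner φ b).mul_left (m : ℝ)).of_nonneg_of_le
      (fun i => sq_nonneg _) fun i => ?_
    have := sq_sum_le_card_mul_sum_sq (s := Finset.univ) (f := fun k => |⟪b k, φ i⟫|)
    simpa only [sq_abs, Finset.card_univ, Fintype.card_fin] using this
  -- `θ` is the indicator of the unstable indices, written so that its summability is Bessel's
  -- inequality.
  set θ : Fin n ⊕ κ → ℝ := fun i => ∑ j, ⟪e j, φ i⟫ ^ 2 with hθ
  have hθs : Summable θ := summable_sum_sq_inner φ e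
  have hθ0 : ∀ i, 0 ≤ θ i := fun i => Finset.sum_nonneg fun j _ => sq_nonneg _
  have hθ1 : ∀ j, 1 ≤ θ (Sum.inl j) := fun j => by
    have h1 := Finset.single_le_sum (f := fun j' => ⟪e j', φ (Sum.inl j)⟫ ^ 2)
      (fun i _ => sq_nonneg _) (Finset.mem_univ j)
    have h2 : ⟪e j, φ (Sum.inl j)⟫ ^ 2 = 1 := by
      rw [hφe, real_inner_self_eq_norm_sq, he.1 j]
      norm_num
    exact h2.symm.le.trans h1
  -- The squared form norm of the solution is at most `exp (-2 a t)` times the sum of the bounds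
  -- `M i` below; `A₁` is the contribution of the controls, `A₂` that of the unstable modes.
  set A₁ : ℝ := 8 * (c₀ / δ + 1) / δ * (r * c) ^ 2 with hA₁
  set A₂ : ℝ := c₀ * c ^ 2 with hA₂
  have hA₁0 : 0 ≤ A₁ := by positivity
  have hA₂0 : 0 ≤ A₂ := by positivity
  refine ⟨2 + (A₁ * ∑' i, β i ^ 2 + A₂ * ∑' i, θ i), ?_, fun w z hz0 hzc hzd hzb => ?_⟩
  · have h1 : 0 ≤ ∑' i, β i ^ 2 := tsum_nonneg fun i => sq_nonneg _
    have h2 : 0 ≤ ∑' i, θ i := tsum_nonneg hθ0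
    positivity
  set N : ℝ := ‖z 0‖ with hN
  have hN0 : 0 ≤ N := norm_nonneg _
  have hNw : N ≤ ‖w‖ := by
    refine (pi_norm_le_iff_of_nonneg (norm_nonneg _)).2 fun j => ?_
    rw [hz0]
    refine (abs_real_inner_le_norm _ _).trans ?_
    rw [he.1 j, mul_one]
    exact norm_embed_le w
  set g : ℝ → L2 L := fun t => ∑ k, sat ℓ ((K *ᵥ z t) k) • b k with hg
  have hgc : ContinuousOn g (Ici 0) :=
    continuousOn_finsetSum _ fun k _ =>
      ((continuous_apply k).comp_continuousOn (hr.continuous.comp_continuousOn hzc)).smul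
        continuousOn_const
  -- `z`, hence `g`, is only known to be continuous for `t ≥ 0`.
  set f : Fin n ⊕ κ → ℝ → ℝ := fun i t => ⟪g (max t 0), φ i⟫ with hf
  have hfc : ∀ i, Continuous (f i) := fun i =>
    (hgc.comp_continuous (by fun_prop) fun t => le_max_right t 0).inner continuous_const
  have hfg : ∀ i t, 0 ≤ t → f i t = ⟪g t, φ i⟫ := fun i t ht => by simp only [hf, max_eq_left ht]
  have hF : ∀ i τ, 0 ≤ τ → |f i τ| ≤ r * c * N * β i * Real.exp (-a * τ) := fun i τ hτ => by
    rw [hfg i τ hτ]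
    have hβ0 : 0 ≤ β i := Finset.sum_nonneg fun k _ => abs_nonneg _
    calc _ ≤ r * ‖z τ‖ * β i := abs_inner_sum_smul_le b (hu (z τ)) (φ i)
      _ ≤ r * (c * N * Real.exp (-a * τ)) * β i := by
          gcongr
          exact hzb τ hτ
      _ = _ := by ring
  set x₀ : Fin n ⊕ κ → ℝ := fun i => ⟪embed L lam bc w, φ i⟫ with hx₀
  set x : Fin n ⊕ κ → ℝ → ℝ := Sum.elim (fun j t => z t j)
    (fun k => duhamel (-μ (Sum.inr k)) (x₀ (Sum.inr k)) (f (Sum.inr k))) with hx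
  have hx0 : ∀ i, x i 0 = x₀ i := by
    rintro (j | k)
    · simp only [hx, Sum.elim_inl, hz0, hx₀, hφe, modes]
    · simp only [hx, Sum.elim_inr, duhamel_zero]
  have hx' : ∀ i t, 0 ≤ t → HasDerivWithinAt (x i) (μ i * x i t + ⟪g t, φ i⟫) (Ici t) t := by
    rintro (j | k) t ht
    · have h1 := hasDerivWithinAt_pi.1 (hzd t ht) j
      rw [modeField_apply, ← hφe j] at h1
      exact h1
    · have h1 := (hasDerivAt_duhamel (-μ (Sum.inr k)) (x₀ (Sum.inr k)) (hfc (Sum.inr k)) t)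
      rw [neg_neg, hfg _ t ht] at h1
      exact h1.hasDerivWithinAt
  have hxc : ∀ i, ContinuousOn (x i) (Ici 0) := by
    rintro (j | k)
    · exact (continuous_apply j).comp_continuousOn hzc
    · exact fun t _ => (hasDerivAt_duhamel (-μ (Sum.inr k)) (x₀ (Sum.inr k)) (hfc (Sum.inr k))
        t).continuousAt.continuousWithinAt
  set M : Fin n ⊕ κ → ℝ := fun i =>
    2 * ((c₀ - μ i) * x₀ i ^ 2) + N ^ 2 * (A₁ * β i ^ 2 + A₂ * θ i) with hM
  have hM0 : ∀ i, 0 ≤ M i := fun i => by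
    have := (hμ i).le
    have := hθ0 i
    positivity
  obtain ⟨hws, hwle⟩ : Summable (fun i => (c₀ - μ i) * x₀ i ^ 2) ∧
      ∑' i, (c₀ - μ i) * x₀ i ^ 2 ≤ ‖w‖ ^ 2 := summable_mul_sq_inner_embed hL hφ hμ w
  have hMs : Summable M :=
    (hws.mul_left 2).add (((hβs.mul_left A₁).add (hθs.mul_left A₂)).mul_left (N ^ 2))
  have hxM : ∀ i t, 0 ≤ t → (c₀ - μ i) * x i t ^ 2 ≤ Real.exp (-(2 * a) * t) * M i := by
    rintro (j | k) t ht
    · have h1 : |z t j| ≤ c * N * Real.exp (-a * t) := (norm_le_pi_norm (z t) j).trans (hzb t ht)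
      have h2 := sq_le_sq' (abs_le.1 h1).1 (abs_le.1 h1).2
      have e1 : Real.exp (-a * t) ^ 2 = Real.exp (-(2 * a) * t) := by
        rw [← Real.exp_nat_mul]
        congr 1
        push_cast
        ring
      have h3 := (hμ (Sum.inl j)).le
      calc (c₀ - μ (Sum.inl j)) * z t j ^ 2 ≤ c₀ * (c * N * Real.exp (-a * t)) ^ 2 := by
            gcongr
            linarith [hμ0 j]
        _ = Real.exp (-(2 * a) * t) * (N ^ 2 * (A₂ * 1)) := by
            rw [← e1, hA₂]
            ring
        _ ≤ Real.exp (-(2 * a) * t) * (N ^ 2 * (A₂ * θ (Sum.inl j))) := by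
            gcongr
            exact hθ1 j
        _ ≤ _ := by
            gcongr
            have h4 : 0 ≤ (c₀ - μ (Sum.inl j)) * x₀ (Sum.inl j) ^ 2 := by positivity
            have h5 : 0 ≤ N ^ 2 * (A₁ * β (Sum.inl j) ^ 2) := by positivity
            simp only [hM]
            linarith
    · have h1 := mul_sq_duhamel_le (s := -μ (Sum.inr k)) hδ hc₀0.le (by linarith [hμδ k]) haδ
        (x₀ (Sum.inr k)) (hF (Sum.inr k)) ht
      rw [← sub_eq_add_neg] at h1
      refine h1.trans ?_
      gcongr
      have h5 : 0 ≤ N ^ 2 * (A₂ * θ (Sum.inr k)) :=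
        mul_nonneg (sq_nonneg _) (mul_nonneg hA₂0 (hθ0 _))
      simp only [hM, hA₁]
      nlinarith
  have hexp : ∀ t, 0 ≤ t → Real.exp (-(2 * a) * t) ≤ 1 := fun t ht =>
    Real.exp_le_one_iff.2 (by nlinarith)
  have hxM' : ∀ i, ∀ t ∈ Ici (0 : ℝ), (c₀ - μ i) * x i t ^ 2 ≤ M i := fun i t ht =>
    (hxM i t ht).trans (mul_le_of_le_one_left (hM0 i) (hexp t ht))
  obtain ⟨Y, hYc, hY⟩ := exists_form_trajectory hL hφ hμ hxc hMs hxM'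
  have hsum : ∀ T > 0, Summable fun i => ∫ t in Ioo 0 T, ((c₀ - μ i) * x i t) ^ 2 := by
    intro T hT
    refine Summable.of_nonneg_of_le (fun i => integral_nonneg fun t => sq_nonneg _) ?_
      (((hws.mul_left (c₀ / δ + 1)).add
        (hβs.mul_left (8 * (c₀ / δ + 1) ^ 2 * T * (r * c * N) ^ 2))).add
        (hMs.mul_left (c₀ * T)))
    rintro (j | k)
    · have h3 := (hμ (Sum.inl j)).le
      have h1 : ∀ t ∈ Ioo 0 T, ((c₀ - μ (Sum.inl j)) * x (Sum.inl j) t) ^ 2 ≤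
          c₀ * M (Sum.inl j) := fun t ht => by
        calc _ = (c₀ - μ (Sum.inl j)) * ((c₀ - μ (Sum.inl j)) * x (Sum.inl j) t ^ 2) := by ring
          _ ≤ c₀ * M (Sum.inl j) :=
            mul_le_mul (by linarith [hμ0 j]) (hxM' _ t ht.1.le) (by positivity) hc₀0.le
      have h2 : IntegrableOn (fun t => ((c₀ - μ (Sum.inl j)) * x (Sum.inl j) t) ^ 2) (Ioo 0 T) :=
        (((continuousOn_const.mul ((hxc (Sum.inl j)).mono Icc_subset_Ici_self)).pow
          2).integrableOn_Icc).mono_set Ioo_subset_Icc_self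
      have h4 := setIntegral_mono_on h2 (integrableOn_const (by simp)) measurableSet_Ioo h1
      rw [setIntegral_const, smul_eq_mul, Real.volume_real_Ioo_of_le hT.le, sub_zero] at h4
      have h5 : 0 ≤ (c₀ / δ + 1) * ((c₀ - μ (Sum.inl j)) * x₀ (Sum.inl j) ^ 2) := by positivity
      have h6 : 0 ≤ 8 * (c₀ / δ + 1) ^ 2 * T * (r * c * N) ^ 2 * β (Sum.inl j) ^ 2 := by positivity
      linarith
    · have h1 := integral_sq_duhamel_le (s := -μ (Sum.inr k)) ha.le hδ hc₀0.le
        (by linarith [hμδ k]) haδ (x₀ (Sum.inr k)) (hfc (Sum.inr k)) (hF (Sum.inr k)) hT.le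
      rw [← sub_eq_add_neg] at h1
      refine h1.trans ?_
      have h5 : 0 ≤ c₀ * T * M (Sum.inr k) := mul_nonneg (by positivity) (hM0 _)
      linarith
  have hsub : ∀ T : ℝ, Icc 0 T ⊆ Ici 0 := fun T => Icc_subset_Ici_self
  have hYx : ∀ T, ∀ t ∈ Icc 0 T, ∀ i, ⟪embed L lam bc (Y t), φ i⟫ = x i t := fun T t ht =>
    (hY t ht.1).1
  have hY0 : embed L lam bc (Y 0) = embed L lam bc w :=
    hilbertBasis_ext φ fun i => by rw [(hY 0 self_mem_Ici).1 i, hx0]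
  refine ⟨Y, fun T hT => ?_, fun t ht => ?_⟩
  · obtain ⟨hd, h4⟩ := memLp_weakDeriv_of_modes hL hφ hμ (fun i => (hxc i).mono (hsub T)) (hYx T)
      (hsum T hT)
    refine ⟨fun t _ => memSobolev_embed hL _, fun k hk => ?_, hd, h4, fun t ht => ?_⟩
    · exact (weakDerivCLM (embed L lam bc) k fun w =>
        memSobolev_embed hL w k hk).continuous.comp_continuousOn (hYc.mono (hsub T))
    · have h1 := eq_add_integral_of_modes hL hφ hd h4 (hgc.mono (hsub T))
        (fun i => (hxc i).mono (hsub T)) (hYx T) (fun i s hs => hx' i s hs.1) ht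
      rw [hY0] at h1
      rw [h1]
      congr 1
      refine intervalIntegral.integral_congr fun s hs => ?_
      rw [uIcc_of_le ht.1] at hs
      have h2 : modes e (embed L lam bc (Y s)) = z s := by
        funext j
        rw [modes, ← hφe, (hY s hs.1).1]
        rfl
      simp only [feedback, h2, hg]
  · rw [(hY t ht).2]
    calc ∑' i, (c₀ - μ i) * x i t ^ 2 ≤ ∑' i, Real.exp (-(2 * a) * t) * M i :=
          (hMs.of_nonneg_of_le (fun i => mul_nonneg (hμ i).le (sq_nonneg _))
            fun i => hxM' i t ht).tsum_le_tsum (fun i => hxM i t ht) (hMs.mul_left _)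
      _ = Real.exp (-(2 * a) * t) * (2 * ∑' i, (c₀ - μ i) * x₀ i ^ 2 +
            N ^ 2 * (A₁ * ∑' i, β i ^ 2 + A₂ * ∑' i, θ i)) := by
          rw [tsum_mul_left, (hws.mul_left 2).tsum_add
            (((hβs.mul_left A₁).add (hθs.mul_left A₂)).mul_left (N ^ 2)), tsum_mul_left,
            tsum_mul_left, (hβs.mul_left A₁).tsum_add (hθs.mul_left A₂), tsum_mul_left,
            tsum_mul_left]
      _ ≤ Real.exp (-(2 * a) * t) * (2 * ‖w‖ ^ 2 +
            ‖w‖ ^ 2 * (A₁ * ∑' i, β i ^ 2 + A₂ * ∑' i, θ i)) := by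
          have h1 : 0 ≤ ∑' i, β i ^ 2 := tsum_nonneg fun i => sq_nonneg _
          have h2 : 0 ≤ ∑' i, θ i := tsum_nonneg hθ0
          gcongr
      _ = _ := by ring

end SaturatedKS

end

theorem mainTheorem3
    (L lam ℓ : ℝ) (hL : 0 < L) (hlam : 0 < lam) (hℓ : 0 < ℓ)
    (bc : BoundaryCondition) (m n : ℕ) (b : Fin m → L2 L)
    (σ : Fin n → ℝ) (e : Fin n → L2 L) (he : IsUnstableBasis L lam bc σ e)
    (K : Matrix (Fin m) (Fin n) ℝ)
    (hK : IsHurwitz (Matrix.diagonal σ + controlMatrix b e * K))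
    (P : Matrix (Fin n) (Fin n) ℝ) (hP : P.PosDef)
    (D : Matrix (Fin m) (Fin m) ℝ) (hDdiag : D.IsDiag) (hD : D.PosDef)
    (C : Matrix (Fin m) (Fin n) ℝ)
    (hM₁ : (-lmi₁ (Matrix.diagonal σ) (controlMatrix b e) K P D C).PosDef)
    (hM₂ : (lmi₂ ℓ K P C).PosSemidef) :
    ∃ c > 0, ∃ a > 0, ∀ y₀ : L2 L,
      MemSobolev L 2 y₀ → SatisfiesBC L bc 2 y₀ → modes e y₀ ∈ region P →
        ∃ y : ℝ → L2 L,
          (∀ T > 0, IsSolution L lam ℓ bc b e K T y₀ y ∧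
            ∀ w : ℝ → L2 L, IsSolution L lam ℓ bc b e K T y₀ w → Set.EqOn w y (Set.Icc 0 T)) ∧
          ∀ t > 0, sobolevNorm L 2 (y t) ≤ c * Real.exp (-a * t) * sobolevNorm L 2 y₀ := by
  obtain ⟨κ, _, φ, μ, hφe, hμσ, hφ, hμ, δ, hδ, hμδ⟩ := he.exists_hilbertBasis hL
  obtain ⟨c₁, hc₁, a₁, ha₁, hz⟩ := exists_mode_solution hℓ hP hDdiag hD hM₁ hM₂
  -- The decay rate must stay below that of the stable modes by a fixed factor.
  set a : ℝ := min a₁ (δ / 2)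
  have ha : 0 < a := lt_min ha₁ (half_pos hδ)
  have haδ : 2 * a ≤ δ := by linarith [min_le_right a₁ (δ / 2)]
  obtain ⟨A, hA, hsol⟩ := exists_decaying_solution hL hℓ b he.orthonormal K hφe
    (fun j => (hμσ j).symm ▸ he.nonneg j) hφ hμ hδ hμδ ha haδ
  obtain ⟨c₂, hc₂, hH2⟩ := exists_sobolevNorm_embed_le hL lam bc
  refine ⟨c₂ * (Real.sqrt A + 1) * (2 + lam / 2), by positivity, a, ha, fun y₀ hy₀ hbc hR => ?_⟩
  obtain ⟨w, hw, hw2⟩ := exists_embed_eq (lam := lam) hL hy₀ hbc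
  obtain ⟨z, hz0, hzc, hzd, hzb⟩ := hz _ hR
  obtain ⟨Y, hY, hYle⟩ := hsol w z (by rw [hz0, hw]) hzc
    (fun t ht => by simpa only [hμσ] using hzd t ht) fun t ht => by
      rw [hz0]
      refine (hzb t ht).trans ?_
      have : a ≤ a₁ := min_le_left _ _
      gcongr
  rw [hw] at hY
  refine ⟨fun t => embed L lam bc (Y t), fun T hT => ⟨hY T hT, fun v hv =>
    (hY T hT).eqOn hL hℓ he hT.le hv⟩, fun t ht => ?_⟩
  have h1 : ‖Y t‖ ≤ (Real.sqrt A + 1) * Real.exp (-a * t) * ‖w‖ := by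
    refine abs_le_of_sq_le_sq' ?_ (by positivity) |>.2
    have e1 : Real.exp (-(2 * a) * t) = Real.exp (-a * t) ^ 2 := by
      rw [← Real.exp_nat_mul]
      congr 1
      push_cast
      ring
    have h2 : A ≤ (Real.sqrt A + 1) ^ 2 := by
      nlinarith [Real.sq_sqrt hA, Real.sqrt_nonneg A]
    calc _ ≤ _ := hYle t ht.le
      _ ≤ Real.exp (-a * t) ^ 2 * ((Real.sqrt A + 1) ^ 2 * ‖w‖ ^ 2) := by
          rw [e1]
          gcongr
      _ = _ := by ring
  calc _ ≤ c₂ * ‖Y t‖ := hH2 (Y t)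
    _ ≤ c₂ * ((Real.sqrt A + 1) * Real.exp (-a * t) * ((2 + lam / 2) * sobolevNorm L 2 y₀)) := by
        gcongr
        exact h1.trans (by gcongr; exact norm_formSpace_le hlam.le hw hw2)
    _ = _ := by ring
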